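/- Let $\mathbb F$ be a field. A tensor of dimension $n$ is a trilinear form $T=\sum_{i,j,k\in[n]}a_{ijk}X_iY_jZ_k:\mathbb F^n\times\mathbb F^n\times\mathbb F^n\to\mathbb F$. It has rank one if $T=(\sum_i a_iX_i)(\sum_j b_jY_j)(\sum_k c_kZ_k)$ for some $a,b,c\in\mathbb F^n$; its rank $\mathbf R(T)$ is the least $r$ such that $T$ is a linear combination of $r$ rank-one tensors; $T^{\otimes r}$ is its $r$-fold Kronecker product, and its asymptotic rank is $\lim_{r\to\infty}\mathbf R(T^{\otimes r})^{1/r}$. The tensor $T$ is concise if for all choices of bases of the three copies of $\mathbb F^n$ every variable occurs in a monomial of $T$ with nonzero coefficient, and tight if for some choice of the three bases there are injective functions $f,g,h:[n]\to\mathbb Z$ with $f(i)+g(j)+h(k)=0$ for all monomials $X_iY_jZ_k$ that have a nonzero coefficient. Assume Strassen's asymptotic rank conjecture over $\mathbb F$: for every $n$, every tight and concise tensor of dimension $n$ over $\mathbb F$ has asymptotic rank $n$. Then for every fixed $\varepsilon>0$ and $s\in\mathbb N$ there is a randomized algorithm for $s$-set cover with running time $O\big((3/2^{2/3}+\varepsilon)^n\big)$,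 where the implied constant depends only on $\mathbb F$, $\varepsilon$ and $s$. Here $s$-set cover is the following problem: given $n,t\in\mathbb N$ and a family $\mathcal F\subseteq 2^{[n]}$ (listed without repetition) of sets of size at most $s$, decide whether there are at most $t$ sets in $\mathcal F$ whose union is $[n]$. A randomized algorithm is a program for a random access machine with logarithmic cost and fair random bits which obeys the time bound for every outcome of the random bits, never accepts a no-instance, and accepts every yes-instance with probability at least $2/3$. -/

import Mathlib

open Filter Topology MeasureTheory

/-! ### Tensors, tensor rank, asymptotic rank -/

/-- A tensor (trilinear form `∑ a i j k X_i Y_j Z_k` in three disjoint sets of variables, each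
indexed by `ι`), given by its coefficients. A tensor of dimension `n` has `ι = Fin n`. -/
abbrev Tensor3 (F ι : Type*) := ι → ι → ι → F

namespace Tensor3

variable {F ι : Type*} [Field F] [Fintype ι]

/-- The trilinear form `F^ι × F^ι × F^ι → F` of a tensor. -/
def form (T : Tensor3 F ι) (x y z : ι → F) : F :=
  ∑ i, ∑ j, ∑ k, T i j k * x i * y j * z k

/-- The coefficients of the trilinear form `T` with respect to three bases of `F^ι`. -/
noncomputable def coeffIn (T : Tensor3 F ι) (b₁ b₂ b₃ : Module.Basis ι F (ι → F)) : Tensor3 F ι :=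
  fun i j k => T.form (b₁ i) (b₂ j) (b₃ k)

/-- `T` is concise: for all choices of bases, every variable of each of the three sets occurs
in some monomial of the support. -/
def IsConcise (T : Tensor3 F ι) : Prop :=
  ∀ b₁ b₂ b₃ : Module.Basis ι F (ι → F),
    (∀ i, ∃ j k, T.coeffIn b₁ b₂ b₃ i j k ≠ 0) ∧
    (∀ j, ∃ i k, T.coeffIn b₁ b₂ b₃ i j k ≠ 0) ∧
    (∀ k, ∃ i j, T.coeffIn b₁ b₂ b₃ i j k ≠ 0)

/-- `T` is tight: for some choice of bases there are injective integer labellings of the three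
sets of variables whose sum vanishes on the support. -/
def IsTight (T : Tensor3 F ι) : Prop :=
  ∃ b₁ b₂ b₃ : Module.Basis ι F (ι → F), ∃ f g h : ι → ℤ,
    Function.Injective f ∧ Function.Injective g ∧ Function.Injective h ∧
    ∀ i j k, T.coeffIn b₁ b₂ b₃ i j k ≠ 0 → f i + g j + h k = 0

end Tensor3

namespace Tensor3

variable {F ι : Type*} [Field F]

/-- `T` has rank one: `T = (∑ a_i X_i) (∑ b_j Y_j) (∑ c_k Z_k)`. -/
def IsRankOne (T : Tensor3 F ι) : Prop :=
  ∃ a b c : ι → F, ∀ i j k, T i j k = a i * b j * c k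

/-- The tensor rank: the least `r` such that `T` is a linear combination of `r` rank-one
tensors. -/
noncomputable def rank (T : Tensor3 F ι) : ℕ :=
  sInf {r : ℕ | ∃ (w : Fin r → F) (S : Fin r → Tensor3 F ι),
    (∀ l, (S l).IsRankOne) ∧ ∀ i j k, T i j k = ∑ l, w l * S l i j k}

/-- The `r`-fold Kronecker product of `T` with itself; its variables are indexed by `ι^r`. -/
def kronPow (T : Tensor3 F ι) (r : ℕ) : Tensor3 F (Fin r → ι) :=
  fun i j k => ∏ m, T (i m) (j m) (k m)

/-- The asymptotic rank of `T` is `x`: `R(T^{⊗ r})^{1/r} → x` as `r → ∞`. -/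
def HasAsymptoticRank (T : Tensor3 F ι) (x : ℝ) : Prop :=
  Tendsto (fun r : ℕ => ((T.kronPow r).rank : ℝ) ^ (1 / (r : ℝ))) atTop (𝓝 x)

end Tensor3

/-- Strassen's asymptotic rank conjecture over the field `F`: every tight and concise tensor of
dimension `n` has asymptotic rank `n`. -/
def AsymptoticRankConjecture (F : Type*) [Field F] : Prop :=
  ∀ (n : ℕ) (T : Tensor3 F (Fin n)), T.IsTight → T.IsConcise → T.HasAsymptoticRank n

/-! ### Randomized random access machines with logarithmic cost -/

namespace RAM

/-- The arithmetic operations on natural numbers (subtraction is truncated at zero, and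
division rounds down). -/
inductive Op
  | plus
  | minus
  | times
  | quot
  | rem

/-- The value of an arithmetic operation. -/
def Op.eval : Op → ℕ → ℕ → ℕ
  | .plus, a, b => a + b
  | .minus, a, b => a - b
  | .times, a, b => a * b
  | .quot, a, b => a / b
  | .rem, a, b => a % b

/-- Programs of a randomized random access machine. A program uses finitely many registers
`r_0, r_1, …` and an unbounded memory with indirect addressing. -/
inductive Prog
  /-- `r_d := c` -/
  | const (d c : ℕ)
  /-- `r_d := r_a ∘ r_b` -/
  | arith (o : Op) (d a b : ℕ)
  /-- `r_d := mem[r_a]` -/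
  | load (d a : ℕ)
  /-- `mem[r_a] := r_b` -/
  | store (a b : ℕ)
  /-- `r_d :=` a fair random bit -/
  | coin (d : ℕ)
  /-- first `p`, then `q` -/
  | seq (p q : Prog)
  /-- `if r_a ≠ 0 then p else q` -/
  | branch (a : ℕ) (p q : Prog)
  /-- `while r_a ≠ 0 do p` -/
  | loop (a : ℕ) (p : Prog)

/-- A state of the machine: registers, memory, and the random bits not yet used. -/
structure State where
  reg : ℕ → ℕ
  mem : ℕ → ℕ
  coins : ℕ → Bool

/-- The state with register `d` overwritten by `v`. -/
def State.setReg (σ : State) (d v : ℕ) : State :=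
  { σ with reg := Function.update σ.reg d v }

/-- `Exec p σ c τ`: started in the state `σ`, the program `p` halts in the state `τ`, at total
logarithmic cost `c`. Every elementary step costs one plus the bit lengths of all numbers and
addresses that it handles. -/
inductive Exec : Prog → State → ℕ → State → Prop
  | const (σ : State) (d v : ℕ) :
      Exec (.const d v) σ (1 + v.size) (σ.setReg d v)
  | arith (σ : State) (o : Op) (d a b : ℕ) :
      Exec (.arith o d a b) σ
        (1 + (σ.reg a).size + (σ.reg b).size + (o.eval (σ.reg a) (σ.reg b)).size)
        (σ.setReg d (o.eval (σ.reg a) (σ.reg b)))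
  | load (σ : State) (d a : ℕ) :
      Exec (.load d a) σ (1 + (σ.reg a).size + (σ.mem (σ.reg a)).size)
        (σ.setReg d (σ.mem (σ.reg a)))
  | store (σ : State) (a b : ℕ) :
      Exec (.store a b) σ (1 + (σ.reg a).size + (σ.reg b).size)
        { σ with mem := Function.update σ.mem (σ.reg a) (σ.reg b) }
  | coin (σ : State) (d : ℕ) :
      Exec (.coin d) σ 1
        { σ.setReg d (σ.coins 0).toNat with coins := fun i => σ.coins (i + 1) }
  | seq {p q : Prog} {σ τ υ : State} {c c' : ℕ} :
      Exec p σ c τ → Exec q τ c' υ → Exec (.seq p q) σ (c + c') υ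
  | branch_true {a : ℕ} {p q : Prog} {σ τ : State} {c : ℕ} :
      σ.reg a ≠ 0 → Exec p σ c τ → Exec (.branch a p q) σ (1 + (σ.reg a).size + c) τ
  | branch_false {a : ℕ} {p q : Prog} {σ τ : State} {c : ℕ} :
      σ.reg a = 0 → Exec q σ c τ → Exec (.branch a p q) σ (1 + c) τ
  | loop_true {a : ℕ} {p : Prog} {σ τ υ : State} {c c' : ℕ} :
      σ.reg a ≠ 0 → Exec p σ c τ → Exec (.loop a p) τ c' υ →
      Exec (.loop a p) σ (1 + (σ.reg a).size + c + c') υ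
  | loop_false {a : ℕ} {p : Prog} {σ : State} :
      σ.reg a = 0 → Exec (.loop a p) σ 1 σ

/-- The initial state: the input is written to the memory cells `0, 1, 2, …`, all other cells
and all registers are zero, and `ω` is the sequence of random bits. -/
def initial (input : List ℕ) (ω : ℕ → Bool) : State where
  reg := fun _ => 0
  mem := fun i => input.getD i 0
  coins := ω

/-- On the random bits `ω`, the program halts on the input with the answer "yes", that is with
`1` in register `0`. -/
def Accepts (p : Prog) (input : List ℕ) (ω : ℕ → Bool) : Prop :=
  ∃ c τ, Exec p (initial input ω) c τ ∧ τ.reg 0 = 1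

/-- On the random bits `ω`, the program halts on the input at cost at most `B`. -/
def HaltsWithin (p : Prog) (input : List ℕ) (ω : ℕ → Bool) (B : ℝ) : Prop :=
  ∃ c τ, Exec p (initial input ω) c τ ∧ (c : ℝ) ≤ B

/-- The distribution of an infinite sequence of independent fair random bits. -/
noncomputable def fairCoins : Measure (ℕ → Bool) :=
  Measure.infinitePi fun _ => (PMF.uniformOfFintype Bool).toMeasure

/-- The program `p` is a randomized algorithm for the decision problem `yes`, whose instances
are encoded by `enc`, with running time `B`: on the instance `x` it halts at cost at most `B x`
whatever the random bits are, it accepts every yes-instance with probability at least `2/3`, and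
it never accepts a no-instance. -/
def IsRandomizedAlgorithm {α : Type*} (p : Prog) (enc : α → List ℕ) (yes : α → Prop)
    (B : α → ℝ) : Prop :=
  ∀ x : α,
    (∀ ω, HaltsWithin p (enc x) ω (B x)) ∧
    (yes x → 2 / 3 ≤ fairCoins {ω | Accepts p (enc x) ω}) ∧
    (¬ yes x → ∀ ω, ¬ Accepts p (enc x) ω)

end RAM

/-! ### Set cover -/

/-- An instance of `s`-set cover: `t ∈ ℕ` and a family of subsets of `[n]`, each of size at most
`s`, listed in any order without repetition. -/
structure SetCoverInstance (s : ℕ) where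
  n : ℕ
  t : ℕ
  family : List (Finset (Fin n))
  nodup : family.Nodup
  card_le : ∀ X ∈ family, X.card ≤ s

namespace SetCoverInstance

variable {s : ℕ}

/-- There exist at most `t` sets in the family whose union is `[n]`. -/
def IsYes (I : SetCoverInstance s) : Prop :=
  ∃ G : Finset (Finset (Fin I.n)),
    (∀ X ∈ G, X ∈ I.family) ∧ G.card ≤ I.t ∧ G.biUnion id = Finset.univ

/-- The encoding of an instance: `n`, the number of sets, the characteristic vectors of the sets,
and the binary digits of `t` (least significant first), where the digits `0, 1` are written as
`1, 2`, so that the empty cells behind them mark their end. -/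
def encode (I : SetCoverInstance s) : List ℕ :=
  [I.n, I.family.length] ++
    (I.family.flatMap fun X => List.ofFn fun i : Fin I.n => if i ∈ X then 1 else 0) ++
    (Nat.digits 2 I.t).map (· + 1)

end SetCoverInstance

/-! Put γ = 3/2^(2/3). Pad the ground set and cut it into intervals of 3h points, where h is a large
constant. In a cover assign each element to one chosen set containing it; this groups the elements
into items of bounded size. By the Beck–Fiala theorem the items can be coloured with three colours
so that every colour meets every interval in at most h + O(s) points (`exists_rounding`,
`exists_three_coloring`). Hence a yes-instance yields a partition of the padded ground set into
three sets that are small in every interval, covered by t₁, t₂, t₃ sets with t₁ + t₂ + t₃ = min t n,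
and conversely such a partition gives a cover (`SetCoverInstance.exists_partition_of_isYes`,
`SetCoverInstance.isYes_of_partition`).

With d = 2(s + 1), at most γ^(3h) 2^d subsets of an interval have at most h + d points
(`card_small_sets_le`). The tensor that records which triples of nearly balanced sets partition the
interval is concise, since two parts determine the third, and tight, since a set can be labelled by
its binary number. Strassen's conjecture therefore says that its asymptotic rank is its dimension D,
so some fixed Kronecker power r has rank at most (2D)^r (`exists_partition_decomposition`). Only
this one finite decomposition is used, and it can be hard-wired into the program. Its coefficients
generate a finitely generated ring, which has a finite residue field by the Nullstellensatz over ℤ,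
so the arithmetic takes place in a finite field (`exists_finite_field_decomposition`). For every g >
γ this gives a constant block length b = 3hr and a table size Q ≤ g^b that bounds both the number of
masks of a block and the length of the decomposition (`exists_blockData`).

An instance has m = n/b + 1 blocks, rounded down, hence L = Q^m ≤ Q g^n numbered masks. Masks with
small pieces are closed under subsets, so dynamic programming over them decides which masks can be
covered by τ sets. For each guess of t₁, t₂, t₃, put random bits on the masks that can be covered
and evaluate the m-fold Kronecker power of the block tensor there. Yates' algorithm applies the
Kronecker power of each of the three Q × Q coefficient matrices in m passes (`yatesPass_iterate`),
so the evaluation takes O(mL) field operations. A nonzero value exhibits a cover. If a suitable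
partition exists, the form is multilinear with a nonzero coefficient at three bits; whatever the
other bits are, one of the eight settings of these three gives a nonzero value. Nine independent
evaluations thus fail with probability at most (7/8)^9 < 1/3 (`RAM.two_thirds_le_of_flips`).

To obtain an actual machine program with logarithmic cost, the algorithm is written in a language
with arrays and counted loops. `Stmt.exec` compiles this language once and for all with a cost
bound, `Setting.Good` is a program logic for correctness, absence of overflow and step counts, and
`Stmt.CostBound` evaluates the step counts. -/

/-! ### A small imperative language with arrays, compiled to the random access machine -/

namespace ArrayLang

open RAM (Prog State Exec Op)

/-- States of array programs: variables, the read-only input, eight arrays, and the number of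
random bits used so far. -/
structure St where
  v : ℕ → ℕ
  inp : ℕ → ℕ
  arr : Fin 8 → ℕ → ℕ
  pos : ℕ

/-- Overwrite a variable. -/
def St.setv (st : St) (x a : ℕ) : St := { st with v := Function.update st.v x a }

/-- Overwrite an array entry. -/
def St.seta (st : St) (k : Fin 8) (i a : ℕ) : St :=
  { st with arr := Function.update st.arr k (Function.update (st.arr k) i a) }

/-- Arithmetic expressions. -/
inductive Expr
  | lit (c : ℕ)
  | var (x : ℕ)
  | op (o : Op) (e f : Expr)
  | get (k : Fin 8) (e : Expr)
  | inp (e : Expr)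

namespace Expr

/-- The value of an expression. -/
def eval (st : St) : Expr → ℕ
  | lit c => c
  | var x => st.v x
  | op o e f => o.eval (e.eval st) (f.eval st)
  | get k e => st.arr k (e.eval st)
  | inp e => st.inp (e.eval st)

/-- A measure of size, which bounds evaluation time and bit lengths of values. -/
def len : Expr → ℕ
  | lit c => c.size + 1
  | var _ => 1
  | op _ e f => e.len + f.len + 1
  | get _ e => e.len + 1
  | inp e => e.len + 1

/-- All input cells that are read have addresses below `Z`. -/
def Ok (Z : ℕ) (st : St) : Expr → Prop
  | lit _ => True
  | var _ => True
  | op _ e f => e.Ok Z st ∧ f.Ok Z st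
  | get _ e => e.Ok Z st
  | inp e => e.Ok Z st ∧ e.eval st < Z

/-- Code which puts the value of the expression into the scratch register number `d`. -/
def code : Expr → ℕ → Prog
  | lit c, d => .const (2 * d + 1) c
  | var x, d => .seq (.const (2 * d + 1) 0) (.arith .plus (2 * d + 1) (2 * x) (2 * d + 1))
  | op o e f, d => .seq (e.code d) (.seq (f.code (d + 1))
      (.arith o (2 * d + 1) (2 * d + 1) (2 * d + 3)))
  | get k e, d => .seq (e.code d) (.seq (.const (2 * d + 3) 8)
      (.seq (.arith .times (2 * d + 1) (2 * d + 1) (2 * d + 3))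
      (.seq (.arith .plus (2 * d + 1) 1 (2 * d + 1))
      (.seq (.const (2 * d + 3) k)
      (.seq (.arith .plus (2 * d + 1) (2 * d + 1) (2 * d + 3))
      (.load (2 * d + 1) (2 * d + 1)))))))
  | inp e, d => .seq (e.code d) (.load (2 * d + 1) (2 * d + 1))

end Expr

/-- Array programs, in which all loops are counted. -/
inductive Stmt
  | set (x : ℕ) (e : Expr)
  | put (k : Fin 8) (e f : Expr)
  | flip (x : ℕ)
  | seq (p q : Stmt)
  | forTo (x : ℕ) (e : Expr) (p : Stmt)

/-- Apply `g 0`, `g 1`, …, `g (n - 1)` in this order. -/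
def iter (g : ℕ → St → St) : ℕ → St → St
  | 0, st => st
  | n + 1, st => g n (iter g n st)

namespace Stmt

/-- The state after running a program. -/
def run (ω : ℕ → Bool) : Stmt → St → St
  | set x e, st => st.setv x (e.eval st)
  | put k e f, st => st.seta k (e.eval st) (f.eval st)
  | flip x, st => { st.setv x (ω st.pos).toNat with pos := st.pos + 1 }
  | seq p q, st => q.run ω (p.run ω st)
  | .forTo x e p, st => iter (fun i s => p.run ω (s.setv x i)) (e.eval st) st

/-- The number of steps of a program. -/
def steps (ω : ℕ → Bool) : Stmt → St → ℕ
  | set _ e, _ => e.len + 1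
  | put _ e f, _ => e.len + f.len + 1
  | flip _, _ => 1
  | seq p q, st => p.steps ω st + q.steps ω (p.run ω st)
  | .forTo x e p, st => e.len + 1 + ∑ i ∈ Finset.range (e.eval st),
      (p.steps ω ((iter (fun i s => p.run ω (s.setv x i)) i st).setv x i) + 1)

/-- All values that are assigned are below `2 ^ w`, and the input is read below `Z` only. -/
def Fits (ω : ℕ → Bool) (w Z : ℕ) : Stmt → St → Prop
  | set _ e, st => e.Ok Z st ∧ e.eval st < 2 ^ w
  | put _ e f, st => e.Ok Z st ∧ f.Ok Z st ∧ f.eval st < 2 ^ w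
  | flip _, _ => True
  | seq p q, st => p.Fits ω w Z st ∧ q.Fits ω w Z (p.run ω st)
  | .forTo x e p, st => e.Ok Z st ∧ e.eval st < 2 ^ w ∧ ∀ i < e.eval st,
      p.Fits ω w Z ((iter (fun i s => p.run ω (s.setv x i)) i st).setv x i)

/-- A bound for the sizes of the expressions in a program. -/
def width : Stmt → ℕ
  | set _ e => e.len
  | put _ e f => e.len + f.len
  | flip _ => 1
  | seq p q => p.width + q.width
  | .forTo _ e p => e.len + p.width

/-- Code for a program, which uses scratch registers from number `d` on. -/
def code : Stmt → ℕ → Prog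
  | set x e, d => .seq (e.code d) (.seq (.const (2 * d + 3) 0)
      (.arith .plus (2 * x) (2 * d + 1) (2 * d + 3)))
  | put k e f, d => .seq (e.code d) (.seq (.const (2 * d + 3) 8)
      (.seq (.arith .times (2 * d + 1) (2 * d + 1) (2 * d + 3))
      (.seq (.arith .plus (2 * d + 1) 1 (2 * d + 1))
      (.seq (.const (2 * d + 3) k)
      (.seq (.arith .plus (2 * d + 1) (2 * d + 1) (2 * d + 3))
      (.seq (f.code (d + 1))
      (.store (2 * d + 1) (2 * d + 3))))))))
  | flip x, _ => .coin (2 * x)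
  | seq p q, d => .seq (p.code d) (q.code d)
  | .forTo x e p, d => .seq (e.code d) (.seq (.const (2 * d + 3) 0) (.loop (2 * d + 1)
      (.seq (.const (2 * d + 5) 0) (.seq (.arith .plus (2 * x) (2 * d + 3) (2 * d + 5))
      (.seq (p.code (d + 2)) (.seq (.const (2 * d + 5) 1)
      (.seq (.arith .plus (2 * d + 3) (2 * d + 3) (2 * d + 5))
      (.arith .minus (2 * d + 1) (2 * d + 1) (2 * d + 5)))))))))

end Stmt

/-! ### Correctness and cost of the compiled code -/

/-- All stored values are below `2 ^ w`. -/
structure St.Bdd (w Z : ℕ) (st : St) : Prop where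
  v : ∀ x, st.v x < 2 ^ w
  inp : ∀ a < Z, st.inp a < 2 ^ w
  arr : ∀ k i, st.arr k i < 2 ^ w

/-- The machine state `σ` represents the state `st`; array entries are stored from address `Z`
on, and `Z` is kept in register `1`. -/
structure Agree (ω : ℕ → Bool) (Z : ℕ) (σ : State) (st : St) : Prop where
  reg : ∀ x, σ.reg (2 * x) = st.v x
  base : σ.reg 1 = Z
  inp : ∀ a < Z, σ.mem a = st.inp a
  arr : ∀ (k : Fin 8) i, σ.mem (Z + i * 8 + k) = st.arr k i
  coins : σ.coins = fun i => ω (st.pos + i)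

theorem St.Bdd.setv {w Z : ℕ} {st : St} (h : st.Bdd w Z) {a : ℕ} (x : ℕ) (ha : a < 2 ^ w) :
    (st.setv x a).Bdd w Z := by
  refine ⟨fun y => ?_, h.inp, h.arr⟩
  by_cases hy : y = x
  · subst hy; simpa [St.setv] using ha
  · simpa [St.setv, hy] using h.v y

theorem St.Bdd.seta {w Z : ℕ} {st : St} (h : st.Bdd w Z) {a : ℕ} (k : Fin 8) (i : ℕ)
    (ha : a < 2 ^ w) : (st.seta k i a).Bdd w Z := by
  refine ⟨h.v, h.inp, fun l j => ?_⟩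
  by_cases hl : l = k
  · subst hl
    by_cases hj : j = i
    · subst hj; simpa [St.seta] using ha
    · simpa [St.seta, hj] using h.arr l j
  · simpa [St.seta, hl] using h.arr l j

theorem Expr.len_pos (e : Expr) : 0 < e.len := by
  cases e <;> simp [Expr.len]

/-- Only stored values are known to have `w` bits; intermediate results may be longer. A product
adds the bit lengths and a sum needs one more bit than its longer argument, which is what the
additive measure `len` accounts for. -/
theorem Expr.eval_lt {w Z : ℕ} {st : St} (h : st.Bdd w Z) (e : Expr) (he : e.Ok Z st) :
    e.eval st < 2 ^ (e.len * (w + 1)) := by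
  have key : ∀ a n : ℕ, a < 2 ^ w → 1 ≤ n → a < 2 ^ (n * (w + 1)) := fun a n ha hn =>
    ha.trans_le (Nat.pow_le_pow_right (by norm_num) (by nlinarith))
  induction e with
  | lit c =>
    simp only [eval, len]
    exact (Nat.lt_size_self c).trans_le (Nat.pow_le_pow_right (by norm_num) (by nlinarith))
  | var x => exact key _ _ (h.v x) le_rfl
  | op o e f ihe ihf =>
    have h1 := ihe he.1
    have h2 := ihf he.2
    simp only [eval, len]
    have h3 : (2 : ℕ) ^ (e.len * (w + 1)) ≤ 2 ^ ((e.len + f.len) * (w + 1)) :=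
      Nat.pow_le_pow_right (by norm_num) (by nlinarith)
    have h4 : (2 : ℕ) ^ (f.len * (w + 1)) ≤ 2 ^ ((e.len + f.len) * (w + 1)) :=
      Nat.pow_le_pow_right (by norm_num) (by nlinarith)
    have h5 : (2 : ℕ) ^ ((e.len + f.len) * (w + 1)) * 2 ≤ 2 ^ ((e.len + f.len + 1) * (w + 1)) := by
      rw [← pow_succ]
      exact Nat.pow_le_pow_right (by norm_num) (by nlinarith)
    cases o with
    | plus => simp only [RAM.Op.eval]; omega
    | minus => simp only [RAM.Op.eval]; omega
    | times =>
      simp only [RAM.Op.eval]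
      calc eval st e * eval st f < 2 ^ (e.len * (w + 1)) * 2 ^ (f.len * (w + 1)) :=
            Nat.mul_lt_mul'' h1 h2
        _ = 2 ^ ((e.len + f.len) * (w + 1)) := by rw [← pow_add]; ring_nf
        _ ≤ _ := by omega
    | quot =>
      simp only [RAM.Op.eval]
      have := Nat.div_le_self (eval st e) (eval st f)
      omega
    | rem =>
      simp only [RAM.Op.eval]
      have := Nat.mod_le (eval st e) (eval st f)
      omega
  | get k e ih => exact key _ _ (h.arr k _) (by simp [len])
  | inp e ih => exact key _ _ (h.inp _ he.2) (by simp [len])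

theorem Expr.size_eval_le {w Z : ℕ} {st : St} (h : st.Bdd w Z) (e : Expr) (he : e.Ok Z st) :
    (e.eval st).size ≤ e.len * (w + 1) :=
  Nat.size_le.2 (e.eval_lt h he)

theorem size_add_le (a b : ℕ) : (a + b).size ≤ a.size + b.size + 1 := by
  rw [Nat.size_le]
  have h1 := Nat.lt_size_self a
  have h2 := Nat.lt_size_self b
  have h3 : (2 : ℕ) ^ a.size ≤ 2 ^ (a.size + b.size) := Nat.pow_le_pow_right (by norm_num) (by omega)
  have h4 : (2 : ℕ) ^ b.size ≤ 2 ^ (a.size + b.size) := Nat.pow_le_pow_right (by norm_num) (by omega)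
  rw [pow_succ]; omega

theorem size_mul_le (a b : ℕ) : (a * b).size ≤ a.size + b.size := by
  rw [Nat.size_le, pow_add]
  exact Nat.mul_lt_mul'' (Nat.lt_size_self a) (Nat.lt_size_self b)

theorem size_fin_le (k : Fin 8) : (k : ℕ).size ≤ 3 :=
  Nat.size_le.2 k.2

/-- The address computation `r := Z + 8 r + k`. -/
theorem exec_address (σ : State) (k : Fin 8) (d : ℕ) (hd : 0 < d) {p : Prog} {c : ℕ} {τ : State}
    (h : Exec p ((σ.setReg (2 * d + 1) (σ.reg 1 + σ.reg (2 * d + 1) * 8 + k)).setReg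
      (2 * d + 3) k) c τ) :
    ∃ c', Exec (.seq (.const (2 * d + 3) 8)
      (.seq (.arith .times (2 * d + 1) (2 * d + 1) (2 * d + 3))
      (.seq (.arith .plus (2 * d + 1) 1 (2 * d + 1))
      (.seq (.const (2 * d + 3) k)
      (.seq (.arith .plus (2 * d + 1) (2 * d + 1) (2 * d + 3)) p))))) σ c' τ ∧
      c' ≤ c + 9 * ((σ.reg (2 * d + 1)).size + (σ.reg 1).size) + 60 := by
  set a := σ.reg (2 * d + 1) with ha
  set Z := σ.reg 1 with hZ
  have e1 : (2 * d + 1 = 2 * d + 3) = False := by simp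
  have e2 : (1 = 2 * d + 1) = False := by simp; omega
  have e3 : (1 = 2 * d + 3) = False := by simp
  have e4 : (2 * d + 3 = 2 * d + 1) = False := by simp
  refine ⟨_, .seq (.const _ _ _) (.seq (.arith _ _ _ _ _) (.seq (.arith _ _ _ _ _)
    (.seq (.const _ _ _) (.seq (.arith _ _ _ _ _) (c' := c) (υ := τ) ?_)))), ?_⟩
  · convert h using 1
    simp only [State.setReg, RAM.Op.eval, Function.update_apply, e1, e2, e3, e4, if_true, if_false,
      ← ha, ← hZ]
    congr 1
    funext x
    simp only [Function.update_apply]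
    split_ifs <;> first | rfl | omega
  · simp only [State.setReg, RAM.Op.eval, Function.update_apply, e1, e2, e3, e4, if_true, if_false,
      ← ha, ← hZ]
    have h1 := size_mul_le a 8
    have h2 := size_add_le Z (a * 8)
    have h3 := size_add_le (Z + a * 8) k
    have h4 := size_fin_le k
    have h5 : Nat.size 8 = 4 := by decide
    omega

/-- Variables live in even registers and the base address in register 1, so code that changes only
odd registers from 2d + 1 on, with d > 0, does not affect the represented state. -/
theorem Agree.of_eq {ω : ℕ → Bool} {Z : ℕ} {st : St} {σ τ : State} (d : ℕ) (hd : 0 < d)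
    (h : Agree ω Z σ st) (h1 : τ.mem = σ.mem) (h2 : τ.coins = σ.coins)
    (h3 : ∀ r, (r % 2 = 0 ∨ r < 2 * d + 1) → τ.reg r = σ.reg r) : Agree ω Z τ st := by
  refine ⟨fun x => ?_, ?_, ?_, ?_, ?_⟩
  · rw [h3 _ (Or.inl (by omega)), h.reg]
  · rw [h3 _ (Or.inr (by omega)), h.base]
  · rw [h1]; exact h.inp
  · rw [h1]; exact h.arr
  · rw [h2]; exact h.coins

/-- The preservation of registers below 2d + 1 is what makes the induction work: the left operand
waits in scratch register d while the right one is computed from d + 1 on. Each node uses boundedly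
many instructions on numbers of O(ℓ(w + 1)) bits. -/
theorem Expr.exec {ω : ℕ → Bool} {w Z ℓ : ℕ} (hZ : Z < 2 ^ w) {st : St} (hst : st.Bdd w Z)
    (e : Expr) (he : e.Ok Z st) (hl : e.len ≤ ℓ) (d : ℕ) (hd : 0 < d) (σ : State)
    (hσ : Agree ω Z σ st) :
    ∃ c τ, Exec (e.code d) σ c τ ∧ c ≤ e.len * (100 * (ℓ * (w + 1) + 1)) ∧
      τ.mem = σ.mem ∧ τ.coins = σ.coins ∧
      (∀ r, (r % 2 = 0 ∨ r < 2 * d + 1) → τ.reg r = σ.reg r) ∧ τ.reg (2 * d + 1) = e.eval st := by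
  have hZs : Z.size ≤ w := Nat.size_le.2 hZ
  have hw : 0 < ℓ := lt_of_lt_of_le e.len_pos hl
  have hwl : w + 1 ≤ ℓ * (w + 1) := Nat.le_mul_of_pos_left _ hw
  induction e generalizing d σ with
  | lit c =>
    refine ⟨_, _, .const _ _ _, ?_, rfl, rfl, fun r hr => ?_, ?_⟩
    · simp only [len] at hl ⊢
      nlinarith
    · have : r ≠ 2 * d + 1 := by omega
      simp [State.setReg, this]
    · simp [State.setReg, eval]
  | var x =>
    refine ⟨_, _, .seq (.const _ _ _) (.arith _ _ _ _ _), ?_, rfl, rfl, fun r hr => ?_, ?_⟩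
    · have h1 : 2 * x ≠ 2 * d + 1 := by omega
      have h2 : (st.v x).size ≤ w := Nat.size_le.2 (hst.v x)
      simp only [State.setReg, RAM.Op.eval, Function.update_apply, h1, if_true, if_false, hσ.reg,
        Nat.add_zero, Nat.size_zero, len]
      omega
    · have : r ≠ 2 * d + 1 := by omega
      simp [State.setReg, this]
    · have h1 : 2 * x ≠ 2 * d + 1 := by omega
      simp [State.setReg, eval, RAM.Op.eval, h1, hσ.reg]
  | op o e f ihe ihf =>
    simp only [len] at hl
    obtain ⟨c1, σ1, x1, b1, m1, k1, r1, v1⟩ := ihe he.1 (by omega) d hd σ hσ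
    have hσ1 := hσ.of_eq d hd m1 k1 r1
    obtain ⟨c2, σ2, x2, b2, m2, k2, r2, v2⟩ := ihf he.2 (by omega) (d + 1) (by omega) σ1 hσ1
    refine ⟨_, _, .seq x1 (.seq x2 (.arith _ _ _ _ _)), ?_, ?_, ?_, fun r hr => ?_, ?_⟩
    · have s1 := e.size_eval_le hst he.1
      have s2 := f.size_eval_le hst he.2
      have s3 := (Expr.op o e f).size_eval_le hst he
      simp only [len, eval] at s3
      have g1 : e.len * (w + 1) ≤ ℓ * (w + 1) := Nat.mul_le_mul_right _ (by omega)
      have g2 : f.len * (w + 1) ≤ ℓ * (w + 1) := Nat.mul_le_mul_right _ (by omega)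
      have g3 : (e.len + f.len + 1) * (w + 1) ≤ ℓ * (w + 1) := Nat.mul_le_mul_right _ (by omega)
      rw [r2 _ (Or.inr (by omega)), v1, show 2 * d + 3 = 2 * (d + 1) + 1 by ring, v2]
      simp only [len]
      rw [Nat.add_mul, Nat.add_mul]
      omega
    · simp [State.setReg, m1, m2]
    · simp [State.setReg, k1, k2]
    · have : r ≠ 2 * d + 1 := by omega
      simp only [State.setReg, Function.update_apply, this, if_false]
      rw [r2 _ (by omega), r1 _ hr]
    · rw [r2 _ (Or.inr (by omega)), v1, show 2 * d + 3 = 2 * (d + 1) + 1 by ring, v2]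
      simp [State.setReg, eval]
  | get k e ih =>
    simp only [len] at hl
    obtain ⟨c1, σ1, x1, b1, m1, k1, r1, v1⟩ := ih he (by omega) d hd σ hσ
    have hσ1 := hσ.of_eq d hd m1 k1 r1
    obtain ⟨c2, x2, b2⟩ := exec_address σ1 k d hd (.load _ (2 * d + 1) (2 * d + 1))
    refine ⟨_, _, .seq x1 x2, ?_, ?_, ?_, fun r hr => ?_, ?_⟩
    · have e1 : (2 * d + 1 = 2 * d + 3) = False := by simp
      simp only [State.setReg, Function.update_apply, e1, if_true, if_false, hσ1.base, v1,
        hσ1.arr] at b2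
      have s1 := e.size_eval_le hst he
      have s2 : (st.arr k (eval st e)).size ≤ w := Nat.size_le.2 (hst.arr _ _)
      have g1 : e.len * (w + 1) ≤ ℓ * (w + 1) := Nat.mul_le_mul_right _ (by omega)
      have s3 := size_add_le Z (eval st e * 8)
      have s4 := size_add_le (Z + eval st e * 8) k
      have s5 := size_mul_le (eval st e) 8
      have h5 : Nat.size 8 = 4 := by decide
      have h6 := size_fin_le k
      simp only [len]
      rw [Nat.add_mul]
      omega
    · simp [State.setReg, m1]
    · simp [State.setReg, k1]
    · have a1 : r ≠ 2 * d + 1 := by omega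
      have a2 : r ≠ 2 * d + 3 := by omega
      simp only [State.setReg, Function.update_apply, a1, a2, if_false]
      rw [r1 _ hr]
    · simp [State.setReg, hσ1.base, v1, hσ1.arr, eval]
  | inp e ih =>
    simp only [len] at hl
    obtain ⟨c1, σ1, x1, b1, m1, k1, r1, v1⟩ := ih he.1 (by omega) d hd σ hσ
    have hσ1 := hσ.of_eq d hd m1 k1 r1
    refine ⟨_, _, .seq x1 (.load _ _ _), ?_, ?_, ?_, fun r hr => ?_, ?_⟩
    · have s1 := e.size_eval_le hst he.1
      have s2 : (st.inp (eval st e)).size ≤ w := Nat.size_le.2 (hst.inp _ he.2)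
      have g1 : e.len * (w + 1) ≤ ℓ * (w + 1) := Nat.mul_le_mul_right _ (by omega)
      rw [v1, hσ1.inp _ he.2]
      simp only [len]
      rw [Nat.add_mul]
      omega
    · simp [State.setReg, m1]
    · simp [State.setReg, k1]
    · have a1 : r ≠ 2 * d + 1 := by omega
      simp only [State.setReg, Function.update_apply, a1, if_false]
      rw [r1 _ hr]
    · simp [State.setReg, v1, hσ1.inp _ he.2, eval]

theorem Agree.setv {ω : ℕ → Bool} {Z : ℕ} {st : St} {σ : State} (h : Agree ω Z σ st) (x a : ℕ) :
    Agree ω Z (σ.setReg (2 * x) a) (st.setv x a) := by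
  refine ⟨fun y => ?_, ?_, h.inp, h.arr, h.coins⟩
  · simp [State.setReg, St.setv, Function.update_apply, h.reg]
  · have : 1 ≠ 2 * x := by omega
    simp [State.setReg, this, h.base]

theorem Agree.setScratch {ω : ℕ → Bool} {Z : ℕ} {st : St} {σ : State} (h : Agree ω Z σ st)
    {d : ℕ} (hd : 0 < d) (a : ℕ) : Agree ω Z (σ.setReg (2 * d + 1) a) st := by
  refine h.of_eq d hd rfl rfl fun r hr => ?_
  have : r ≠ 2 * d + 1 := by omega
  simp [State.setReg, this]

/-- The eight arrays are interleaved modulo 8 above address `Z`; hence different entries have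
different addresses and no write reaches the input cells below `Z`. -/
theorem Agree.seta {ω : ℕ → Bool} {Z : ℕ} {st : St} {σ : State} (h : Agree ω Z σ st)
    (k : Fin 8) (i a : ℕ) :
    Agree ω Z { σ with mem := Function.update σ.mem (Z + i * 8 + k) a } (st.seta k i a) := by
  refine ⟨h.reg, h.base, fun b hb => ?_, fun l j => ?_, h.coins⟩
  · have : b ≠ Z + i * 8 + k := by omega
    simpa [this, St.seta] using h.inp b hb
  · have := k.2
    have := l.2
    by_cases hl : l = k
    · subst hl
      by_cases hj : j = i
      · subst hj; simp [St.seta]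
      · have : Z + j * 8 + l ≠ Z + i * 8 + l := by omega
        simp [St.seta, hj, h.arr]
    · have : Z + j * 8 + l ≠ Z + i * 8 + k := by
        intro h; apply hl; ext; omega
      simp [St.seta, hl, this, h.arr]

theorem reg_setReg_ne (σ : State) {r d : ℕ} (a : ℕ) (h : r ≠ d) :
    (σ.setReg d a).reg r = σ.reg r := by
  simp [State.setReg, h]

theorem reg_setReg_self (σ : State) (d a : ℕ) : (σ.setReg d a).reg d = a := by
  simp [State.setReg]

/-- Compiled programs compute what they should, and their logarithmic cost is at most the number
of steps times the bit length. -/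
theorem Stmt.exec {ω : ℕ → Bool} {w Z ℓ : ℕ} (hw : 0 < w) (hZ : Z < 2 ^ w) (p : Stmt)
    (hl : p.width ≤ ℓ) (hℓ : 0 < ℓ) {st : St} (hst : st.Bdd w Z) (hp : p.Fits ω w Z st)
    (d : ℕ) (hd : 0 < d) (σ : State) (hσ : Agree ω Z σ st) :
    ∃ c τ, Exec (p.code d) σ c τ ∧ c ≤ p.steps ω st * (200 * (ℓ * (w + 1) + 1)) ∧
      Agree ω Z τ (p.run ω st) ∧ (p.run ω st).Bdd w Z ∧
      (∀ i, i < d → τ.reg (2 * i + 1) = σ.reg (2 * i + 1)) := by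
  have hZs : Z.size ≤ w := Nat.size_le.2 hZ
  have hwl : w + 1 ≤ ℓ * (w + 1) := Nat.le_mul_of_pos_left _ hℓ
  have sz : ∀ {a}, a < 2 ^ w → a.size ≤ w := fun h => Nat.size_le.2 h
  induction p generalizing d σ st with
  | set x e =>
    simp only [width] at hl
    obtain ⟨c1, σ1, x1, b1, m1, k1, r1, v1⟩ := e.exec hZ hst hp.1 hl d hd σ hσ
    have hσ1 := (hσ.of_eq d hd m1 k1 r1)
    refine ⟨_, _, .seq x1 (.seq (.const _ _ _) (.arith _ _ _ _ _)), ?_, ?_, hst.setv _ hp.2, ?_⟩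
    · have s1 := sz hp.2
      have a1 : 2 * d + 1 ≠ 2 * d + 3 := by omega
      simp only [State.setReg, RAM.Op.eval, Function.update_apply, a1, if_false, if_true, v1,
        Nat.size_zero, Nat.add_zero, steps]
      nlinarith
    · have a1 : 2 * d + 1 ≠ 2 * d + 3 := by omega
      have := (hσ1.setScratch (d := d + 1) (by omega) 0).setv x (e.eval st)
      simp (disch := omega) only [reg_setReg_ne, reg_setReg_self, RAM.Op.eval, v1, Nat.add_zero]
      exact this
    · intro i hi
      simp (disch := omega) only [reg_setReg_ne, r1]
  | put k e f =>
    simp only [width] at hl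
    obtain ⟨he, hf, hv⟩ := hp
    obtain ⟨c1, σ1, x1, b1, m1, k1, r1, v1⟩ := e.exec hZ hst he (ℓ := ℓ) (by omega) d hd σ hσ
    have hσ1 := (hσ.of_eq d hd m1 k1 r1)
    set σ2 := (σ1.setReg (2 * d + 1) (σ1.reg 1 + σ1.reg (2 * d + 1) * 8 + k)).setReg
      (2 * d + 3) k with hσ2
    have hσ2' : Agree ω Z σ2 st :=
      (hσ1.setScratch hd _).setScratch (d := d + 1) (by omega) _
    obtain ⟨c3, σ3, x3, b3, m3, k3, r3, v3⟩ :=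
      f.exec hZ hst hf (ℓ := ℓ) (by omega) (d + 1) (by omega) σ2 hσ2'
    have hσ3 := hσ2'.of_eq (d + 1) (by omega) m3 k3 r3
    obtain ⟨c2, x2, b2⟩ := exec_address σ1 k d hd (.seq x3 (.store _ (2 * d + 1) (2 * d + 3)))
    have a1 : 2 * d + 1 ≠ 2 * d + 3 := by omega
    have v4 : σ3.reg (2 * d + 1) = Z + e.eval st * 8 + k := by
      rw [r3 _ (Or.inr (by omega))]
      simp [hσ2, State.setReg, hσ1.base, v1]
    have v3' : σ3.reg (2 * d + 3) = f.eval st := v3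
    refine ⟨_, _, .seq x1 x2, ?_, ?_, hst.seta _ _ hv, ?_⟩
    · have s1 := sz hv
      have s2 := e.size_eval_le hst he
      have g1 : e.len * (w + 1) ≤ ℓ * (w + 1) := Nat.mul_le_mul_right _ (by omega)
      have s3 := size_add_le Z (e.eval st * 8)
      have s4 := size_add_le (Z + e.eval st * 8) k
      have s5 := size_mul_le (e.eval st) 8
      have h5 : Nat.size 8 = 4 := by decide
      have h6 := size_fin_le k
      rw [v1, hσ1.base, v3', v4] at b2
      simp only [steps]
      have e1 : e.len * (200 * (ℓ * (w + 1) + 1)) = 2 * (e.len * (100 * (ℓ * (w + 1) + 1))) := by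
        ring
      have e2 : f.len * (200 * (ℓ * (w + 1) + 1)) = 2 * (f.len * (100 * (ℓ * (w + 1) + 1))) := by
        ring
      rw [Nat.add_mul, Nat.add_mul, e1, e2]
      omega
    · rw [v4, v3']
      exact hσ3.seta _ _ _
    · intro i hi
      change σ3.reg _ = _
      rw [r3 _ (Or.inr (by omega)), hσ2]
      simp (disch := omega) only [reg_setReg_ne, r1]
  | flip x =>
    have h0 : σ.coins 0 = ω st.pos := by simp [hσ.coins]
    refine ⟨_, _, .coin _ _, ?_, ?_, ?_, ?_⟩
    · simp only [steps]; omega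
    · have := hσ.setv x (ω st.pos).toNat
      refine ⟨fun y => ?_, ?_, this.inp, this.arr, ?_⟩
      · change (σ.setReg (2 * x) (σ.coins 0).toNat).reg (2 * y) = _
        rw [h0]; exact this.reg y
      · change (σ.setReg (2 * x) (σ.coins 0).toNat).reg 1 = _
        rw [h0]; exact this.base
      · funext i; simp [run, hσ.coins, Nat.add_comm, Nat.add_left_comm]
    · have : (ω st.pos).toNat < 2 ^ w :=
        (Bool.toNat_lt _).trans_le (Nat.le_self_pow (by omega) 2)
      have := hst.setv x this
      exact ⟨this.v, this.inp, this.arr⟩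
    · intro i hi
      have : 2 * i + 1 ≠ 2 * x := by omega
      simp [State.setReg, this]
  | seq p q ihp ihq =>
    simp only [width] at hl
    obtain ⟨c1, σ1, x1, b1, h1, g1, r1⟩ := ihp (by omega) hst hp.1 d hd σ hσ
    obtain ⟨c2, σ2, x2, b2, h2, g2, r2⟩ := ihq (by omega) g1 hp.2 d hd σ1 h1
    refine ⟨_, _, .seq x1 x2, ?_, h2, g2, fun i hi => (r2 i hi).trans (r1 i hi)⟩
    simp only [steps, Nat.add_mul]
    omega
  | forTo x e p ih =>
    simp only [width] at hl
    obtain ⟨he, hn, hp⟩ := hp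
    obtain ⟨c1, σ1, x1, b1, m1, k1, r1, v1⟩ := e.exec hZ hst he (ℓ := ℓ) (by omega) d hd σ hσ
    have hσ1 := (hσ.of_eq d hd m1 k1 r1)
    set g : ℕ → St → St := fun i s => p.run ω (s.setv x i) with hg
    set n := e.eval st with hndef
    have hn1 : n.size ≤ w := sz hn
    -- Register 2d + 1 holds the number j of remaining rounds and 2d + 3 the round i. The body is
    -- compiled at scratch level d + 2 and cannot touch them; x is only a copy of i, so the body may
    -- even overwrite it.
    have loop : ∀ j i, i + j = n → ∀ σ, Agree ω Z σ (iter g i st) → (iter g i st).Bdd w Z →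
        σ.reg (2 * d + 1) = j → σ.reg (2 * d + 3) = i → ∃ c τ,
        Exec (.loop (2 * d + 1)
          (.seq (.const (2 * d + 5) 0) (.seq (.arith .plus (2 * x) (2 * d + 3) (2 * d + 5))
          (.seq (p.code (d + 2)) (.seq (.const (2 * d + 5) 1)
          (.seq (.arith .plus (2 * d + 3) (2 * d + 3) (2 * d + 5))
          (.arith .minus (2 * d + 1) (2 * d + 1) (2 * d + 5)))))))) σ c τ ∧
        c ≤ (∑ l ∈ Finset.Ico i n, (p.steps ω ((iter g l st).setv x l) + 1)) *
          (200 * (ℓ * (w + 1) + 1)) + 1 ∧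
        Agree ω Z τ (iter g n st) ∧ (iter g n st).Bdd w Z ∧
        (∀ i, i < d → τ.reg (2 * i + 1) = σ.reg (2 * i + 1)) := by
      intro j
      induction j with
      | zero =>
        intro i hi σ h1 h2 h3 h4
        obtain rfl : i = n := by omega
        exact ⟨_, _, .loop_false h3, by omega, h1, h2, fun _ _ => rfl⟩
      | succ j ihj =>
        intro i hi σ h1 h2 h3 h4
        have hin : i < n := by omega
        have hs1 : (σ.reg (2 * d + 1)).size ≤ w := by rw [h3]; exact sz (by omega)
        have hs2 : i.size ≤ w := sz (by omega)
        have hs3 : (i + 1).size ≤ w := sz (by omega)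
        have hs4 : j.size ≤ w := sz (by omega)
        have hs5 : (j + 1).size ≤ w := sz (by omega)
        have a1 : 2 * d + 3 ≠ 2 * d + 5 := by omega
        have a2 : 2 * d + 1 ≠ 2 * d + 5 := by omega
        have a3 : 2 * d + 1 ≠ 2 * d + 3 := by omega
        have a4 : 2 * d + 3 ≠ 2 * x := by omega
        have a5 : 2 * d + 1 ≠ 2 * x := by omega
        have a6 : 2 * d + 5 ≠ 2 * d + 3 := by omega
        have hA := (h1.setScratch (d := d + 2) (by omega) 0).setv x i
        obtain ⟨c2, σ2, x2, b2, hσ2, g2, r2⟩ := ih (by omega) (h2.setv x (a := i) (by omega))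
          (hp i hin) (d + 2) (by omega) _ hA
        have q1 : σ2.reg (2 * d + 1) = j + 1 := by
          rw [r2 d (by omega)]
          simp [State.setReg, a5, h3, show 2 * (d + 2) + 1 = 2 * d + 5 by ring]
        have q2 : σ2.reg (2 * d + 3) = i := by
          rw [show 2 * d + 3 = 2 * (d + 1) + 1 by ring, r2 (d + 1) (by omega)]
          simp [State.setReg, show 2 * (d + 1) + 1 = 2 * d + 3 by ring, a4, h4,
            show 2 * (d + 2) + 1 = 2 * d + 5 by ring]
        have hB := ((hσ2.setScratch (d := d + 2) (by omega) 1).setScratch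
          (d := d + 1) (by omega) (i + 1)).setScratch (d := d) hd j
        obtain ⟨c3, σ3, x3, b3, hσ3, g3, r3⟩ := ihj (i + 1) (by omega) _ hB g2
          (by simp [State.setReg])
          (by simp [State.setReg, show 2 * (d + 1) + 1 = 2 * d + 3 by ring])
        refine ⟨_, _, .loop_true (by omega) (.seq (.const _ _ _) (.seq (.arith _ _ _ _ _)
          (.seq (c := c2) (τ := σ2) ?_ (.seq (.const _ _ _) (.seq (.arith _ _ _ _ _)
          (.arith _ _ _ _ _)))))) (c' := c3) (υ := σ3) ?_, ?_, hσ3, g3, ?_⟩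
        · simp (disch := omega) only [reg_setReg_ne, reg_setReg_self, RAM.Op.eval, h4,
            Nat.add_zero]
          exact x2
        · simp (disch := omega) only [reg_setReg_ne, reg_setReg_self, RAM.Op.eval, q1, q2,
            Nat.add_sub_cancel]
          exact x3
        · have e1 : Nat.size 1 = 1 := by decide
          rw [Finset.sum_eq_sum_Ico_succ_bot hin, Nat.add_mul, Nat.add_mul]
          simp only [State.setReg, RAM.Op.eval, Function.update_apply, a1, a2, a3, a6,
            if_true, if_false, q1, q2, h4, Nat.size_zero, Nat.add_zero, e1, Nat.add_sub_cancel]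
          omega
        · intro l hl
          have b1 : l ≠ d := by omega
          have b2 : l ≠ d + 1 := by omega
          have b3 : l ≠ d + 2 := by omega
          have b4 : 2 * l + 1 ≠ 2 * x := by omega
          rw [r3 l hl]
          simp only [State.setReg, Function.update_apply]
          rw [if_neg (by omega), if_neg (by omega), if_neg (by omega), r2 l (by omega)]
          simp only [State.setReg, Function.update_apply]
          rw [if_neg (by omega), if_neg (by omega)]
    have a2 : 2 * d + 1 ≠ 2 * d + 3 := by omega
    obtain ⟨c2, σ2, x2, b2, h2, g2, r2⟩ := loop n 0 (by omega) (σ1.setReg (2 * d + 3) 0)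
      (hσ1.setScratch (d := d + 1) (by omega) 0) hst
      (by simp (disch := omega) only [reg_setReg_ne, v1]) (by simp [State.setReg])
    refine ⟨_, _, .seq x1 (.seq (.const _ _ _) x2), ?_, h2, g2, ?_⟩
    · have e1 : e.len * (200 * (ℓ * (w + 1) + 1)) = 2 * (e.len * (100 * (ℓ * (w + 1) + 1))) := by
        ring
      simp only [steps, Nat.size_zero, Finset.range_eq_Ico, ← hg, ← hndef]
      rw [Nat.add_mul, Nat.add_mul, e1]
      omega
    · intro i hi
      rw [r2 i hi]
      simp (disch := omega) only [reg_setReg_ne, r1]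

end ArrayLang

/-! ### Rounding with small discrepancy (Beck and Fiala) -/

/-- A nonzero direction in the unit cube can be followed until a new coordinate becomes
integral. -/
theorem exists_move {J : Type*} [Fintype J] (x z : J → ℝ) (hx : ∀ j, 0 ≤ x j ∧ x j ≤ 1)
    (hz : z ≠ 0) :
    ∃ t : ℝ, (∀ j, 0 ≤ x j + t * z j ∧ x j + t * z j ≤ 1) ∧
      ∃ j, z j ≠ 0 ∧ (x j + t * z j = 0 ∨ x j + t * z j = 1) := by
  classical
  have hne : (Finset.univ.filter fun j => z j ≠ 0).Nonempty := by
    by_contra h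
    rw [Finset.not_nonempty_iff_eq_empty, Finset.filter_eq_empty_iff] at h
    exact hz (funext fun j => not_not.1 (h (Finset.mem_univ j)))
  -- The first time at which a moving coordinate leaves [0, 1]: through 1 if z j > 0, through 0 if z
  -- j < 0.
  obtain ⟨j₀, hj₀, hmin⟩ := Finset.exists_min_image _
    (fun j => if 0 < z j then (1 - x j) / z j else x j / (-z j)) hne
  simp only [Finset.mem_filter, Finset.mem_univ, true_and] at hj₀ hmin
  set t := if 0 < z j₀ then (1 - x j₀) / z j₀ else x j₀ / (-z j₀) with ht
  have ht0 : 0 ≤ t := by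
    rw [ht]
    split_ifs with h
    · exact div_nonneg (by linarith [(hx j₀).2]) h.le
    · exact div_nonneg (hx j₀).1 (by linarith)
  refine ⟨t, fun j => ?_, j₀, hj₀, ?_⟩
  · rcases lt_trichotomy (z j) 0 with h | h | h
    · have := hmin j h.ne
      rw [if_neg (not_lt.2 h.le), le_div_iff₀ (by linarith)] at this
      have h2 := (hx j).2
      constructor <;> nlinarith
    · rw [h]; simpa using hx j
    · have := hmin j h.ne'
      rw [if_pos h, le_div_iff₀ h] at this
      have h2 := (hx j).1
      constructor <;> nlinarith
  · rcases lt_or_gt_of_ne hj₀ with h | h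
    · left
      rw [ht, if_neg (not_lt.2 h.le)]
      field_simp
      ring
    · right
      rw [ht, if_pos h]
      field_simp
      ring

/-- The Beck–Fiala argument, by induction on the number of fractional coordinates. A row whose
fractional weight exceeds s is kept exactly balanced; a row of fractional weight at most s can be
ignored, because from then on each coordinate moves by at most 1. -/
theorem exists_rounding {J I : Type*} [Fintype J] [Fintype I] (v : J → I → ℝ)
    (hv : ∀ j i, 0 ≤ v j i) (s : ℝ) (hs0 : 0 ≤ s) (hs : ∀ j, ∑ i, v j i ≤ s) (x : J → ℝ)
    (hx : ∀ j, 0 ≤ x j ∧ x j ≤ 1) :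
    ∃ y : J → ℝ, (∀ j, y j = 0 ∨ y j = 1) ∧ (∀ j, x j = 0 ∨ x j = 1 → y j = x j) ∧
      ∀ i, |∑ j, (y j - x j) * v j i| ≤ s := by
  classical
  induction hN : (Finset.univ.filter fun j => ¬(x j = 0 ∨ x j = 1)).card using Nat.strong_induction_on
    generalizing x with
  | _ N ih =>
  set U := Finset.univ.filter fun j => ¬(x j = 0 ∨ x j = 1) with hUdef
  have memU : ∀ j, j ∈ U ↔ ¬(x j = 0 ∨ x j = 1) := fun j => by simp [hUdef]
  by_cases hU : U = ∅
  · refine ⟨x, fun j => ?_, fun _ _ => rfl, fun i => by simpa using hs0⟩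
    by_contra h
    have := (memU j).2 h
    simp [hU] at this
  have hUne : U.Nonempty := Finset.nonempty_iff_ne_empty.2 hU
  set A := Finset.univ.filter fun i => s < ∑ j ∈ U, v j i with hA
  have memA : ∀ i, i ∈ A ↔ s < ∑ j ∈ U, v j i := fun i => by simp [hA]
  -- Double counting: the fractional coordinates carry total weight at most s |U|, and each row in A
  -- takes more than s of it.
  have hcard : A.card < U.card := by
    by_contra! hle
    have hAne : A.Nonempty := Finset.card_pos.1 (hUne.card_pos.trans_le hle)
    have h1 : (A.card : ℝ) * s < ∑ i ∈ A, ∑ j ∈ U, v j i := by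
      rw [← nsmul_eq_mul, ← Finset.sum_const]
      exact Finset.sum_lt_sum_of_nonempty hAne fun i hi => (memA i).1 hi
    have h2 : ∑ i ∈ A, ∑ j ∈ U, v j i ≤ U.card * s := by
      rw [Finset.sum_comm, ← nsmul_eq_mul, ← Finset.sum_const]
      refine Finset.sum_le_sum fun j _ => (Finset.sum_le_univ_sum_of_nonneg (hv j)).trans (hs j)
    have h3 : (U.card : ℝ) * s ≤ A.card * s :=
      mul_le_mul_of_nonneg_right (by exact_mod_cast hle) hs0
    linarith
  -- Fewer equations than unknowns: there is a direction supported on U which changes no row of A.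
  obtain ⟨z, hz0, hzU, hzA⟩ : ∃ z : J → ℝ, z ≠ 0 ∧ (∀ j, j ∉ U → z j = 0) ∧
      ∀ i ∈ A, ∑ j, z j * v j i = 0 := by
    let f : (U → ℝ) →ₗ[ℝ] (A → ℝ) :=
      { toFun := fun z i => ∑ j : U, z j * v j i
        map_add' := fun z z' => by
          funext i; simp [add_mul, Finset.sum_add_distrib]
        map_smul' := fun c z => by
          funext i; simp [Finset.mul_sum, mul_assoc] }
    have hk : LinearMap.ker f ≠ ⊥ := LinearMap.ker_ne_bot_of_finrank_lt (by simpa using hcard)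
    obtain ⟨z, hz, hz0⟩ := (Submodule.ne_bot_iff _).1 hk
    refine ⟨fun j => if h : j ∈ U then z ⟨j, h⟩ else 0, fun h => hz0 ?_, fun j hj => by simp [hj],
      fun i hi => ?_⟩
    · funext j
      have := congrFun h j
      simpa using this
    · have := congrFun (LinearMap.mem_ker.1 hz) ⟨i, hi⟩
      simp only [f, LinearMap.coe_mk, AddHom.coe_mk, Pi.zero_apply] at this
      rw [← Finset.sum_subset (Finset.subset_univ U) (fun j _ hj => by
        simp only [dif_neg hj, zero_mul]),
        ← Finset.sum_coe_sort, ← this]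
      exact Finset.sum_congr rfl fun j _ => by simp
  obtain ⟨t, hxt, j₀, hj₀, hint⟩ := exists_move x z hx hz0
  have hj₀U : j₀ ∈ U := by by_contra h; exact hj₀ (hzU _ h)
  have hfix : ∀ j, x j = 0 ∨ x j = 1 → x j + t * z j = x j := fun j hj => by
    rw [hzU j (by rw [memU]; exact not_not.2 hj)]; ring
  have hlt : (Finset.univ.filter fun j => ¬(x j + t * z j = 0 ∨ x j + t * z j = 1)).card < N := by
    rw [← hN]
    refine Finset.card_lt_card ((Finset.ssubset_iff_of_subset fun j hj => ?_).2
      ⟨j₀, hj₀U, fun h => (Finset.mem_filter.1 h).2 hint⟩)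
    rw [memU]
    intro h
    rw [Finset.mem_filter, hfix j h] at hj
    exact hj.2 h
  obtain ⟨y, hy1, hy2, hy3⟩ := ih _ hlt (fun j => x j + t * z j) hxt rfl
  have hyx : ∀ j, x j = 0 ∨ x j = 1 → y j = x j := fun j hj => by
    have := hy2 j (by rw [hfix j hj]; exact hj)
    rw [this, hfix j hj]
  refine ⟨y, hy1, hyx, fun i => ?_⟩
  by_cases hi : i ∈ A
  · have := hy3 i
    have e : ∑ j, (y j - (x j + t * z j)) * v j i
        = ∑ j, (y j - x j) * v j i - t * ∑ j, z j * v j i := by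
      rw [Finset.mul_sum, ← Finset.sum_sub_distrib]
      exact Finset.sum_congr rfl fun j _ => by ring
    rw [e, hzA i hi] at this
    simpa using this
  · rw [memA, not_lt] at hi
    calc |∑ j, (y j - x j) * v j i| = |∑ j ∈ U, (y j - x j) * v j i| := by
          rw [Finset.sum_subset (Finset.subset_univ U)]
          intro j _ hj
          rw [memU, not_not] at hj
          simp [hyx j hj]
      _ ≤ ∑ j ∈ U, |(y j - x j) * v j i| := Finset.abs_sum_le_sum_abs _ _
      _ ≤ ∑ j ∈ U, v j i := by
          refine Finset.sum_le_sum fun j _ => ?_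
          rw [abs_mul, abs_of_nonneg (hv j i)]
          refine mul_le_of_le_one_left (hv j i) ?_
          rw [abs_le]
          rcases hy1 j with h | h <;> rw [h] <;> constructor <;> linarith [(hx j).1, (hx j).2]
      _ ≤ s := hi

/-- If the elements of blocks of size `3 h` are grouped into items of size at most `s`, then the
items have a colouring with three colours such that every colour occurs at most `h + 2 s` times
in every block. -/
theorem exists_three_coloring {E I J : Type*} [Fintype E] [Fintype I] [Fintype J] [DecidableEq I]
    [DecidableEq J] (blk : E → I) (item : E → J) (h s : ℕ)
    (hblk : ∀ i, (Finset.univ.filter fun e => blk e = i).card = 3 * h)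
    (hitem : ∀ j, (Finset.univ.filter fun e => item e = j).card ≤ s) :
    ∃ color : J → Fin 3, ∀ i c,
      (Finset.univ.filter fun e => blk e = i ∧ color (item e) = c).card ≤ h + 2 * s := by
  classical
  set v : J → I → ℝ := fun j i =>
    ((Finset.univ.filter fun e => blk e = i ∧ item e = j).card : ℝ) with hvdef
  have hv : ∀ j i, 0 ≤ v j i := fun j i => Nat.cast_nonneg _
  have hs : ∀ j, ∑ i, v j i ≤ (s : ℝ) := fun j => by
    simp only [hvdef]
    have : (Finset.univ.filter fun e => item e = j).card
        = ∑ i, (Finset.univ.filter fun e => blk e = i ∧ item e = j).card := by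
      rw [Finset.card_eq_sum_card_fiberwise (f := blk) (t := Finset.univ) (by simp)]
      refine Finset.sum_congr rfl fun i _ => ?_
      rw [Finset.filter_filter]
      congr 1; ext e; simp [and_comm]
    have h2 := hitem j
    rw [this] at h2
    exact_mod_cast h2
  have count : ∀ (P : J → Prop) [DecidablePred P] (i : I),
      ((Finset.univ.filter fun e => blk e = i ∧ P (item e)).card : ℝ)
        = ∑ j, (if P j then 1 else 0) * v j i := by
    intro P _ i
    rw [Finset.card_eq_sum_card_fiberwise (f := item) (t := Finset.univ) (by simp)]
    push_cast
    refine Finset.sum_congr rfl fun j _ => ?_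
    rw [Finset.filter_filter]
    split_ifs with hP
    · rw [one_mul, hvdef]
      congr 2; ext e
      simp only [Finset.mem_filter, Finset.mem_univ, true_and]
      constructor
      · rintro ⟨⟨a, -⟩, b⟩; exact ⟨a, b⟩
      · rintro ⟨a, b⟩; exact ⟨⟨a, b ▸ hP⟩, b⟩
    · rw [zero_mul, Nat.cast_eq_zero, Finset.card_eq_zero, Finset.filter_eq_empty_iff]
      rintro e - ⟨⟨-, a⟩, b⟩
      exact hP (b ▸ a)
  have tot : ∀ i, ∑ j, v j i = 3 * h := fun i => by
    have := count (fun _ => True) i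
    simp only [and_true, if_true, one_mul, hblk] at this
    rw [← this]; push_cast; ring
  -- Colour 0 is the rounding of the constant 1/3. The remainder 1 - y is then halved and rounded
  -- again; since integral coordinates stay fixed, items of colour 0 are not recoloured. The errors
  -- s and s + s/2 are both at most 2s.
  obtain ⟨y, hy1, -, hy3⟩ := exists_rounding v hv s (Nat.cast_nonneg s) hs (fun _ => 1 / 3)
    (fun _ => by norm_num)
  obtain ⟨u, hu1, hu2, hu3⟩ := exists_rounding v hv s (Nat.cast_nonneg s) hs
    (fun j => (1 - y j) / 2)
    (fun j => by rcases hy1 j with h | h <;> rw [h] <;> norm_num)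
  have hu4 : ∀ j, y j = 1 → u j = 0 := fun j hj => by
    have := hu2 j (Or.inl (by rw [hj]; norm_num))
    rw [this, hj]; norm_num
  refine ⟨fun j => if y j = 1 then 0 else if u j = 1 then 1 else 2, fun i c => ?_⟩
  have E1 : ∑ j, (y j - 1 / 3) * v j i = ∑ j, y j * v j i - h := by
    have := tot i
    have e : ∑ j, (1 / 3 : ℝ) * v j i = h := by rw [← Finset.mul_sum, this]; ring
    rw [← e, ← Finset.sum_sub_distrib]
    exact Finset.sum_congr rfl fun j _ => by ring
  have E2 : ∑ j, (u j - (1 - y j) / 2) * v j i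
      = ∑ j, u j * v j i - (3 * h) / 2 + (∑ j, y j * v j i) / 2 := by
    rw [← tot i, Finset.sum_div, Finset.sum_div, ← Finset.sum_sub_distrib,
      ← Finset.sum_add_distrib]
    exact Finset.sum_congr rfl fun j _ => by ring
  have B1 := hy3 i
  have B2 := hu3 i
  rw [E1, abs_le] at B1
  rw [E2, abs_le] at B2
  have hs0 : (0 : ℝ) ≤ s := Nat.cast_nonneg s
  have key : ((Finset.univ.filter fun e => blk e = i ∧
      (if y (item e) = 1 then (0 : Fin 3) else if u (item e) = 1 then 1 else 2) = c).card : ℝ)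
      ≤ h + 2 * s := by
    rw [count (fun j => (if y j = 1 then (0 : Fin 3) else if u j = 1 then 1 else 2) = c)]
    have F : ∀ g : J → ℝ, (∀ j, (if (if y j = 1 then (0 : Fin 3) else if u j = 1 then 1 else 2) = c
        then (1 : ℝ) else 0) = g j) →
        ∑ j, (if (if y j = 1 then (0 : Fin 3) else if u j = 1 then 1 else 2) = c
          then (1 : ℝ) else 0) * v j i = ∑ j, g j * v j i := fun g hg =>
      Finset.sum_congr rfl fun j _ => by rw [hg]
    fin_cases c
    · rw [F y]
      · linarith
      · intro j
        rcases hy1 j with a | a <;> rcases hu1 j with b | b <;> simp [a, b]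
    · rw [F u]
      · linarith
      · intro j
        rcases hy1 j with a | a
        · rcases hu1 j with b | b <;> simp [a, b]
        · simp [a, hu4 j a]
    · rw [F (fun j => 1 - y j - u j)]
      · have : ∑ j, (1 - y j - u j) * v j i
            = 3 * h - ∑ j, y j * v j i - ∑ j, u j * v j i := by
          rw [← tot i, ← Finset.sum_sub_distrib, ← Finset.sum_sub_distrib]
          exact Finset.sum_congr rfl fun j _ => by ring
        rw [this]
        linarith
      · intro j
        rcases hy1 j with a | a
        · rcases hu1 j with b | b <;> simp [a, b]
        · simp [a, hu4 j a]
  exact_mod_cast key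

/-! ### From Strassen's conjecture to small decompositions over a finite field -/

/-- Exactly one of three propositions holds. -/
def ExactlyOne (p q r : Prop) : Prop :=
  (p ∧ ¬q ∧ ¬r) ∨ (¬p ∧ q ∧ ¬r) ∨ (¬p ∧ ¬q ∧ r)

/-- Three sets partition the index set. -/
def IsPartition3 {β : Type*} (A B C : Finset β) : Prop :=
  ∀ o, ExactlyOne (o ∈ A) (o ∈ B) (o ∈ C)

theorem IsPartition3.rotate {β : Type*} {A B C : Finset β} (h : IsPartition3 A B C) :
    IsPartition3 B C A := fun o => by
  have := h o; unfold ExactlyOne at *; tauto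

theorem IsPartition3.swap {β : Type*} {A B C : Finset β} (h : IsPartition3 A B C) :
    IsPartition3 B A C := fun o => by
  have := h o; unfold ExactlyOne at *; tauto

theorem IsPartition3.unique {β : Type*} {A A' B C : Finset β} (h : IsPartition3 A B C)
    (h' : IsPartition3 A' B C) : A = A' := by
  ext o
  have := h o; have := h' o; unfold ExactlyOne at *; tauto

theorem IsPartition3.sum_add {β M : Type*} [Fintype β] [AddCommMonoid M] {A B C : Finset β}
    (h : IsPartition3 A B C) (f : β → M) :
    ∑ o ∈ A, f o + ∑ o ∈ B, f o + ∑ o ∈ C, f o = ∑ o, f o := by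
  classical
  have e : ∀ A : Finset β, ∑ o ∈ A, f o = ∑ o, if o ∈ A then f o else 0 := fun A => by simp
  rw [e A, e B, e C, ← Finset.sum_add_distrib, ← Finset.sum_add_distrib]
  refine Finset.sum_congr rfl fun o _ => ?_
  rcases h o with ⟨a, b, c⟩ | ⟨a, b, c⟩ | ⟨a, b, c⟩ <;> simp [a, b, c]

theorem IsPartition3.card_add {β : Type*} [Fintype β] {A B C : Finset β}
    (h : IsPartition3 A B C) : A.card + B.card + C.card = Fintype.card β := by
  have := h.sum_add fun _ => 1
  simpa using this

/-- The other two parts can be chosen freely among the sets of complementary sizes. -/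
theorem exists_isPartition3 {β : Type*} [Fintype β] [DecidableEq β] (A : Finset β) {k : ℕ}
    (h1 : A.card ≤ k) (h2 : Fintype.card β ≤ A.card + 2 * k) (h3 : 2 * k ≤ Fintype.card β)
    (h4 : Fintype.card β ≤ 3 * k) :
    ∃ B C : Finset β, IsPartition3 A B C ∧ (B.card ≤ k ∧ Fintype.card β ≤ B.card + 2 * k) ∧
      (C.card ≤ k ∧ Fintype.card β ≤ C.card + 2 * k) := by
  have hc : Aᶜ.card = Fintype.card β - A.card := Finset.card_compl A
  obtain ⟨B, hB, hBc⟩ := Finset.exists_subset_card_eq (s := Aᶜ)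
    (n := (Fintype.card β - A.card) / 2) (by omega)
  refine ⟨B, Aᶜ \ B, fun o => ?_, ?_, ?_⟩
  · have : o ∈ B → o ∉ A := fun h => by simpa using hB h
    simp only [ExactlyOne, Finset.mem_sdiff, Finset.mem_compl]
    tauto
  · omega
  · rw [Finset.card_sdiff_of_subset hB]; omega

/-! ### Conciseness and rank decompositions -/

namespace Tensor3

variable {F ι : Type*} [Field F] [Fintype ι]

theorem form_add_mid (T : Tensor3 F ι) (x y y' z : ι → F) :
    T.form x (y + y') z = T.form x y z + T.form x y' z := by
  simp only [form, ← Finset.sum_add_distrib, Pi.add_apply]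
  refine Finset.sum_congr rfl fun i _ => Finset.sum_congr rfl fun j _ =>
    Finset.sum_congr rfl fun k _ => by ring

theorem form_smul_mid (T : Tensor3 F ι) (c : F) (x y z : ι → F) :
    T.form x (c • y) z = c • T.form x y z := by
  simp only [form, Finset.mul_sum, Pi.smul_apply, smul_eq_mul]
  refine Finset.sum_congr rfl fun i _ => Finset.sum_congr rfl fun j _ =>
    Finset.sum_congr rfl fun k _ => by ring

theorem form_add_right (T : Tensor3 F ι) (x y z z' : ι → F) :
    T.form x y (z + z') = T.form x y z + T.form x y z' := by
  simp only [form, ← Finset.sum_add_distrib, Pi.add_apply]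
  refine Finset.sum_congr rfl fun i _ => Finset.sum_congr rfl fun j _ =>
    Finset.sum_congr rfl fun k _ => by ring

theorem form_smul_right (T : Tensor3 F ι) (c : F) (x y z : ι → F) :
    T.form x y (c • z) = c • T.form x y z := by
  simp only [form, Finset.mul_sum, Pi.smul_apply, smul_eq_mul]
  refine Finset.sum_congr rfl fun i _ => Finset.sum_congr rfl fun j _ =>
    Finset.sum_congr rfl fun k _ => by ring

theorem form_single [DecidableEq ι] (T : Tensor3 F ι) (x : ι → F) (j k : ι) :
    T.form x (Pi.single j 1) (Pi.single k 1) = ∑ i, T i j k * x i := by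
  refine Finset.sum_congr rfl fun i _ => ?_
  rw [Finset.sum_eq_single j, Finset.sum_eq_single k] <;> simp +contextual

/-- If every slice of the first kind is nonzero and the supports of these slices are disjoint,
then in all bases all variables of the first kind occur. -/
theorem exists_coeffIn_ne_zero (T : Tensor3 F ι) (h1 : ∀ i, ∃ j k, T i j k ≠ 0)
    (h2 : ∀ i i' j k, T i j k ≠ 0 → T i' j k ≠ 0 → i = i')
    (b₁ b₂ b₃ : Module.Basis ι F (ι → F)) (i : ι) :
    ∃ j k, T.form (b₁ i) (b₂ j) (b₃ k) ≠ 0 := by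
  classical
  by_contra! h
  obtain ⟨i', hi'⟩ : ∃ i', b₁ i i' ≠ 0 := by
    by_contra! h0
    exact b₁.ne_zero i (funext h0)
  obtain ⟨j, k, hjk⟩ := h1 i'
  let B : (ι → F) →ₗ[F] (ι → F) →ₗ[F] F := LinearMap.mk₂ F (T.form (b₁ i))
    (fun y y' z => T.form_add_mid _ y y' z) (fun c y z => T.form_smul_mid c _ y z)
    (fun y z z' => T.form_add_right _ y z z') (fun c y z => T.form_smul_right c _ y z)
  -- If the variable b₁ i did not occur, the bilinear form obtained by fixing it would vanish on a
  -- pair of bases, hence identically. At the unit vectors j, k only the slice i' contributes, and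
  -- that contribution is nonzero.
  have hB : B = 0 := LinearMap.ext_basis b₂ b₃ fun j k => by simpa [B] using h j k
  have h0 : T.form (b₁ i) (Pi.single j 1) (Pi.single k 1) = 0 := by
    change B (Pi.single j 1) (Pi.single k 1) = 0
    rw [hB]; simp
  rw [form_single, Finset.sum_eq_single i'] at h0
  · exact (mul_ne_zero hjk hi') h0
  · intro l _ hl
    by_contra hne
    exact hl (h2 _ _ _ _ (left_ne_zero_of_mul hne) hjk)
  · simp

theorem isConcise_of_disjoint (T : Tensor3 F ι)
    (h1 : ∀ i, ∃ j k, T i j k ≠ 0) (h2 : ∀ j, ∃ i k, T i j k ≠ 0) (h3 : ∀ k, ∃ i j, T i j k ≠ 0)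
    (u1 : ∀ i i' j k, T i j k ≠ 0 → T i' j k ≠ 0 → i = i')
    (u2 : ∀ i j j' k, T i j k ≠ 0 → T i j' k ≠ 0 → j = j')
    (u3 : ∀ i j k k', T i j k ≠ 0 → T i j k' ≠ 0 → k = k') : T.IsConcise := by
  intro b₁ b₂ b₃
  refine ⟨fun i => T.exists_coeffIn_ne_zero h1 u1 b₁ b₂ b₃ i, fun j => ?_, fun k => ?_⟩
  · obtain ⟨i, k, h⟩ := exists_coeffIn_ne_zero (fun j i k => T i j k) h2
      (fun j j' i k => u2 i j j' k) b₂ b₁ b₃ j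
    refine ⟨i, k, ?_⟩
    convert h using 1
    simp only [coeffIn, form]
    rw [Finset.sum_comm]
    refine Finset.sum_congr rfl fun _ _ => Finset.sum_congr rfl fun _ _ =>
      Finset.sum_congr rfl fun _ _ => by ring
  · obtain ⟨i, j, h⟩ := exists_coeffIn_ne_zero (fun k i j => T i j k) h3
      (fun k k' i j => u3 i j k k') b₃ b₁ b₂ k
    refine ⟨i, j, ?_⟩
    convert h using 1
    simp only [coeffIn, form]
    symm
    rw [Finset.sum_comm]
    refine Finset.sum_congr rfl fun _ _ => ?_
    rw [Finset.sum_comm]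
    exact Finset.sum_congr rfl fun _ _ => Finset.sum_congr rfl fun _ _ => by ring

theorem coeffIn_basisFun [DecidableEq ι] (T : Tensor3 F ι) :
    T.coeffIn (Pi.basisFun F ι) (Pi.basisFun F ι) (Pi.basisFun F ι) = T := by
  funext i j k
  simp only [coeffIn, Pi.basisFun_apply]
  rw [form_single, Finset.sum_eq_single i] <;> simp +contextual

/-- The rank is attained by a decomposition. -/
theorem exists_decomposition {κ : Type*} [Finite κ] (T : Tensor3 F κ) :
    ∃ a b c : Fin T.rank → κ → F, ∀ i j k, T i j k = ∑ l, a l i * b l j * c l k := by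
  classical
  have := Fintype.ofFinite κ
  have hne : {r : ℕ | ∃ (w : Fin r → F) (S : Fin r → Tensor3 F κ),
      (∀ l, (S l).IsRankOne) ∧ ∀ i j k, T i j k = ∑ l, w l * S l i j k}.Nonempty := by
    let e := Fintype.equivFin (κ × κ × κ)
    refine ⟨_, fun l => T (e.symm l).1 (e.symm l).2.1 (e.symm l).2.2, fun l i j k =>
      Pi.single (M := fun _ => F) (e.symm l).1 1 i * Pi.single (M := fun _ => F) (e.symm l).2.1 1 j
        * Pi.single (M := fun _ => F) (e.symm l).2.2 1 k, fun l => ⟨_, _, _, fun _ _ _ => rfl⟩, ?_⟩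
    intro i j k
    rw [e.symm.sum_comp (fun q => T q.1 q.2.1 q.2.2 * (Pi.single (M := fun _ => F) q.1 1 i *
      Pi.single (M := fun _ => F) q.2.1 1 j * Pi.single (M := fun _ => F) q.2.2 1 k))]
    rw [Finset.sum_eq_single (i, j, k)]
    · simp
    · rintro ⟨i', j', k'⟩ - hne
      by_contra h
      apply hne
      simp only [Pi.single_apply, mul_ite, mul_one, mul_zero, ite_eq_right_iff] at h
      grind
    · simp
  obtain ⟨w, S, hS, hT⟩ := Nat.sInf_mem hne
  choose a b c habc using hS
  refine ⟨fun l i => w l * a l i, b, c, fun i j k => ?_⟩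
  rw [hT]
  exact Finset.sum_congr rfl fun l _ => by rw [habc]; ring

end Tensor3

/-! ### Finite residue fields of finitely generated rings -/

theorem isJacobsonRing_int : IsJacobsonRing ℤ := by
  rw [isJacobsonRing_iff_prime_eq]
  intro P hP
  by_cases h : P = ⊥
  · subst h
    rw [eq_bot_iff]
    intro x hx
    -- Membership in the radical makes x·x + 1 a unit, so it is ±1 and x = 0.
    have := Ideal.mem_jacobson_bot.1 hx x
    rw [Int.isUnit_iff] at this
    rw [Ideal.mem_bot]
    rcases this with h | h <;> nlinarith
  · have := hP.isMaximal h
    exact Ideal.jacobson_eq_self_of_isMaximal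

/-- The Nullstellensatz over the Jacobson ring ℤ makes K a finite ℤ-module. In characteristic p this
is a finite-dimensional space over `ZMod p`; in characteristic 0, integrality over ℤ would force ℤ
to be a field. -/
theorem finite_of_field_of_finiteType_int (K : Type*) [Field K] [inst : Algebra ℤ K]
    [hK : Algebra.FiniteType ℤ K] :
    Finite K := by
  have := isJacobsonRing_int
  obtain rfl : inst = Ring.toIntAlgebra K := Subsingleton.elim _ _
  have hfin : Module.Finite ℤ K := finite_of_finite_type_of_isJacobsonRing ℤ K
  obtain ⟨p, hp⟩ := CharP.exists K
  rcases CharP.char_is_prime_or_zero K p with hprime | rfl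
  · have := Fact.mk hprime
    let := ZMod.algebra K p
    have : Module.Finite (ZMod p) K := by
      have : IsScalarTower ℤ (ZMod p) K := IsScalarTower.of_algebraMap_eq' (Subsingleton.elim _ _)
      exact Module.Finite.of_restrictScalars_finite ℤ (ZMod p) K
    exact Module.finite_of_finite (ZMod p)
  · have := CharP.charP_to_charZero K
    exact absurd (isField_of_isIntegral_of_isField (R := ℤ) (S := K)
      (RingHom.injective_int _) (Field.toIsField K)) Int.not_isField

/-- Decompositions of `0`-`1` tensors over some field exist over a finite field as well. -/
theorem exists_finite_field_decomposition.{u} {F : Type u} [Field F] {ι ρ : Type}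
    [Finite ι] [Fintype ρ] (T : ι → ι → ι → Prop) [∀ i j k, Decidable (T i j k)] (a b c : ρ → ι → F)
    (h : ∀ i j k, ∑ l, a l i * b l j * c l k = if T i j k then 1 else 0) :
    ∃ (K : Type u) (_ : Field K) (_ : Finite K) (a b c : ρ → ι → K),
      ∀ i j k, ∑ l, a l i * b l j * c l k = if T i j k then 1 else 0 := by
  classical
  set X : Set F := Set.range (fun q : ρ × ι => a q.1 q.2) ∪ Set.range (fun q : ρ × ι => b q.1 q.2)
    ∪ Set.range (fun q : ρ × ι => c q.1 q.2) with hX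
  have hXfin : X.Finite :=
    ((Set.finite_range _).union (Set.finite_range _)).union (Set.finite_range _)
  let S := Algebra.adjoin ℤ X
  have hS : Algebra.FiniteType ℤ S := Algebra.FiniteType.adjoin_of_finite hXfin
  have ha : ∀ l i, a l i ∈ S := fun l i =>
    Algebra.subset_adjoin (Or.inl (Or.inl ⟨(l, i), rfl⟩))
  have hb : ∀ l i, b l i ∈ S := fun l i =>
    Algebra.subset_adjoin (Or.inl (Or.inr ⟨(l, i), rfl⟩))
  have hc : ∀ l i, c l i ∈ S := fun l i => Algebra.subset_adjoin (Or.inr ⟨(l, i), rfl⟩)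
  -- The identities hold in the ring generated by the coefficients, and their right-hand sides 0 and
  -- 1 survive in every quotient, so any maximal ideal serves.
  obtain ⟨m, hm⟩ := Ideal.exists_maximal S
  let := Ideal.Quotient.field m
  have hfin : Algebra.FiniteType ℤ (S ⧸ m) :=
    Algebra.FiniteType.of_surjective (Ideal.Quotient.mkₐ ℤ m) (Ideal.Quotient.mkₐ_surjective ℤ m)
  have hK : Finite (S ⧸ m) := finite_of_field_of_finiteType_int (S ⧸ m)
  refine ⟨S ⧸ m, inferInstance, hK,
    fun l i => Ideal.Quotient.mk m ⟨a l i, ha l i⟩, fun l i => Ideal.Quotient.mk m ⟨b l i, hb l i⟩,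
    fun l i => Ideal.Quotient.mk m ⟨c l i, hc l i⟩, fun i j k => ?_⟩
  have e : ∑ l, (⟨a l i, ha l i⟩ * ⟨b l j, hb l j⟩ * ⟨c l k, hc l k⟩ : S)
      = if T i j k then 1 else 0 := by
    apply Subtype.ext
    have := h i j k
    push_cast
    rw [this]
    split_ifs <;> rfl
  simp only [← map_mul, ← map_sum, e]
  split_ifs <;> simp

/-! ### The tensor of nearly balanced partitions -/

theorem sum_two_pow_injective (β : ℕ) :
    Function.Injective fun A : Finset (Fin β) => ∑ o ∈ A, (2 : ℤ) ^ (o : ℕ) := by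
  intro A B h
  have key : ∀ A : Finset (Fin β), ∑ o ∈ A, (2 : ℤ) ^ (o : ℕ)
      = ((∑ o ∈ A.map Fin.valEmbedding, 2 ^ o : ℕ) : ℤ) := fun A => by
    rw [Finset.sum_map]; push_cast; rfl
  simp only [key, Nat.cast_inj] at h
  exact Finset.map_injective _ (Finset.geomSum_injective le_rfl h)

open Classical in
/-- Strassen's conjecture bounds the rank of some power of the tensor of nearly balanced
partitions. -/
theorem exists_partition_decomposition {F : Type*} [Field F] (hARC : AsymptoticRankConjecture F)
    (h d : ℕ) (hd : d * 2 ≤ h) (P : ℕ)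
    (hP : Fintype.card {A : Finset (Fin (3 * h)) // A.card ≤ h + d ∧ 3 * h ≤ A.card + 2 * (h + d)}
      ≤ P) :
    ∃ r R : ℕ, 0 < r ∧ R ≤ (2 * P) ^ r ∧ ∃ a b c : Fin R → (Fin r →
      {A : Finset (Fin (3 * h)) // A.card ≤ h + d ∧ 3 * h ≤ A.card + 2 * (h + d)}) → F,
      ∀ A B C, ∑ l, a l A * b l B * c l C =
        if ∀ q, IsPartition3 (A q).1 (B q).1 (C q).1 then 1 else 0 := by
  set ι := {A : Finset (Fin (3 * h)) // A.card ≤ h + d ∧ 3 * h ≤ A.card + 2 * (h + d)} with hι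
  set D := Fintype.card ι with hD
  let e : ι ≃ Fin D := Fintype.equivFin ι
  let T : Tensor3 F (Fin D) := fun i j k =>
    if IsPartition3 (e.symm i).1 (e.symm j).1 (e.symm k).1 then 1 else 0
  have hT : ∀ i j k, T i j k ≠ 0 ↔ IsPartition3 (e.symm i).1 (e.symm j).1 (e.symm k).1 := by
    intro i j k; simp [T]
  -- This is why the index sets also have a lower size bound: a set that is too small cannot be
  -- completed to a partition, and its variable would not occur.
  have ex : ∀ A : ι, ∃ B C : ι, IsPartition3 A.1 B.1 C.1 := fun A => by
    obtain ⟨B, C, h1, h2, h3⟩ := exists_isPartition3 (k := h + d) A.1 A.2.1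
      (by simpa using A.2.2) (by rw [Fintype.card_fin]; omega) (by rw [Fintype.card_fin]; omega)
    exact ⟨⟨B, by simpa using h2⟩, ⟨C, by simpa using h3⟩, h1⟩
  have hconc : T.IsConcise := by
    apply Tensor3.isConcise_of_disjoint
    · intro i
      obtain ⟨B, C, hp⟩ := ex (e.symm i)
      exact ⟨e B, e C, by rw [hT]; simpa using hp⟩
    · intro i
      obtain ⟨B, C, hp⟩ := ex (e.symm i)
      exact ⟨e B, e C, by rw [hT]; simpa using hp.swap⟩
    · intro i
      obtain ⟨B, C, hp⟩ := ex (e.symm i)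
      exact ⟨e B, e C, by rw [hT]; simpa using hp.rotate⟩
    · intro i i' j k h1 h2
      rw [hT] at h1 h2
      exact e.symm.injective (Subtype.ext (h1.unique h2))
    · intro i j j' k h1 h2
      rw [hT] at h1 h2
      exact e.symm.injective (Subtype.ext (h1.swap.unique h2.swap))
    · intro i j k k' h1 h2
      rw [hT] at h1 h2
      exact e.symm.injective (Subtype.ext (h1.rotate.rotate.unique h2.rotate.rotate))
  have htight : T.IsTight := by
    -- In a partition the three binary numbers add up to 2^(3h) - 1, written as the sum of all
    -- powers; subtracting it from the third label makes the sums vanish.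
    let f : Fin D → ℤ := fun i => ∑ o ∈ (e.symm i).1, (2 : ℤ) ^ (o : ℕ)
    have hf : Function.Injective f := fun i j hij =>
      e.symm.injective (Subtype.ext (sum_two_pow_injective _ hij))
    refine ⟨Pi.basisFun F _, Pi.basisFun F _, Pi.basisFun F _, f, f,
      fun k => f k - ∑ o : Fin (3 * h), (2 : ℤ) ^ (o : ℕ), hf, hf,
      fun i j hij => hf (sub_left_injective hij), fun i j k hne => ?_⟩
    rw [Tensor3.coeffIn_basisFun, hT] at hne
    have := hne.sum_add fun o => (2 : ℤ) ^ (o : ℕ)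
    simp only [f]
    linarith
  have hDpos : 0 < D := by
    obtain ⟨A, -, hA⟩ := Finset.exists_subset_card_eq (s := (Finset.univ : Finset (Fin (3 * h))))
      (n := h) (by simp; omega)
    exact Fintype.card_pos_iff.2 ⟨⟨A, by omega, by omega⟩⟩
  have hlim := hARC D T htight hconc
  -- The factor 2 is room to pass from the limit D to an actual power r; it is absorbed later by the
  -- choice of h.
  have hev := Filter.Tendsto.eventually_lt_const (u := 2 * (D : ℝ)) (by
    have : (0 : ℝ) < D := by exact_mod_cast hDpos
    linarith) hlim
  obtain ⟨r, hr, hr0⟩ := (hev.and (eventually_gt_atTop 0)).exists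
  have hrR : (T.kronPow r).rank ≤ (2 * P) ^ r := by
    have h0 : (0 : ℝ) ≤ ((T.kronPow r).rank : ℝ) := Nat.cast_nonneg _
    have h1 : ((T.kronPow r).rank : ℝ) ≤ (2 * (D : ℝ)) ^ r := by
      have h2 := pow_le_pow_left₀ (Real.rpow_nonneg h0 _) hr.le r
      rwa [one_div, Real.rpow_inv_natCast_pow h0 hr0.ne'] at h2
    have h3 : (T.kronPow r).rank ≤ (2 * D) ^ r := by exact_mod_cast h1
    exact h3.trans (Nat.pow_le_pow_left (by omega) r)
  obtain ⟨a, b, c, habc⟩ := (T.kronPow r).exists_decomposition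
  refine ⟨r, _, hr0, hrR, fun l A => a l fun q => e (A q), fun l A => b l fun q => e (A q),
    fun l A => c l fun q => e (A q), fun A B C => ?_⟩
  rw [← habc]
  simp only [Tensor3.kronPow, T, Equiv.symm_apply_apply]
  split_ifs with hall
  · exact Finset.prod_eq_one fun q _ => if_pos (hall q)
  · push Not at hall
    obtain ⟨q, hq⟩ := hall
    exact Finset.prod_eq_zero (Finset.mem_univ q) (if_neg hq)

/-- The number of small sets. -/
theorem card_small_sets_le (h d : ℕ) (hd : d ≤ 2 * h) :
    ((Finset.univ.filter fun A : Finset (Fin (3 * h)) => A.card ≤ h + d).card : ℝ)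
      ≤ (3 / (2 : ℝ) ^ ((2 : ℝ) / 3)) ^ (3 * h) * 2 ^ d := by
  have hg : (3 / (2 : ℝ) ^ ((2 : ℝ) / 3)) ^ (3 * h) = 3 ^ (3 * h) / 2 ^ (2 * h) := by
    rw [div_pow, ← Real.rpow_natCast, ← Real.rpow_natCast (_ ^ _), ← Real.rpow_mul (by norm_num),
      ← Real.rpow_natCast 2]
    congr 2
    push_cast; ring
  -- The probabilities of a random set containing each point with probability 1/3 sum to 1, and a
  -- set with at most h + d points has probability at least 2^(2h-d)/3^(3h).
  have hsum := Finset.sum_pow_mul_eq_add_pow (1 / 3 : ℝ) (2 / 3)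
    (Finset.univ : Finset (Fin (3 * h)))
  rw [Finset.powerset_univ, Finset.card_univ, Fintype.card_fin] at hsum
  norm_num only [one_pow] at hsum
  have hterm : ∀ A ∈ Finset.univ.filter fun A : Finset (Fin (3 * h)) => A.card ≤ h + d,
      (2 : ℝ) ^ (2 * h - d) / 3 ^ (3 * h) ≤ (1 / 3) ^ A.card * (2 / 3) ^ (3 * h - A.card) := by
    intro A hA
    have hA := (Finset.mem_filter.1 hA).2
    have hA3 : A.card ≤ 3 * h := by simpa using Finset.card_le_univ A
    rw [div_pow, div_pow, one_pow, div_mul_div_comm, one_mul, ← pow_add,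
      Nat.add_sub_cancel' hA3]
    exact div_le_div_of_nonneg_right (pow_le_pow_right₀ (by norm_num) (by omega)) (by positivity)
  have h1 := (Finset.card_nsmul_le_sum _ _ _ hterm).trans
    (Finset.sum_le_sum_of_subset_of_nonneg (Finset.subset_univ _) fun A _ _ => by positivity)
  rw [hsum, nsmul_eq_mul] at h1
  have h2 : (2 : ℝ) ^ (2 * h) = 2 ^ (2 * h - d) * 2 ^ d := by
    rw [← pow_add]; congr 1; omega
  rw [hg, div_mul_eq_mul_div, h2, mul_div_mul_right _ _ (by positivity), le_div_iff₀ (by positivity)]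
  rwa [← mul_div_assoc, div_le_one (by positivity)] at h1

/-! ### Bit masks and their pieces -/

/-- The part of the set with characteristic bits `x` in the block number `q` of size `β`. -/
def piece (β x q : ℕ) : Finset (Fin β) :=
  Finset.univ.filter fun o => x.testBit (β * q + o)

theorem mem_piece {β x q : ℕ} {o : Fin β} : o ∈ piece β x q ↔ x.testBit (β * q + o) = true := by
  simp [piece]

/-- The sets with characteristic bits `x`, `y`, `z` partition `{0, …, b - 1}`. -/
def BitPartition (b x y z : ℕ) : Prop :=
  ∀ i < b, ExactlyOne (x.testBit i) (y.testBit i) (z.testBit i)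

theorem bitPartition_iff_pieces {β r x y z : ℕ} :
    BitPartition (β * r) x y z ↔
      ∀ q : Fin r, IsPartition3 (piece β x q) (piece β y q) (piece β z q) := by
  constructor
  · intro h q o
    have := h (β * q + o) (by
      have := q.2; have := o.2
      calc β * q + o < β * q + β := by omega
        _ = β * (q + 1) := by ring
        _ ≤ β * r := Nat.mul_le_mul_left _ (by omega))
    simpa only [mem_piece] using this
  · intro h i hi
    have hβ : 0 < β := Nat.pos_of_ne_zero fun h0 => by simp [h0] at hi
    have := h ⟨i / β, Nat.div_lt_of_lt_mul hi⟩ ⟨i % β, Nat.mod_lt _ hβ⟩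
    simpa only [mem_piece, Nat.div_add_mod] using this

/-- The bit masks of sets with small pieces. -/
def smallMasks (β k r : ℕ) : Finset ℕ :=
  (Finset.range (2 ^ (β * r))).filter fun x => ∀ q < r, (piece β x q).card ≤ k

theorem zero_mem_smallMasks (β k r : ℕ) : 0 ∈ smallMasks β k r := by
  refine Finset.mem_filter.2 ⟨by simp, fun q _ => ?_⟩
  have : piece β 0 q = ∅ := by ext o; simp [mem_piece]
  simp [this]

theorem card_smallMasks_le (β k r : ℕ) :
    (smallMasks β k r).card ≤
      (Finset.univ.filter fun A : Finset (Fin β) => A.card ≤ k).card ^ r := by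
  classical
  have := Finset.card_le_card_of_injOn (s := smallMasks β k r)
    (t := Fintype.piFinset fun _ : Fin r =>
      Finset.univ.filter fun A : Finset (Fin β) => A.card ≤ k)
    (fun x q => piece β x q) ?_ ?_
  · simpa [Fintype.card_piFinset] using this
  · intro x hx
    have hx := (Finset.mem_filter.1 hx).2
    simp only [Finset.mem_coe, Fintype.mem_piFinset, Finset.mem_filter, Finset.mem_univ, true_and]
    exact fun q => hx q q.2
  · intro x hx y hy hxy
    have hx := Finset.mem_range.1 (Finset.mem_filter.1 hx).1
    have hy := Finset.mem_range.1 (Finset.mem_filter.1 hy).1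
    refine Nat.eq_of_testBit_eq fun i => ?_
    by_cases hi : i < β * r
    · have hβ : 0 < β := Nat.pos_of_ne_zero fun h0 => by simp [h0] at hi
      have := congrFun hxy ⟨i / β, Nat.div_lt_of_lt_mul hi⟩
      have := congrArg (fun A => (⟨i % β, Nat.mod_lt _ hβ⟩ : Fin β) ∈ A) this
      simp only [mem_piece, Nat.div_add_mod, eq_iff_iff] at this
      exact Bool.eq_iff_iff.2 this
    · have h2 : 2 ^ (β * r) ≤ 2 ^ i := Nat.pow_le_pow_right (by norm_num) (by omega)
      rw [Nat.testBit_lt_two_pow (hx.trans_le h2), Nat.testBit_lt_two_pow (hy.trans_le h2)]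

/-! ### The block table and its decomposition -/

/-- The data of one block: bit masks of `b` bits, listed in a table of length `Q`, and a
decomposition into `Q` summands of the tensor which tells whether three masks partition the
block. -/
structure BlockData (K : Type*) [Field K] (h k r Q : ℕ) where
  tab : ℕ → ℕ
  coef : ℕ → ℕ → ℕ → K
  tab_zero : tab 0 = 0
  tab_mem : ∀ A < Q, tab A ∈ smallMasks (3 * h) k r
  exists_tab : ∀ x ∈ smallMasks (3 * h) k r, ∃ A < Q, tab A = x
  sum_one : ∀ A < Q, ∀ B < Q, ∀ C < Q, BitPartition (3 * h * r) (tab A) (tab B) (tab C) →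
    ∑ l ∈ Finset.range Q, coef 0 l A * coef 1 l B * coef 2 l C = 1
  sum_zero : ∀ A < Q, ∀ B < Q, ∀ C < Q, ¬BitPartition (3 * h * r) (tab A) (tab B) (tab C) →
    ∑ l ∈ Finset.range Q, coef 0 l A * coef 1 l B * coef 2 l C = 0

/-- Number 0 is reserved for the empty mask, so the enumeration is shifted by one. Numbers beyond it
repeat the empty mask; later arguments never need the table to be injective. -/
theorem exists_table (s : Finset ℕ) (hs : 0 ∈ s) (Q : ℕ) (hQ : s.card < Q) :
    ∃ tab : ℕ → ℕ, tab 0 = 0 ∧ (∀ A, tab A ∈ s) ∧ ∀ x ∈ s, ∃ A < Q, tab A = x := by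
  refine ⟨fun A => if h : A - 1 < s.card then if A = 0 then 0 else s.equivFin.symm ⟨A - 1, h⟩
    else 0, by simp, fun A => ?_, fun x hx => ?_⟩
  · dsimp only
    split_ifs <;> simp [hs]
  · have := (s.equivFin ⟨x, hx⟩).2
    refine ⟨s.equivFin ⟨x, hx⟩ + 1, by omega, ?_⟩
    simp

/-- One factor 2^r pays for the extra table entry: (2P)^r + 1 ≤ 2 (2P)^r ≤ (4P)^r. -/
theorem table_size_le {P r m : ℕ} {g : ℝ} (hP : 1 ≤ P) (hr : 0 < r) (h : 4 * (P : ℝ) ≤ g ^ m) :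
    (((2 * P) ^ r + 1 : ℕ) : ℝ) ≤ g ^ (m * r) := by
  have hP0 : (1 : ℝ) ≤ P := by exact_mod_cast hP
  have h6 : (1 : ℝ) ≤ (2 * P) ^ r := one_le_pow₀ (by linarith)
  have h7 : (2 : ℝ) ≤ 2 ^ r := by
    simpa using pow_le_pow_right₀ (by norm_num : (1 : ℝ) ≤ 2) hr
  calc (((2 * P) ^ r + 1 : ℕ) : ℝ) = (2 * P) ^ r + 1 := by push_cast; ring
    _ ≤ 2 * (2 * P) ^ r := by linarith
    _ ≤ 2 ^ r * (2 * P) ^ r := by gcongr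
    _ = (4 * P) ^ r := by rw [← mul_pow, ← mul_assoc]; norm_num
    _ ≤ (g ^ m) ^ r := by gcongr
    _ = g ^ (m * r) := by rw [← pow_mul]

/-- All constants of the program are fixed here. Any base g above γ suffices, since (g/γ)^(3h)
eventually exceeds the factor 4·2^d lost by the slack in the piece sizes and by the rank estimate.
The table also contains masks with very small pieces, because the dynamic programming needs all
subsets, while the decomposition only knows nearly balanced ones. -/
theorem exists_blockData.{u} {F : Type u} [Field F] (hARC : AsymptoticRankConjecture F)
    (d : ℕ) {g : ℝ} (hg : 3 / (2 : ℝ) ^ ((2 : ℝ) / 3) < g) :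
    ∃ (K : Type u) (_ : Field K) (_ : Finite K) (h r Q : ℕ) (_ : BlockData K h (h + d) r Q),
      0 < h ∧ 0 < r ∧ 2 ≤ Q ∧ (Q : ℝ) ≤ g ^ (3 * h * r) := by
  classical
  set γ : ℝ := 3 / (2 : ℝ) ^ ((2 : ℝ) / 3) with hγ
  have hγ0 : 0 < γ := by positivity
  obtain ⟨h, hh, hhd⟩ : ∃ h : ℕ, 4 * (2 : ℝ) ^ d * γ ^ (3 * h) ≤ g ^ (3 * h) ∧ 2 * d + 1 ≤ h := by
    have h1 : 1 < g / γ := (one_lt_div hγ0).2 hg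
    have h2 := (tendsto_pow_atTop_atTop_of_one_lt h1).eventually_ge_atTop (4 * (2 : ℝ) ^ d)
    obtain ⟨N, hN⟩ := (h2.and (eventually_ge_atTop (2 * d + 1))).exists_forall_of_atTop
    refine ⟨N, ?_, (hN N le_rfl).2⟩
    have := (hN (3 * N) (by omega)).1
    rwa [div_pow, le_div_iff₀ (by positivity)] at this
  set P := (Finset.univ.filter fun A : Finset (Fin (3 * h)) => A.card ≤ h + d).card with hP
  have hPγ := card_small_sets_le h d (by omega)
  rw [← hP, ← hγ] at hPγ
  have hP1 : 1 ≤ P := Finset.card_pos.2 ⟨∅, by simp⟩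
  have hD : Fintype.card {A : Finset (Fin (3 * h)) // A.card ≤ h + d ∧
      3 * h ≤ A.card + 2 * (h + d)} ≤ P := by
    rw [Fintype.card_subtype]
    exact Finset.card_le_card fun A hA => by
      simp only [Finset.mem_filter, Finset.mem_univ, true_and] at hA ⊢
      exact hA.1
  obtain ⟨r, R, hr0, hR, a', b', c', habc'⟩ :=
    exists_partition_decomposition hARC h d (by omega) P hD
  obtain ⟨K, _, hK, a, b, c, habc⟩ := exists_finite_field_decomposition _ a' b' c' habc'
  set Q := (2 * P) ^ r + 1 with hQ
  have hQ2 : 2 ≤ Q := by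
    have : 0 < (2 * P) ^ r := by positivity
    omega
  have hcard := card_smallMasks_le (3 * h) (h + d) r
  rw [← hP] at hcard
  have hcard2 : (smallMasks (3 * h) (h + d) r).card < Q := by
    have : P ^ r ≤ (2 * P) ^ r := Nat.pow_le_pow_left (by omega) r
    omega
  have h0mem := zero_mem_smallMasks (3 * h) (h + d) r
  obtain ⟨tab, ht0, htm, hte⟩ := exists_table _ h0mem Q hcard2
  set Good : ℕ → Prop := fun x => ∀ q : Fin r, (piece (3 * h) x q).card ≤ h + d ∧
    3 * h ≤ (piece (3 * h) x q).card + 2 * (h + d) with hGood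
  -- Extend the coefficients by zero, both to rows from R to Q and to masks with a piece too small
  -- for the index set of the tensor.
  let ext : (Fin R → (Fin r → {A : Finset (Fin (3 * h)) // A.card ≤ h + d ∧
      3 * h ≤ A.card + 2 * (h + d)}) → K) → ℕ → ℕ → K := fun f l A =>
    if hl : l < R then if hA : Good (tab A) then
      f ⟨l, hl⟩ (fun q => ⟨piece (3 * h) (tab A) q, hA q⟩) else 0 else 0
  have ext_bad : ∀ f l A, ¬Good (tab A) → ext f l A = 0 := fun f l A hA => by simp [ext, hA]
  have ext_good : ∀ f A (hA : Good (tab A)) (l : Fin R), ext f l A =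
      f l (fun q => ⟨piece (3 * h) (tab A) q, hA q⟩) := fun f A hA l => by
    dsimp only [ext]
    rw [dif_pos l.2, dif_pos hA]
  have ext_big : ∀ f l A, R ≤ l → ext f l A = 0 := fun f l A hl => dif_neg (by omega)
  let coef : ℕ → ℕ → ℕ → K := fun κ => if κ = 0 then ext a else if κ = 1 then ext b else ext c
  have key : ∀ A B C, ∑ l ∈ Finset.range Q, coef 0 l A * coef 1 l B * coef 2 l C
      = if BitPartition (3 * h * r) (tab A) (tab B) (tab C) then 1 else 0 := by
    intro A B C
    have e : ∀ l, coef 0 l A * coef 1 l B * coef 2 l C = ext a l A * ext b l B * ext c l C :=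
      fun l => by simp [coef]
    simp only [e]
    by_cases hall : Good (tab A) ∧ Good (tab B) ∧ Good (tab C)
    · obtain ⟨hA, hB, hC⟩ := hall
      have := habc (fun q => ⟨piece (3 * h) (tab A) q, hA q⟩)
        (fun q => ⟨piece (3 * h) (tab B) q, hB q⟩) (fun q => ⟨piece (3 * h) (tab C) q, hC q⟩)
      rw [← Finset.sum_subset (Finset.range_mono (show R ≤ Q by omega)), Finset.sum_range]
      · simp only [ext_good _ _ hA, ext_good _ _ hB, ext_good _ _ hC]
        rw [this]
        simp only [bitPartition_iff_pieces]
      · intro l _ hl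
        simp only [Finset.mem_range] at hl
        rw [ext_big a l A (by omega), zero_mul, zero_mul]
    · have hz : ∀ l, ext a l A * ext b l B * ext c l C = 0 := fun l => by
        by_cases hA : Good (tab A)
        · by_cases hB : Good (tab B)
          · have hC : ¬Good (tab C) := fun hC => hall ⟨hA, hB, hC⟩
            rw [ext_bad c l C hC, mul_zero]
          · rw [ext_bad b l B hB, mul_zero, zero_mul]
        · rw [ext_bad a l A hA, zero_mul, zero_mul]
      rw [Finset.sum_eq_zero fun l _ => hz l, if_neg]
      intro hbp
      rw [bitPartition_iff_pieces] at hbp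
      -- The zero extension loses nothing: if three pieces of size at most h + d partition 3h
      -- points, each has at least 3h - 2(h + d) points.
      refine hall ⟨fun q => ?_, fun q => ?_, fun q => ?_⟩ <;>
      · have h1 := (Finset.mem_filter.1 (htm A)).2 q q.2
        have h2 := (Finset.mem_filter.1 (htm B)).2 q q.2
        have h3 := (Finset.mem_filter.1 (htm C)).2 q q.2
        have h4 := (hbp q).card_add
        rw [Fintype.card_fin] at h4
        omega
  refine ⟨K, inferInstance, hK, h, r, Q, ⟨tab, coef, ht0, fun A _ => htm A, hte,
    fun A _ B _ C _ hp => by rw [key, if_pos hp], fun A _ B _ C _ hp => by rw [key, if_neg hp]⟩,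
    by omega, hr0, hQ2, ?_⟩
  exact table_size_le hP1 hr0 (le_trans (by nlinarith) hh)

/-! ### Kronecker powers and Yates' algorithm -/

theorem sum_range_mul_div_mod {M : Type*} [AddCommMonoid M] (f : ℕ → ℕ → M) (L Q : ℕ)
    (hQ : 0 < Q) :
    ∑ N ∈ Finset.range (L * Q), f (N / Q) (N % Q)
      = ∑ i ∈ Finset.range L, ∑ j ∈ Finset.range Q, f i j := by
  induction L with
  | zero => simp
  | succ L ih =>
    rw [Nat.succ_mul, Finset.sum_range_add, ih, Finset.sum_range_succ]
    congr 1
    refine Finset.sum_congr rfl fun j hj => ?_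
    have hj := Finset.mem_range.1 hj
    rw [mul_comm L Q, Nat.mul_add_div hQ, Nat.mul_add_mod, Nat.div_eq_of_lt hj,
      Nat.mod_eq_of_lt hj, Nat.add_zero]

/-- The coefficients of a Kronecker power of a matrix, for indices written in base `Q`. -/
def kron {K : Type*} [Field K] (Q : ℕ) (c : ℕ → ℕ → K) : ℕ → ℕ → ℕ → K
  | 0, _, _ => 1
  | j + 1, l, A => kron Q c j (l / Q) (A / Q) * c (l % Q) (A % Q)

/-- One pass of Yates' algorithm: the matrix acts on the leading digit, which becomes the last
one. -/
def yatesPass {K : Type*} [Field K] (Q L : ℕ) (c : ℕ → ℕ → K) (V : ℕ → K) (N : ℕ) : K :=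
  ∑ A ∈ Finset.range Q, c (N % Q) A * V (A * L + N / Q)

/-- After j passes the j leading digits of the argument of V have been transformed and moved to the
low end. Thus the low j digits of N are row indices, and its high digits are the still untransformed
digits. After m passes all digits are back in their original order. -/
theorem yatesPass_iterate {K : Type*} [Field K] {Q : ℕ} (hQ : 0 < Q) (c : ℕ → ℕ → K) (m : ℕ)
    (V : ℕ → K) (j : ℕ) (hj : j ≤ m) (N : ℕ) :
    (yatesPass Q (Q ^ (m - 1)) c)^[j] V N =
      ∑ α ∈ Finset.range (Q ^ j), kron Q c j (N % Q ^ j) α * V (α * Q ^ (m - j) + N / Q ^ j) := by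
  induction j generalizing N with
  | zero => simp [kron]
  | succ j ih =>
    rw [Function.iterate_succ_apply', yatesPass]
    simp only [ih (by omega)]
    have hL : Q ^ (m - 1) = Q ^ j * Q ^ (m - (j + 1)) := by
      rw [← pow_add]; congr 1; omega
    have hL2 : Q ^ (m - j) = Q * Q ^ (m - (j + 1)) := by
      rw [← pow_succ']; congr 1; omega
    have hN : N / Q ^ (j + 1) = N / Q / Q ^ j := by rw [Nat.div_div_eq_div_mul, pow_succ']
    have e1 : ∀ A, (A * Q ^ (m - 1) + N / Q) % Q ^ j = N / Q % Q ^ j := fun A => by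
      rw [hL, show A * (Q ^ j * Q ^ (m - (j + 1))) = Q ^ j * (A * Q ^ (m - (j + 1))) by ring,
        Nat.mul_add_mod]
    have e2 : ∀ A, (A * Q ^ (m - 1) + N / Q) / Q ^ j
        = A * Q ^ (m - (j + 1)) + N / Q ^ (j + 1) := fun A => by
      rw [hL, show A * (Q ^ j * Q ^ (m - (j + 1))) = Q ^ j * (A * Q ^ (m - (j + 1))) by ring,
        Nat.mul_add_div (by positivity), hN]
    simp only [e1, e2]
    have e3 : ∀ α, kron Q c (j + 1) (N % Q ^ (j + 1)) α * V (α * Q ^ (m - (j + 1)) + N / Q ^ (j + 1))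
        = kron Q c j (N / Q % Q ^ j) (α / Q) * c (N % Q) (α % Q) *
          V ((α / Q * Q + α % Q) * Q ^ (m - (j + 1)) + N / Q ^ (j + 1)) := fun α => by
      rw [Nat.div_add_mod', kron, pow_succ', Nat.mod_mul_right_div_self, Nat.mod_mul_right_mod]
    simp only [e3]
    rw [pow_succ Q j, sum_range_mul_div_mod (fun i A => kron Q c j (N / Q % Q ^ j) i * c (N % Q) A *
          V ((i * Q + A) * Q ^ (m - (j + 1)) + N / (Q ^ j * Q))) (Q ^ j) Q hQ, Finset.sum_comm]
    refine Finset.sum_congr rfl fun A _ => ?_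
    rw [Finset.mul_sum]
    refine Finset.sum_congr rfl fun α _ => ?_
    rw [hL2, show α * (Q * Q ^ (m - (j + 1))) + (A * Q ^ (m - (j + 1)) + N / (Q ^ j * Q))
      = (α * Q + A) * Q ^ (m - (j + 1)) + N / (Q ^ j * Q) by ring]
    ring

theorem yatesPass_iterate_full {K : Type*} [Field K] {Q : ℕ} (hQ : 0 < Q) (c : ℕ → ℕ → K) (m : ℕ)
    (V : ℕ → K) (N : ℕ) (hN : N < Q ^ m) :
    (yatesPass Q (Q ^ (m - 1)) c)^[m] V N =
      ∑ α ∈ Finset.range (Q ^ m), kron Q c m N α * V α := by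
  rw [yatesPass_iterate hQ c m V m le_rfl]
  simp [Nat.mod_eq_of_lt hN, Nat.div_eq_of_lt hN]

/-- The mask with `m` blocks of `b` bits whose block masks are given by the base `Q` digits. -/
def blockMask (tab : ℕ → ℕ) (b Q : ℕ) : ℕ → ℕ → ℕ
  | 0, _ => 0
  | m + 1, N => blockMask tab b Q m (N / Q) * 2 ^ b + tab (N % Q)

/-- A leading digit 0 adds an empty block in front because `tab 0 = 0`. -/
theorem blockMask_succ_eq {tab : ℕ → ℕ} (h0 : tab 0 = 0) (b Q : ℕ) (m N : ℕ) (hN : N < Q ^ m) :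
    blockMask tab b Q (m + 1) N = blockMask tab b Q m N := by
  induction m generalizing N with
  | zero =>
    have : N = 0 := by simpa using hN
    subst this
    simp [blockMask, h0]
  | succ m ih =>
    rw [blockMask, ih, ← blockMask]
    rw [pow_succ] at hN
    exact Nat.div_lt_of_lt_mul (by rwa [mul_comm])

/-- This keeps the number of blocks fixed, so that a single table can be filled in increasing order
of N from its own entries N / Q. -/
theorem blockMask_rec {tab : ℕ → ℕ} (h0 : tab 0 = 0) (b Q : ℕ) (m N : ℕ) (hN : N < Q ^ m) :
    blockMask tab b Q m N = blockMask tab b Q m (N / Q) * 2 ^ b + tab (N % Q) := by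
  rw [← blockMask_succ_eq h0 b Q m N hN, blockMask]

theorem bitPartition_add {b m x y z x' y' z' : ℕ} (hx : x' < 2 ^ b) (hy : y' < 2 ^ b)
    (hz : z' < 2 ^ b) :
    BitPartition (b * (m + 1)) (x * 2 ^ b + x') (y * 2 ^ b + y') (z * 2 ^ b + z') ↔
      BitPartition (b * m) x y z ∧ BitPartition b x' y' z' := by
  have e : ∀ {a a' : ℕ}, a' < 2 ^ b → ∀ i, (a * 2 ^ b + a').testBit i =
      if i < b then a'.testBit i else a.testBit (i - b) := fun {a a'} h i => by
    rw [mul_comm a, Nat.testBit_two_pow_mul_add _ h]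
  constructor
  · intro h
    refine ⟨fun i hi => ?_, fun i hi => ?_⟩
    · have := h (b + i) (by rw [mul_add]; omega)
      rw [e hx, e hy, e hz] at this
      simpa using this
    · have := h i (by rw [mul_add]; omega)
      rw [e hx, e hy, e hz] at this
      simpa [hi] using this
  · rintro ⟨h1, h2⟩ i hi
    rw [e hx, e hy, e hz]
    by_cases hib : i < b
    · simpa [hib] using h2 i hib
    · simpa [hib] using h1 (i - b) (by rw [mul_add] at hi; omega)

theorem piece_add_low {β r x x' q : ℕ} (hx : x' < 2 ^ (β * r)) (hq : q < r) :
    piece β (x * 2 ^ (β * r) + x') q = piece β x' q := by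
  ext o
  have : β * q + o < β * r := by
    have := o.2
    calc β * q + o < β * q + β := by omega
      _ = β * (q + 1) := by ring
      _ ≤ β * r := Nat.mul_le_mul_left _ (by omega)
  rw [mem_piece, mem_piece, mul_comm x, Nat.testBit_two_pow_mul_add _ hx, if_pos this]

theorem piece_add_high {β r x x' q : ℕ} (hx : x' < 2 ^ (β * r)) :
    piece β (x * 2 ^ (β * r) + x') (r + q) = piece β x q := by
  ext o
  have e : β * (r + q) + o = β * r + (β * q + o) := by ring
  rw [mem_piece, mem_piece, mul_comm x, Nat.testBit_two_pow_mul_add _ hx, e,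
    if_neg (by omega), Nat.add_sub_cancel_left]

theorem smallMasks_add {β k r s x x' : ℕ} (hx : x' < 2 ^ (β * r)) :
    x * 2 ^ (β * r) + x' ∈ smallMasks β k (r + s) ↔
      x ∈ smallMasks β k s ∧ x' ∈ smallMasks β k r := by
  simp only [smallMasks, Finset.mem_filter, Finset.mem_range]
  have hlt : x * 2 ^ (β * r) + x' < 2 ^ (β * (r + s)) ↔ x < 2 ^ (β * s) := by
    rw [mul_add, pow_add]
    generalize 2 ^ (β * r) = a at *
    generalize 2 ^ (β * s) = b
    constructor
    · intro h
      by_contra! hle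
      nlinarith
    · intro h
      nlinarith
  rw [hlt]
  constructor
  · rintro ⟨h1, h2⟩
    refine ⟨⟨h1, fun q hq => ?_⟩, hx, fun q hq => ?_⟩
    · rw [← piece_add_high hx]; exact h2 _ (by omega)
    · rw [← piece_add_low hx hq]; exact h2 _ (by omega)
  · rintro ⟨⟨h1, h2⟩, -, h3⟩
    refine ⟨h1, fun q hq => ?_⟩
    by_cases hqr : q < r
    · rw [piece_add_low hx hqr]; exact h3 q hqr
    · obtain ⟨q', rfl⟩ := Nat.exists_eq_add_of_le (not_lt.1 hqr)
      rw [piece_add_high hx]; exact h2 q' (by omega)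

/-- Only upper bounds are imposed on the pieces. The dynamic programming, which removes sets from
masks, depends on this. -/
theorem smallMasks_of_subset {β k r x y : ℕ} (hx : x ∈ smallMasks β k r)
    (h : ∀ i, y.testBit i = true → x.testBit i = true) : y ∈ smallMasks β k r := by
  obtain ⟨h1, h2⟩ := Finset.mem_filter.1 hx
  refine Finset.mem_filter.2 ⟨Finset.mem_range.2 (Nat.lt_pow_two_of_testBit _ fun i hi => ?_),
    fun q hq => (Finset.card_le_card fun o ho => ?_).trans (h2 q hq)⟩
  · by_contra hne
    have h3 := h i (by simpa using hne)
    have : x < 2 ^ i := (Finset.mem_range.1 h1).trans_le (Nat.pow_le_pow_right (by norm_num) hi)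
    rw [Nat.testBit_lt_two_pow this] at h3
    exact absurd h3 (by simp)
  · rw [mem_piece] at ho ⊢
    exact h _ ho

/-! ### Masks with several blocks and the trilinear form on them -/

namespace BlockData

variable {K : Type*} [Field K] {h k r Q : ℕ} (B : BlockData K h k r Q)

/-- The mask with the number `N`, for `m` blocks. -/
def mask (m N : ℕ) : ℕ := blockMask B.tab (3 * h * r) Q m N

theorem tab_lt {A : ℕ} (hA : A < Q) : B.tab A < 2 ^ (3 * h * r) :=
  Finset.mem_range.1 (Finset.mem_filter.1 (B.tab_mem A hA)).1

theorem mask_mem (hQ : 0 < Q) (m N : ℕ) : B.mask m N ∈ smallMasks (3 * h) k (r * m) := by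
  induction m generalizing N with
  | zero => simpa [mask, blockMask] using zero_mem_smallMasks (3 * h) k 0
  | succ m ih =>
    have hA := Nat.mod_lt N hQ
    rw [mask, blockMask, Nat.mul_succ, Nat.add_comm (r * m), smallMasks_add (B.tab_lt hA)]
    exact ⟨ih _, B.tab_mem _ hA⟩

theorem mask_lt (hQ : 0 < Q) (m N : ℕ) : B.mask m N < 2 ^ (3 * h * r * m) := by
  rw [mul_assoc]
  exact Finset.mem_range.1 (Finset.mem_filter.1 (B.mask_mem hQ m N)).1

theorem exists_mask {m x : ℕ} (hx : x ∈ smallMasks (3 * h) k (r * m)) :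
    ∃ N < Q ^ m, B.mask m N = x := by
  induction m generalizing x with
  | zero =>
    have := (Finset.mem_filter.1 hx).1
    simp only [mul_zero, pow_zero, Finset.mem_range, Nat.lt_one_iff] at this
    exact ⟨0, by simp, by simp [mask, blockMask, this]⟩
  | succ m ih =>
    have hlt : x % 2 ^ (3 * h * r) < 2 ^ (3 * h * r) := Nat.mod_lt _ (by positivity)
    rw [← Nat.div_add_mod' x (2 ^ (3 * h * r)), Nat.mul_succ, Nat.add_comm (r * m),
      smallMasks_add hlt] at hx
    obtain ⟨N, hN, hN'⟩ := ih hx.1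
    obtain ⟨A, hA, hA'⟩ := B.exists_tab _ hx.2
    refine ⟨N * Q + A, ?_, ?_⟩
    · rw [pow_succ]
      calc N * Q + A < N * Q + Q := by omega
        _ = (N + 1) * Q := by ring
        _ ≤ _ := Nat.mul_le_mul_right _ hN
    · have hQ : 0 < Q := by omega
      rw [mask] at hN'
      rw [mask, blockMask, mul_comm N, Nat.mul_add_div hQ, Nat.div_eq_of_lt hA, Nat.mul_add_mod,
        Nat.mod_eq_of_lt hA, Nat.add_zero, hN', hA', Nat.div_add_mod']

-- Split off the last digit of l: the sum factors into the sum for m blocks and the sum for one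
-- block, just as the partition condition splits.
open Classical in
theorem sum_kron (hQ : 0 < Q) (m : ℕ) (A₁ A₂ A₃ : ℕ) :
    ∑ l ∈ Finset.range (Q ^ m), kron Q (B.coef 0) m l A₁ * kron Q (B.coef 1) m l A₂ *
      kron Q (B.coef 2) m l A₃ =
    if BitPartition (3 * h * r * m) (B.mask m A₁) (B.mask m A₂) (B.mask m A₃) then 1 else 0 := by
  induction m generalizing A₁ A₂ A₃ with
  | zero => simp [kron, BitPartition]
  | succ m ih =>
    have h1 := Nat.mod_lt A₁ hQ
    have h2 := Nat.mod_lt A₂ hQ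
    have h3 := Nat.mod_lt A₃ hQ
    simp only [kron]
    rw [pow_succ, sum_range_mul_div_mod (fun i l =>
      kron Q (B.coef 0) m i (A₁ / Q) * B.coef 0 l (A₁ % Q) *
      (kron Q (B.coef 1) m i (A₂ / Q) * B.coef 1 l (A₂ % Q)) *
      (kron Q (B.coef 2) m i (A₃ / Q) * B.coef 2 l (A₃ % Q))) _ _ hQ]
    have e : ∀ i l, kron Q (B.coef 0) m i (A₁ / Q) * B.coef 0 l (A₁ % Q) *
      (kron Q (B.coef 1) m i (A₂ / Q) * B.coef 1 l (A₂ % Q)) *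
      (kron Q (B.coef 2) m i (A₃ / Q) * B.coef 2 l (A₃ % Q)) =
      (kron Q (B.coef 0) m i (A₁ / Q) * kron Q (B.coef 1) m i (A₂ / Q) *
        kron Q (B.coef 2) m i (A₃ / Q)) *
      (B.coef 0 l (A₁ % Q) * B.coef 1 l (A₂ % Q) * B.coef 2 l (A₃ % Q)) := fun i l => by ring
    simp only [e]
    rw [← Finset.sum_mul_sum, ih]
    have hiff : BitPartition (3 * h * r * (m + 1)) (B.mask (m + 1) A₁) (B.mask (m + 1) A₂)
        (B.mask (m + 1) A₃) ↔ BitPartition (3 * h * r * m) (B.mask m (A₁ / Q)) (B.mask m (A₂ / Q))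
        (B.mask m (A₃ / Q)) ∧ BitPartition (3 * h * r) (B.tab (A₁ % Q)) (B.tab (A₂ % Q))
        (B.tab (A₃ % Q)) :=
      bitPartition_add (B.tab_lt h1) (B.tab_lt h2) (B.tab_lt h3)
    rw [hiff]
    by_cases hp : BitPartition (3 * h * r) (B.tab (A₁ % Q)) (B.tab (A₂ % Q)) (B.tab (A₃ % Q))
    · rw [B.sum_one _ h1 _ h2 _ h3 hp]; simp [hp]
    · rw [B.sum_zero _ h1 _ h2 _ h3 hp]; simp [hp]

/-- The value that is computed by three runs of Yates' algorithm. -/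
def value (m : ℕ) (x : ℕ → ℕ → K) : K :=
  ∑ N ∈ Finset.range (Q ^ m), (yatesPass Q (Q ^ (m - 1)) (B.coef 0))^[m] (x 0) N *
    (yatesPass Q (Q ^ (m - 1)) (B.coef 1))^[m] (x 1) N *
    (yatesPass Q (Q ^ (m - 1)) (B.coef 2))^[m] (x 2) N

-- The iterates are products with the Kronecker powers of the coefficient matrices; expanding them
-- and summing over N first reduces the claim to `sum_kron`.
open Classical in
theorem value_eq (hQ : 0 < Q) (m : ℕ) (x : ℕ → ℕ → K) :
    B.value m x = ∑ A₁ ∈ Finset.range (Q ^ m), ∑ A₂ ∈ Finset.range (Q ^ m),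
      ∑ A₃ ∈ Finset.range (Q ^ m),
      (if BitPartition (3 * h * r * m) (B.mask m A₁) (B.mask m A₂) (B.mask m A₃) then 1 else 0) *
      (x 0 A₁ * x 1 A₂ * x 2 A₃) := by
  have e : ∀ N ∈ Finset.range (Q ^ m), (yatesPass Q (Q ^ (m - 1)) (B.coef 0))^[m] (x 0) N *
    (yatesPass Q (Q ^ (m - 1)) (B.coef 1))^[m] (x 1) N *
    (yatesPass Q (Q ^ (m - 1)) (B.coef 2))^[m] (x 2) N =
    ∑ A₁ ∈ Finset.range (Q ^ m), ∑ A₂ ∈ Finset.range (Q ^ m), ∑ A₃ ∈ Finset.range (Q ^ m),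
      (kron Q (B.coef 0) m N A₁ * kron Q (B.coef 1) m N A₂ * kron Q (B.coef 2) m N A₃) *
      (x 0 A₁ * x 1 A₂ * x 2 A₃) := fun N hN => by
    have hN := Finset.mem_range.1 hN
    rw [yatesPass_iterate_full hQ _ _ _ _ hN, yatesPass_iterate_full hQ _ _ _ _ hN,
      yatesPass_iterate_full hQ _ _ _ _ hN, Finset.sum_mul_sum, Finset.sum_mul]
    refine Finset.sum_congr rfl fun A₁ _ => ?_
    rw [Finset.sum_mul]
    refine Finset.sum_congr rfl fun A₂ _ => ?_
    rw [Finset.mul_sum]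
    exact Finset.sum_congr rfl fun A₃ _ => by ring
  rw [value, Finset.sum_congr rfl e, Finset.sum_comm]
  refine Finset.sum_congr rfl fun A₁ _ => ?_
  rw [Finset.sum_comm]
  refine Finset.sum_congr rfl fun A₂ _ => ?_
  rw [Finset.sum_comm]
  refine Finset.sum_congr rfl fun A₃ _ => ?_
  rw [← B.sum_kron hQ, Finset.sum_mul]

end BlockData

/-! ### Covering masks -/

/-- The elements `e < n` in the set with characteristic bits `x` can be covered by at most `τ`
sets of the family. -/
def CoveredBy {n : ℕ} (fam : List (Finset (Fin n))) (τ x : ℕ) : Prop :=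
  ∃ L : List (Finset (Fin n)), L.length ≤ τ ∧ (∀ X ∈ L, X ∈ fam) ∧
    ∀ e : Fin n, x.testBit e = true → ∃ X ∈ L, e ∈ X

/-- The mask of the elements below `n` of `x` at which `χ` vanishes. -/
def diffMask (n x : ℕ) (χ : ℕ → ℕ) : ℕ :=
  ∑ e ∈ Finset.range n, 2 ^ e * (x / 2 ^ e % 2) * (1 - χ e)

theorem diffMask_lt_and_testBit (n x : ℕ) (χ : ℕ → ℕ) (hχ : ∀ e, χ e ≤ 1) :
    diffMask n x χ < 2 ^ n ∧
      ∀ i, (diffMask n x χ).testBit i = true ↔ i < n ∧ x.testBit i = true ∧ χ i = 0 := by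
  induction n with
  | zero => simp [diffMask]
  | succ n ih =>
    obtain ⟨h1, h2⟩ := ih
    have hrec : diffMask (n + 1) x χ = 2 ^ n * ((x / 2 ^ n % 2) * (1 - χ n)) + diffMask n x χ := by
      rw [diffMask, Finset.sum_range_succ, diffMask]; ring
    have hb : (x / 2 ^ n % 2) * (1 - χ n) ≤ 1 := by
      have a := Nat.mod_lt (x / 2 ^ n) (show 0 < 2 by norm_num)
      calc _ ≤ 1 * 1 := Nat.mul_le_mul (by omega) (by omega)
        _ = 1 := rfl
    constructor
    · rw [hrec, pow_succ]
      have := Nat.mul_le_mul_left (2 ^ n) hb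
      omega
    · intro i
      rw [hrec, Nat.testBit_two_pow_mul_add _ h1]
      split_ifs with hi
      · rw [h2]
        constructor
        · rintro ⟨-, h⟩; exact ⟨by omega, h⟩
        · rintro ⟨-, h⟩; exact ⟨hi, h⟩
      · by_cases hin : i = n
        · subst hin
          have hx : x.testBit i = decide (x / 2 ^ i % 2 = 1) := Nat.testBit_eq_decide_div_mod_eq
          rw [Nat.sub_self, hx]
          have a := Nat.mod_two_eq_zero_or_one (x / 2 ^ i)
          have b := hχ i
          rcases a with a | a <;> rcases Nat.le_one_iff_eq_zero_or_eq_one.1 b with b | b <;>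
            simp [a, b]
        · rw [Nat.testBit_lt_two_pow]
          · constructor
            · intro h; exact absurd h (by simp)
            · rintro ⟨h, -⟩; omega
          · calc (x / 2 ^ n % 2) * (1 - χ n) ≤ 1 := hb
              _ < 2 ^ (i - n) := Nat.one_lt_two_pow (by omega)

theorem coveredBy_zero {n : ℕ} (fam : List (Finset (Fin n))) (x : ℕ) :
    CoveredBy fam 0 x ↔ x % 2 ^ n = 0 := by
  constructor
  · rintro ⟨L, hL, -, h⟩
    have hL : L = [] := List.length_eq_zero_iff.1 (by omega)
    subst hL
    refine Nat.eq_of_testBit_eq fun i => ?_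
    rw [Nat.testBit_mod_two_pow, Nat.zero_testBit]
    by_contra hne
    simp only [Bool.and_eq_false_imp, decide_eq_true_eq, not_forall, Bool.not_eq_false] at hne
    obtain ⟨hi, hx⟩ := hne
    obtain ⟨X, hX, -⟩ := h ⟨i, hi⟩ hx
    simp at hX
  · intro h
    refine ⟨[], le_rfl, by simp, fun e he => ?_⟩
    have := Nat.testBit_mod_two_pow x n e
    rw [h, Nat.zero_testBit, he] at this
    simp at this

/-- The recursion of the dynamic programming: remove the elements of the first set of the cover. The
alternative without a set is needed because only at most τ sets are demanded. -/
theorem coveredBy_succ {n : ℕ} (fam : List (Finset (Fin n))) (τ x : ℕ) :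
    CoveredBy fam (τ + 1) x ↔ CoveredBy fam τ x ∨
      ∃ X ∈ fam, CoveredBy fam τ (diffMask n x fun e => if e ∈ X.map Fin.valEmbedding then 1 else 0)
      := by
  have key : ∀ (X : Finset (Fin n)) (e : Fin n),
      (diffMask n x fun e => if e ∈ X.map Fin.valEmbedding then 1 else 0).testBit e = true ↔
      x.testBit e = true ∧ e ∉ X := fun X e => by
    rw [(diffMask_lt_and_testBit n x _ (fun e => by split_ifs <;> simp)).2]
    simp [Fin.val_inj]
  constructor
  · rintro ⟨L, hL, h1, h2⟩
    cases L with
    | nil => exact Or.inl ⟨[], by simp, by simp, h2⟩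
    | cons X L =>
      refine Or.inr ⟨X, h1 X (by simp), L, by simpa using hL, fun Y hY => h1 Y (by simp [hY]),
        fun e he => ?_⟩
      rw [key] at he
      obtain ⟨Y, hY, heY⟩ := h2 e he.1
      rcases List.mem_cons.1 hY with rfl | hY
      · exact absurd heY he.2
      · exact ⟨Y, hY, heY⟩
  · rintro (⟨L, hL, h⟩ | ⟨X, hX, L, hL, h1, h2⟩)
    · exact ⟨L, by omega, h⟩
    · refine ⟨X :: L, by simpa using hL, ?_, fun e he => ?_⟩
      · simpa [hX] using h1
      · by_cases heX : e ∈ X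
        · exact ⟨X, by simp, heX⟩
        · obtain ⟨Y, hY, heY⟩ := h2 e ((key X e).2 ⟨he, heX⟩)
          exact ⟨Y, by simp [hY], heY⟩

/-! ### Covers and three-part partitions -/

namespace SetCoverInstance

variable {s : ℕ} (I : SetCoverInstance s)

theorem isYes_of_partition {N x y z t₁ t₂ t₃ : ℕ} (hN : I.n ≤ N) (h : BitPartition N x y z)
    (hx : CoveredBy I.family t₁ x) (hy : CoveredBy I.family t₂ y) (hz : CoveredBy I.family t₃ z)
    (ht : t₁ + t₂ + t₃ ≤ I.t) : I.IsYes := by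
  classical
  obtain ⟨L₁, l1, f1, c1⟩ := hx
  obtain ⟨L₂, l2, f2, c2⟩ := hy
  obtain ⟨L₃, l3, f3, c3⟩ := hz
  refine ⟨(L₁ ++ L₂ ++ L₃).toFinset, ?_, ?_, ?_⟩
  · intro X hX
    simp only [List.mem_toFinset, List.mem_append] at hX
    rcases hX with (hX | hX) | hX
    · exact f1 X hX
    · exact f2 X hX
    · exact f3 X hX
  · refine (List.toFinset_card_le _).trans ?_
    simp only [List.length_append]
    omega
  · refine Finset.eq_univ_of_forall fun e => ?_
    simp only [Finset.mem_biUnion, List.mem_toFinset, List.mem_append, id]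
    have := e.2
    rcases h e (by omega) with ⟨a, -, -⟩ | ⟨-, a, -⟩ | ⟨-, -, a⟩
    · obtain ⟨X, hX, heX⟩ := c1 e a; exact ⟨X, by simp [hX], heX⟩
    · obtain ⟨X, hX, heX⟩ := c2 e a; exact ⟨X, by simp [hX], heX⟩
    · obtain ⟨X, hX, heX⟩ := c3 e a; exact ⟨X, by simp [hX], heX⟩

/-- A yes-instance has a cover that splits into three parts which are nearly balanced in every
block. -/
theorem exists_partition_of_isYes (hyes : I.IsYes) {h R : ℕ} (hh : 0 < h) :
    ∃ t₁ t₂ t₃ x y z, t₁ + t₂ + t₃ = min I.t I.n ∧ BitPartition (3 * h * R) x y z ∧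
      x ∈ smallMasks (3 * h) (h + 2 * (s + 1)) R ∧ y ∈ smallMasks (3 * h) (h + 2 * (s + 1)) R ∧
      z ∈ smallMasks (3 * h) (h + 2 * (s + 1)) R ∧ CoveredBy I.family t₁ x ∧
      CoveredBy I.family t₂ y ∧ CoveredBy I.family t₃ z := by
  classical
  obtain ⟨G, hG, hGt, hGu⟩ := hyes
  have hex : ∀ e : Fin I.n, ∃ X ∈ G, e ∈ X := fun e => by
    have : e ∈ G.biUnion id := by rw [hGu]; exact Finset.mem_univ e
    simpa using this
  choose f hfG hfe using hex
  -- Sets not chosen for any element are dropped, which also bounds the number of sets by n.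
  set G' := Finset.univ.image f with hG'
  have hG'n : G'.card ≤ I.n := by simpa using Finset.card_image_le (s := Finset.univ) (f := f)
  have hG't : G'.card ≤ I.t := (Finset.card_le_card fun X hX => by
    obtain ⟨e, -, rfl⟩ := Finset.mem_image.1 hX
    exact hfG e).trans hGt
  -- Positions from n on are padding and form items of their own. Their size 1 may exceed s when s =
  -- 0, which is why s + 1 appears below.
  let item : Fin R × Fin (3 * h) → Finset (Fin I.n) ⊕ (Fin R × Fin (3 * h)) := fun q =>
    if hq : 3 * h * q.1 + q.2 < I.n then Sum.inl (f ⟨_, hq⟩) else Sum.inr q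
  have hitem : ∀ j, (Finset.univ.filter fun e => item e = j).card ≤ s + 1 := by
    rintro (X | q)
    · by_cases hX : X ∈ G
      · refine le_trans ?_ ((I.card_le X (hG X hX)).trans (Nat.le_succ s))
        rw [← Finset.card_map Fin.valEmbedding]
        refine Finset.card_le_card_of_injOn (fun q => 3 * h * q.1 + q.2) (fun q hq => ?_) ?_
        · have hq := (Finset.mem_filter.1 hq).2
          simp only [item] at hq
          split_ifs at hq with hlt
          refine Finset.mem_coe.2 (Finset.mem_map.2 ⟨⟨_, hlt⟩, ?_, rfl⟩)
          rw [← Sum.inl.inj hq]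
          exact hfe _
        · rintro ⟨q, o⟩ - ⟨q', o'⟩ - heq
          have h3 : 0 < 3 * h := by omega
          have e1 := congrArg (· / (3 * h)) heq
          have e2 := congrArg (· % (3 * h)) heq
          simp only [Nat.mul_add_div h3, Nat.div_eq_of_lt o.2, Nat.div_eq_of_lt o'.2,
            Nat.add_zero] at e1
          simp only [Nat.mul_add_mod, Nat.mod_eq_of_lt o.2, Nat.mod_eq_of_lt o'.2] at e2
          exact Prod.ext (Fin.ext e1) (Fin.ext e2)
      · rw [Finset.card_eq_zero.2]
        · omega
        · refine Finset.filter_eq_empty_iff.2 fun e _ he => hX ?_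
          simp only [item] at he
          split_ifs at he with hq
          rw [← Sum.inl.inj he]
          exact hfG _
    · refine le_trans (Finset.card_le_card (t := {q}) fun e he => ?_) (by simp)
      have he := (Finset.mem_filter.1 he).2
      simp only [item] at he
      split_ifs at he with hq
      simpa using he
  obtain ⟨color, hcolor⟩ := exists_three_coloring (fun e : Fin R × Fin (3 * h) => e.1) item h (s + 1)
    (fun i => by
      have : (Finset.univ.filter fun e : Fin R × Fin (3 * h) => e.1 = i)
          = {i} ×ˢ Finset.univ := by ext ⟨a, b⟩; simp [eq_comm]
      rw [this]; simp) hitem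
  let cl : ℕ → Fin 3 := fun i => if hi : i / (3 * h) < R then
    color (item (⟨i / (3 * h), hi⟩, ⟨i % (3 * h), Nat.mod_lt _ (by omega)⟩)) else 0
  let mk : Fin 3 → ℕ := fun c => Nat.ofBits fun i : Fin (3 * h * R) => decide (cl i = c)
  have mk_bit : ∀ c i, (mk c).testBit i = true ↔ i < 3 * h * R ∧ cl i = c := fun c i => by
    by_cases hi : i < 3 * h * R
    · simp [mk, Nat.testBit_ofBits_lt _ _ hi, hi]
    · simp [mk, Nat.testBit_ofBits_ge _ _ (not_lt.1 hi), hi]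
  have mk_mem : ∀ c, mk c ∈ smallMasks (3 * h) (h + 2 * (s + 1)) R := fun c => by
    refine Finset.mem_filter.2 ⟨Finset.mem_range.2 (Nat.ofBits_lt_two_pow _), fun q hq => ?_⟩
    refine le_trans ?_ (hcolor ⟨q, hq⟩ c)
    refine Finset.card_le_card_of_injOn (fun o => (⟨q, hq⟩, o)) (fun o ho => ?_)
      (fun o _ o' _ h => by simpa using h)
    rw [Finset.mem_coe, mem_piece, mk_bit] at ho
    have h3 : 0 < 3 * h := by omega
    have e1 : (3 * h * q + o) / (3 * h) = q := by
      rw [Nat.mul_add_div h3, Nat.div_eq_of_lt o.2, Nat.add_zero]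
    have e2 : (3 * h * q + o) % (3 * h) = o := by
      rw [Nat.mul_add_mod, Nat.mod_eq_of_lt o.2]
    have ho := ho.2
    simp only [cl, e1, e2, hq, dif_pos, Fin.eta] at ho
    simpa using ho
  have mk_cov : ∀ c, CoveredBy I.family (G'.filter fun X => color (Sum.inl X) = c).card (mk c) := by
    intro c
    refine ⟨(G'.filter fun X => color (Sum.inl X) = c).toList, by simp, fun X hX => ?_,
      fun e he => ⟨f e, ?_, hfe e⟩⟩
    · simp only [Finset.mem_toList, Finset.mem_filter, hG', Finset.mem_image] at hX
      obtain ⟨⟨e, -, rfl⟩, -⟩ := hX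
      exact hG _ (hfG e)
    · rw [mk_bit] at he
      simp only [Finset.mem_toList, Finset.mem_filter, hG', Finset.mem_image]
      refine ⟨⟨e, Finset.mem_univ e, rfl⟩, ?_⟩
      rw [← he.2]
      have h1 : (e : ℕ) / (3 * h) < R := Nat.div_lt_of_lt_mul he.1
      simp only [cl, h1, dif_pos, item, Nat.div_add_mod, e.2, Fin.eta]
  have hsum : (G'.filter fun X => color (Sum.inl X) = 0).card +
      (G'.filter fun X => color (Sum.inl X) = 1).card +
      (G'.filter fun X => color (Sum.inl X) = 2).card = G'.card := by
    rw [Finset.card_eq_sum_card_fiberwise (s := G') (f := fun X => color (Sum.inl X))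
      (t := Finset.univ) (by simp), Fin.sum_univ_three]
  obtain ⟨L, hL, hL'⟩ := mk_cov 2
  -- The third budget takes all that is left, so that the budgets sum exactly to min t n and one of
  -- the guesses hits them.
  refine ⟨_, _, min I.t I.n - (G'.filter fun X => color (Sum.inl X) = 0).card -
    (G'.filter fun X => color (Sum.inl X) = 1).card, mk 0, mk 1, mk 2, ?_, fun i hi => ?_,
    mk_mem 0, mk_mem 1, mk_mem 2, mk_cov 0, mk_cov 1, L, ?_, hL'⟩
  · omega
  · simp only [mk_bit, hi, true_and, ExactlyOne]
    generalize cl i = c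
    fin_cases c <;> simp
  · omega

end SetCoverInstance

/-! ### Fair random bits -/

namespace RAM

instance : IsProbabilityMeasure fairCoins := by unfold fairCoins; infer_instance

theorem map_xor_uniform (c : Bool) :
    (PMF.uniformOfFintype Bool).toMeasure.map (fun b => xor b c)
      = (PMF.uniformOfFintype Bool).toMeasure := by
  refine Measure.ext_of_singleton fun b => ?_
  rw [Measure.map_apply (measurable_of_finite _) (MeasurableSet.singleton b)]
  have : (fun b => xor b c) ⁻¹' {b} = {xor b c} := by
    ext x
    simp only [Set.mem_preimage, Set.mem_singleton_iff]
    revert x b c; decide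
  rw [this, PMF.toMeasure_apply_singleton _ _ (MeasurableSet.singleton _),
    PMF.toMeasure_apply_singleton _ _ (MeasurableSet.singleton _)]
  simp

theorem measurePreserving_xor (c : ℕ → Bool) :
    MeasurePreserving (fun (ω : ℕ → Bool) n => xor (ω n) (c n)) fairCoins fairCoins := by
  refine ⟨by fun_prop, ?_⟩
  unfold fairCoins
  rw [Measure.infinitePi_map_pi (f := fun n b => xor b (c n)) _ fun n => measurable_of_finite _]
  simp only [map_xor_uniform]

theorem measurableSet_of_finite_coordinates (A : Set (ℕ → Bool)) (M : ℕ)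
    (hA : ∀ ω ω' : ℕ → Bool, (∀ n < M, ω n = ω' n) → ω ∈ A → ω' ∈ A) : MeasurableSet A := by
  have hm : Measurable fun (ω : ℕ → Bool) (i : Fin M) => ω i := by fun_prop
  have : A = (fun (ω : ℕ → Bool) (i : Fin M) => ω i) ⁻¹'
      {v | (fun n => if h : n < M then v ⟨n, h⟩ else false) ∈ A} := by
    ext ω
    constructor
    · intro h
      exact hA ω _ (fun n hn => by simp [hn]) h
    · intro h
      exact hA _ ω (fun n hn => by simp [hn]) h
  rw [this]
  exact hm (Set.toFinite _).measurableSet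

/-- The bits to be flipped. -/
noncomputable def flipMask {k : ℕ} (p : Fin k → Fin 3 → ℕ) (S : Fin k → Fin 3 → Bool) (n : ℕ) :
    Bool :=
  open Classical in decide (∃ i j, p i j = n ∧ S i j = true)

/-- If each of nine experiments succeeds for at least one of the eight ways to flip three bits of
its own, then some experiment succeeds with probability at least `2/3`. -/
theorem two_thirds_le_of_flips (p : Fin 9 → Fin 3 → ℕ) (success : Fin 9 → (ℕ → Bool) → Prop)
    (hmeas : MeasurableSet {ω | ∃ i, success i ω})
    (h : ∀ (ω : ℕ → Bool) i, ∃ b : Fin 3 → Bool, ∀ S : Fin 9 → Fin 3 → Bool, S i = b →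
      success i (fun n : ℕ => xor (ω n) (flipMask p S n))) :
    2 / 3 ≤ fairCoins {ω | ∃ i, success i ω} := by
  classical
  set A := {ω | ∃ i, success i ω} with hA
  set fl : (Fin 9 → Fin 3 → Bool) → (ℕ → Bool) → ℕ → Bool :=
    fun S ω n => xor (ω n) (flipMask p S n) with hfl
  -- Averaging over flip patterns: a pattern that fails must avoid one of eight choices in each of
  -- nine coordinates, so at most 7^9 of 8^9 fail. Each flip preserves the measure, hence the
  -- failure probability is at most (7/8)^9 < 1/3.
  have hcount : ∀ ω, 8 ^ 9 - 7 ^ 9 ≤ (Finset.univ.filter fun S => fl S ω ∈ A).card := by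
    intro ω
    choose b hb using h ω
    have hbad : (Finset.univ.filter fun S => ¬fl S ω ∈ A).card ≤ 7 ^ 9 := by
      have h1 : (Finset.univ.filter fun S => ¬fl S ω ∈ A) ⊆
          Fintype.piFinset fun i => Finset.univ.erase (b i) := by
        intro S hS
        rw [Fintype.mem_piFinset]
        intro i
        refine Finset.mem_erase.2 ⟨fun hSi => ?_, Finset.mem_univ _⟩
        exact (Finset.mem_filter.1 hS).2 ⟨i, hb i S hSi⟩
      refine (Finset.card_le_card h1).trans ?_
      rw [Fintype.card_piFinset]
      simp [Finset.card_erase_of_mem]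
    have htot := Finset.card_filter_add_card_filter_not (s := Finset.univ)
      (fun S => fl S ω ∈ A)
    have hcard : (Finset.univ : Finset (Fin 9 → Fin 3 → Bool)).card = 8 ^ 9 := by
      simp [Finset.card_univ]
    rw [hcard] at htot
    omega
  have hsum : ∑ S : Fin 9 → Fin 3 → Bool, fairCoins (fl S ⁻¹' A) = 8 ^ 9 * fairCoins A := by
    have : ∀ S, fairCoins (fl S ⁻¹' A) = fairCoins A := fun S =>
      (measurePreserving_xor (flipMask p S)).measure_preimage hmeas.nullMeasurableSet
    simp only [this, Finset.sum_const, Finset.card_univ, nsmul_eq_mul]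
    congr 1
    simp
    norm_num
  have hint : ∑ S : Fin 9 → Fin 3 → Bool, fairCoins (fl S ⁻¹' A)
      = ∫⁻ ω, ((Finset.univ.filter fun S => fl S ω ∈ A).card : ENNReal) ∂fairCoins := by
    have hm : ∀ S, MeasurableSet (fl S ⁻¹' A) := fun S =>
      (measurePreserving_xor (flipMask p S)).measurable hmeas
    simp only [← lintegral_indicator_one (hm _)]
    rw [← lintegral_finsetSum _ fun S _ => measurable_one.indicator (hm S)]
    refine lintegral_congr fun ω => ?_
    rw [Finset.card_filter]
    push_cast
    refine Finset.sum_congr rfl fun S _ => ?_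
    simp [Set.indicator_apply]
  have hle : ((8 ^ 9 - 7 ^ 9 : ℕ) : ENNReal) ≤ 8 ^ 9 * fairCoins A := by
    rw [← hsum, hint]
    calc ((8 ^ 9 - 7 ^ 9 : ℕ) : ENNReal)
        = ∫⁻ _, ((8 ^ 9 - 7 ^ 9 : ℕ) : ENNReal) ∂fairCoins := by simp
      _ ≤ _ := lintegral_mono fun ω => Nat.cast_le.2 (hcount ω)
  have hreal := ENNReal.toReal_mono (by finiteness) hle
  rw [ENNReal.toReal_natCast, ENNReal.toReal_mul, ENNReal.toReal_pow, ENNReal.toReal_ofNat] at hreal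
  norm_num at hreal
  rw [← ENNReal.ofReal_toReal (measure_ne_top fairCoins A),
    show (2 / 3 : ENNReal) = ENNReal.ofReal (2 / 3) by
      rw [ENNReal.ofReal_div_of_pos (by norm_num)]; simp]
  exact ENNReal.ofReal_le_ofReal (by linarith)

end RAM

/-! ### Nonvanishing of multilinear forms at random points -/

section Multilinear

variable {K : Type*} [Field K]

/-- As a function of the entry at A the sum is affine with nonzero slope, so it cannot vanish at
both 0 and 1. This holds over every field, however small. -/
theorem exists_bit_sum_ne_zero (L : ℕ) (f x : ℕ → K) {A : ℕ} (hA : A < L) (hf : f A ≠ 0) :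
    ∃ b : Bool, ∑ N ∈ Finset.range L, f N * Function.update x A (if b then 1 else 0) N ≠ 0 := by
  have key : ∀ v, ∑ N ∈ Finset.range L, f N * Function.update x A v N
      = f A * v + ∑ N ∈ (Finset.range L).erase A, f N * x N := fun v => by
    rw [← Finset.add_sum_erase _ _ (Finset.mem_range.2 hA)]
    simp only [Function.update_self]
    congr 1
    refine Finset.sum_congr rfl fun N hN => ?_
    rw [Function.update_of_ne (Finset.ne_of_mem_erase hN)]
  by_cases h0 : ∑ N ∈ (Finset.range L).erase A, f N * x N = 0
  · exact ⟨true, by rw [key, h0]; simpa using hf⟩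
  · exact ⟨false, by rw [key]; simpa using h0⟩

/-- Fix the bits one after another, starting with the third: each choice leaves a form in fewer
arguments whose coefficient at the chosen position is nonzero. -/
theorem exists_bits_trilinear_ne_zero (L : ℕ) (c : ℕ → ℕ → ℕ → K) (x : ℕ → ℕ → K) (A : ℕ → ℕ)
    (hA : ∀ κ < 3, A κ < L) (hc : c (A 0) (A 1) (A 2) ≠ 0) :
    ∃ b : ℕ → Bool, ∑ A₁ ∈ Finset.range L, ∑ A₂ ∈ Finset.range L, ∑ A₃ ∈ Finset.range L,
      c A₁ A₂ A₃ * (Function.update (x 0) (A 0) (if b 0 then 1 else 0) A₁ *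
        Function.update (x 1) (A 1) (if b 1 then 1 else 0) A₂ *
        Function.update (x 2) (A 2) (if b 2 then 1 else 0) A₃) ≠ 0 := by
  obtain ⟨b2, h2⟩ := exists_bit_sum_ne_zero L (c (A 0) (A 1)) (x 2) (hA 2 (by norm_num)) hc
  obtain ⟨b1, h1⟩ := exists_bit_sum_ne_zero L (fun A₂ => ∑ A₃ ∈ Finset.range L, c (A 0) A₂ A₃ *
    Function.update (x 2) (A 2) (if b2 then 1 else 0) A₃) (x 1) (hA 1 (by norm_num)) h2
  obtain ⟨b0, h0⟩ := exists_bit_sum_ne_zero L (fun A₁ => ∑ A₂ ∈ Finset.range L,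
    (∑ A₃ ∈ Finset.range L, c A₁ A₂ A₃ *
    Function.update (x 2) (A 2) (if b2 then 1 else 0) A₃) *
    Function.update (x 1) (A 1) (if b1 then 1 else 0) A₂) (x 0) (hA 0 (by norm_num)) h1
  refine ⟨fun κ => if κ = 0 then b0 else if κ = 1 then b1 else b2, ?_⟩
  convert h0 using 1
  refine Finset.sum_congr rfl fun A₁ _ => ?_
  rw [Finset.sum_mul]
  refine Finset.sum_congr rfl fun A₂ _ => ?_
  rw [Finset.sum_mul, Finset.sum_mul]
  refine Finset.sum_congr rfl fun A₃ _ => ?_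
  simp only [if_true, one_ne_zero, if_false, OfNat.ofNat_ne_zero, OfNat.ofNat_ne_one]
  ring

end Multilinear

namespace BlockData

variable {K : Type*} [Field K] {h k r Q : ℕ} (B : BlockData K h k r Q)

open Classical in
/-- The random input of the trilinear form: random bits, restricted to the admissible masks. -/
noncomputable def randomInput (L : ℕ) (ok : ℕ → ℕ → Prop) (ω : ℕ → Bool) (pos : ℕ)
    (κ N : ℕ) : K :=
  if ω (pos + κ * L + N) = true ∧ ok κ N then 1 else 0

theorem value_congr (hQ : 0 < Q) (m : ℕ) {x y : ℕ → ℕ → K}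
    (hxy : ∀ κ < 3, ∀ N < Q ^ m, x κ N = y κ N) : B.value m x = B.value m y := by
  rw [B.value_eq hQ, B.value_eq hQ]
  refine Finset.sum_congr rfl fun A₁ h1 => Finset.sum_congr rfl fun A₂ h2 =>
    Finset.sum_congr rfl fun A₃ h3 => ?_
  rw [Finset.mem_range] at h1 h2 h3
  rw [hxy 0 (by norm_num) _ h1, hxy 1 (by norm_num) _ h2, hxy 2 (by norm_num) _ h3]

/-- If an admissible partition exists, then one of nine independent evaluations is nonzero with
probability at least `2/3`. -/
theorem two_thirds_le_nonzero (hQ : 0 < Q) (m : ℕ) (ok : ℕ → ℕ → Prop) (u : Fin 9 → ℕ)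
    (hu : Function.Injective u) (A : ℕ → ℕ) (hA : ∀ κ < 3, A κ < Q ^ m)
    (hok : ∀ κ < 3, ok κ (A κ))
    (hp : BitPartition (3 * h * r * m) (B.mask m (A 0)) (B.mask m (A 1)) (B.mask m (A 2))) :
    2 / 3 ≤ RAM.fairCoins {ω | ∃ i,
      B.value m (randomInput (K := K) (Q ^ m) ok ω (u i * (3 * Q ^ m))) ≠ 0} := by
  classical
  set L := Q ^ m with hL
  -- The three bits of a trial that belong to the fixed partition. As `u` is injective, different
  -- trials read disjoint ranges of length 3L.
  let p : Fin 9 → Fin 3 → ℕ := fun i j => u i * (3 * L) + j * L + A j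
  have hp_inj : ∀ i j i' j', ∀ N < L, p i j = u i' * (3 * L) + j' * L + N → (j' < 3) →
      i = i' ∧ (j : ℕ) = j' ∧ A j = N := by
    intro i j i' j' N hN heq hj'
    have h1 := hA j j.2
    have e1 : u i * (3 * L) + j * L + A j = L * (3 * u i + j) + A j := by ring
    have e2 : u i' * (3 * L) + j' * L + N = L * (3 * u i' + j') + N := by ring
    have heq : L * (3 * u i + j) + A j = L * (3 * u i' + j') + N := by
      rw [← e1, ← e2]; exact heq
    have hLpos : 0 < L := by omega
    have d := congrArg (· / L) heq
    simp only [Nat.mul_add_div hLpos, Nat.div_eq_of_lt h1, Nat.div_eq_of_lt hN] at d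
    have d2 : A j = N := by
      have := congrArg (· % L) heq
      simpa only [Nat.mul_add_mod, Nat.mod_eq_of_lt h1, Nat.mod_eq_of_lt hN] using this
    have := j.2
    exact ⟨hu (by omega), by omega, d2⟩
  apply RAM.two_thirds_le_of_flips p
  · refine RAM.measurableSet_of_finite_coordinates _
      ((Finset.univ.sup u + 1) * (3 * L)) fun ω ω' hω hin => ?_
    obtain ⟨i, hi⟩ := hin
    refine ⟨i, ?_⟩
    rwa [← B.value_congr hQ m fun κ hκ N hN => ?_]
    simp only [randomInput]
    rw [hω]
    have h1 : u i ≤ Finset.univ.sup u := Finset.le_sup (Finset.mem_univ i)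
    calc u i * (3 * L) + κ * L + N < u i * (3 * L) + κ * L + L := by omega
      _ = (3 * u i + κ + 1) * L := by ring
      _ ≤ (3 * (Finset.univ.sup u + 1)) * L := Nat.mul_le_mul_right _ (by omega)
      _ = _ := by ring
  · intro ω i
    obtain ⟨b, hb⟩ := exists_bits_trilinear_ne_zero L (fun A₁ A₂ A₃ =>
      if BitPartition (3 * h * r * m) (B.mask m A₁) (B.mask m A₂) (B.mask m A₃) then (1 : K) else 0)
      (randomInput (K := K) L ok ω (u i * (3 * L))) A hA (by simp [hp])
    -- The pattern that turns the present bits into the good bits b. Flips made for other trials do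
    -- not occur in the range of this one.
    refine ⟨fun j => xor (ω (p i j)) (b j), fun S hS => ?_⟩
    rw [B.value_eq hQ]
    convert hb using 1
    have key : ∀ κ < 3, ∀ N < L, randomInput (K := K) L ok
        (fun n => xor (ω n) (RAM.flipMask p S n)) (u i * (3 * L)) κ N
        = Function.update (randomInput (K := K) L ok ω (u i * (3 * L)) κ) (A κ)
          (if b κ then 1 else 0) N := by
      intro κ hκ N hN
      by_cases hNA : N = A κ
      · subst hNA
        have hmask : RAM.flipMask p S (u i * (3 * L) + κ * L + A κ) =
            xor (ω (u i * (3 * L) + κ * L + A κ)) (b κ) := by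
          have e : S i ⟨κ, hκ⟩ = xor (ω (u i * (3 * L) + κ * L + A κ)) (b κ) := by rw [hS]
          rw [← e, Bool.eq_iff_iff, RAM.flipMask, decide_eq_true_eq]
          constructor
          · rintro ⟨i', j', h1, h2⟩
            obtain ⟨rfl, h3, -⟩ := hp_inj i' j' i κ _ hN h1 hκ
            have : j' = ⟨κ, hκ⟩ := Fin.ext h3
            rwa [← this]
          · intro h2
            exact ⟨i, ⟨κ, hκ⟩, rfl, h2⟩
        rw [Function.update_self]
        simp only [randomInput, hmask]
        have hx : ∀ a c : Bool, xor a (xor a c) = c := by decide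
        rw [hx]
        simp [hok κ hκ]
      · rw [Function.update_of_ne hNA]
        have hmask : RAM.flipMask p S (u i * (3 * L) + κ * L + N) = false := by
          rw [RAM.flipMask, decide_eq_false_iff_not]
          rintro ⟨i', j', h1, h2⟩
          obtain ⟨-, h3, h4⟩ := hp_inj i' j' i κ _ hN h1 hκ
          exact hNA (by rw [← h4, h3])
        simp only [randomInput, hmask, Bool.xor_false]
    refine Finset.sum_congr rfl fun A₁ h1 => Finset.sum_congr rfl fun A₂ h2 =>
      Finset.sum_congr rfl fun A₃ h3 => ?_
    rw [Finset.mem_range] at h1 h2 h3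
    rw [key 0 (by norm_num) _ h1, key 1 (by norm_num) _ h2, key 2 (by norm_num) _ h3]

end BlockData

/-! ### Verification of array programs -/

namespace ArrayLang

section Simp

variable (st : St) (x y a i j : ℕ) (k l : Fin 8)

@[simp] theorem St.setv_v : (st.setv x a).v y = if y = x then a else st.v y := by
  simp [St.setv, Function.update_apply]

@[simp] theorem St.setv_inp : (st.setv x a).inp = st.inp := rfl
@[simp] theorem St.setv_arr : (st.setv x a).arr = st.arr := rfl
@[simp] theorem St.setv_pos : (st.setv x a).pos = st.pos := rfl
@[simp] theorem St.seta_v : (st.seta k i a).v = st.v := rfl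
@[simp] theorem St.seta_pos : (st.seta k i a).pos = st.pos := rfl

theorem St.seta_arr :
    (st.seta k i a).arr l j = if l = k ∧ j = i then a else st.arr l j := by
  by_cases hl : l = k
  · subst hl; simp [St.seta, Function.update_apply]
  · simp [St.seta, hl]

@[simp] theorem St.seta_arr_ne (h : l ≠ k) : (st.seta k i a).arr l = st.arr l := by
  simp [St.seta, h]

end Simp

/-! ### Evaluation of expressions and table lookup -/

namespace Expr

instance : Add Expr := ⟨op .plus⟩
instance : Sub Expr := ⟨op .minus⟩
instance : Mul Expr := ⟨op .times⟩
instance : Div Expr := ⟨op .quot⟩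
instance : Mod Expr := ⟨op .rem⟩

variable (st : St) (Z : ℕ) (e f : Expr) (c x : ℕ) (k : Fin 8)

@[simp] theorem eval_lit : (lit c).eval st = c := rfl
@[simp] theorem eval_var : (var x).eval st = st.v x := rfl
@[simp] theorem eval_get : (get k e).eval st = st.arr k (e.eval st) := rfl
@[simp] theorem eval_inp : (inp e).eval st = st.inp (e.eval st) := rfl
@[simp] theorem eval_add : (e + f).eval st = e.eval st + f.eval st := rfl
@[simp] theorem eval_sub : (e - f).eval st = e.eval st - f.eval st := rfl
@[simp] theorem eval_mul : (e * f).eval st = e.eval st * f.eval st := rfl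
@[simp] theorem eval_div : (e / f).eval st = e.eval st / f.eval st := rfl
@[simp] theorem eval_mod : (e % f).eval st = e.eval st % f.eval st := rfl
@[simp] theorem ok_lit : (lit c).Ok Z st := trivial
@[simp] theorem ok_var : (var x).Ok Z st := trivial
@[simp] theorem ok_get : (get k e).Ok Z st ↔ e.Ok Z st := Iff.rfl
@[simp] theorem ok_inp : (inp e).Ok Z st ↔ e.Ok Z st ∧ e.eval st < Z := Iff.rfl
@[simp] theorem ok_add : (e + f).Ok Z st ↔ e.Ok Z st ∧ f.Ok Z st := Iff.rfl
@[simp] theorem ok_sub : (e - f).Ok Z st ↔ e.Ok Z st ∧ f.Ok Z st := Iff.rfl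
@[simp] theorem ok_mul : (e * f).Ok Z st ↔ e.Ok Z st ∧ f.Ok Z st := Iff.rfl
@[simp] theorem ok_div : (e / f).Ok Z st ↔ e.Ok Z st ∧ f.Ok Z st := Iff.rfl
@[simp] theorem ok_mod : (e % f).Ok Z st ↔ e.Ok Z st ∧ f.Ok Z st := Iff.rfl

/-- Look up the value of `e` in a table of length `n`. -/
def lookup (g : ℕ → ℕ) (e : Expr) : ℕ → Expr
  | 0 => lit 0
  -- With truncated subtraction, 1 - ((e - n) + (n - e)) is the indicator of e = n.
  | n + 1 => lookup g e n + lit (g n) * (lit 1 - ((e - lit n) + (lit n - e)))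

theorem eval_lookup (g : ℕ → ℕ) (n : ℕ) :
    (lookup g e n).eval st = if e.eval st < n then g (e.eval st) else 0 := by
  induction n with
  | zero => simp [lookup]
  | succ n ih =>
    simp only [lookup, eval_add, eval_mul, eval_sub, eval_lit, ih]
    rcases lt_trichotomy (e.eval st) n with h | h | h
    · rw [if_pos h, if_pos (by omega), show 1 - (e.eval st - n + (n - e.eval st)) = 0 by omega]
      simp
    · simp [h]
    · rw [if_neg (by omega), if_neg (by omega),
        show 1 - (e.eval st - n + (n - e.eval st)) = 0 by omega]
      simp

@[simp] theorem ok_lookup (g : ℕ → ℕ) (n : ℕ) (h : e.Ok Z st) : (lookup g e n).Ok Z st := by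
  induction n with
  | zero => trivial
  | succ n ih => exact ⟨ih, trivial, trivial, ⟨h, trivial⟩, trivial, h⟩

/-- Look up an entry in a two-dimensional table. -/
def lookup₂ (g : ℕ → ℕ → ℕ) (n₁ n₂ : ℕ) (e f : Expr) : Expr :=
  lookup (fun i => g (i / n₂) (i % n₂)) (e * lit n₂ + f) (n₁ * n₂)

theorem eval_lookup₂ (g : ℕ → ℕ → ℕ) {n₁ n₂ : ℕ} {e f : Expr} (he : e.eval st < n₁)
    (hf : f.eval st < n₂) : (lookup₂ g n₁ n₂ e f).eval st = g (e.eval st) (f.eval st) := by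
  have hn : 0 < n₂ := by omega
  have hlt : (e * lit n₂ + f).eval st < n₁ * n₂ :=
    calc e.eval st * n₂ + f.eval st < e.eval st * n₂ + n₂ := by omega
      _ = (e.eval st + 1) * n₂ := by ring
      _ ≤ n₁ * n₂ := Nat.mul_le_mul_right _ he
  rw [lookup₂, eval_lookup, if_pos hlt]
  simp only [eval_add, eval_mul, eval_lit]
  rw [mul_comm, Nat.mul_add_div hn, Nat.div_eq_of_lt hf, Nat.mul_add_mod, Nat.mod_eq_of_lt hf,
    Nat.add_zero]

@[simp] theorem ok_lookup₂ (g : ℕ → ℕ → ℕ) (n₁ n₂ : ℕ) (he : e.Ok Z st) (hf : f.Ok Z st) :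
    (lookup₂ g n₁ n₂ e f).Ok Z st :=
  ok_lookup _ _ _ _ _ (by simp [he, hf])

end Expr

/-! ### Frame conditions and step bounds -/

namespace Stmt

/-- A bound for the number of steps, if the loop bounds have at most the values that they have in
the state `ref`. -/
def maxSteps (ref : St) : Stmt → ℕ
  | set _ e => e.len + 1
  | put _ e f => e.len + f.len + 1
  | flip _ => 1
  | seq p q => p.maxSteps ref + q.maxSteps ref
  | .forTo _ e p => e.len + 1 + e.eval ref * (p.maxSteps ref + 1)

/-- The variables that a program may assign to. -/
def assigns : Stmt → ℕ → Bool
  | set x _, y => Nat.beq x y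
  | put _ _ _, _ => false
  | flip x, y => Nat.beq x y
  | seq p q, y => p.assigns y || q.assigns y
  | .forTo x _ p, y => Nat.beq x y || p.assigns y

/-- The arrays that a program may write to. -/
def puts : Stmt → ℕ → Bool
  | set _ _, _ => false
  | put k _ _, l => Nat.beq k l
  | flip _, _ => false
  | seq p q, l => p.puts l || q.puts l
  | .forTo _ _ p, l => p.puts l

/-- Whether a program uses random bits. -/
def flips : Stmt → Bool
  | set _ _ => false
  | put _ _ _ => false
  | flip _ => true
  | seq p q => p.flips || q.flips
  | .forTo _ _ p => p.flips

/-- The states differ at most in what the program may change. -/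
structure Frame (p : Stmt) (st st' : St) : Prop where
  v : ∀ x, p.assigns x = false → st'.v x = st.v x
  inp : st'.inp = st.inp
  arr : ∀ l, p.puts l.1 = false → st'.arr l = st.arr l
  pos : p.flips = false → st'.pos = st.pos

theorem Frame.refl (p : Stmt) (st : St) : p.Frame st st :=
  ⟨fun _ _ => rfl, rfl, fun _ _ => rfl, fun _ => rfl⟩

theorem frame_iter {p : Stmt} {x : ℕ} {e : Expr} {ω : ℕ → Bool}
    (ih : ∀ st, p.Frame st (p.run ω st)) (st : St) (n : ℕ) :
    (Stmt.forTo x e p).Frame st (iter (fun i s => p.run ω (s.setv x i)) n st) := by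
  induction n with
  | zero => exact Frame.refl _ _
  | succ n ihn =>
    have h := ih ((iter (fun i s => p.run ω (s.setv x i)) n st).setv x n)
    refine ⟨fun y hy => ?_, ?_, fun l hl => ?_, fun hf => ?_⟩
    · have hy' := hy
      simp only [assigns, Bool.or_eq_false_iff] at hy
      have hxy : y ≠ x := fun hyx => by
        have := hy.1
        rw [hyx, Nat.beq_refl] at this
        exact absurd this (by simp)
      exact (h.v y hy.2).trans ((by simp [hxy] : _ = _).trans (ihn.v y hy'))
    · exact h.inp.trans ihn.inp
    · exact (h.arr l hl).trans (ihn.arr l hl)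
    · exact (h.pos hf).trans (ihn.pos hf)

/-- What a program may change is computed by Boolean functions of its text, so for a concrete
program the hypotheses of the frame conditions are proved by `rfl`. -/
theorem frame_run (ω : ℕ → Bool) (p : Stmt) (st : St) : p.Frame st (p.run ω st) := by
  induction p generalizing st with
  | set x e =>
    refine ⟨fun y hy => ?_, rfl, fun _ _ => rfl, fun _ => rfl⟩
    have : y ≠ x := fun h => by rw [h] at hy; simp [assigns] at hy
    simp [run, this]
  | put k e f =>
    refine ⟨fun _ _ => rfl, rfl, fun l hl => ?_, fun _ => rfl⟩
    have : l ≠ k := fun h => by rw [h] at hl; simp [puts] at hl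
    simp [run, this]
  | flip x =>
    refine ⟨fun y hy => ?_, rfl, fun _ _ => rfl, fun h => by simp [flips] at h⟩
    have : y ≠ x := fun h => by rw [h] at hy; simp [assigns] at hy
    simp [run, this]
  | seq p q ihp ihq =>
    have h1 := ihp st
    have h2 := ihq (p.run ω st)
    refine ⟨fun y hy => ?_, h2.inp.trans h1.inp, fun l hl => ?_, fun hf => ?_⟩
    · simp only [assigns, Bool.or_eq_false_iff] at hy
      exact (h2.v y hy.2).trans (h1.v y hy.1)
    · simp only [puts, Bool.or_eq_false_iff] at hl
      exact (h2.arr l hl.2).trans (h1.arr l hl.1)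
    · simp only [flips, Bool.or_eq_false_iff] at hf
      exact (h2.pos hf.2).trans (h1.pos hf.1)
  | forTo x e p ih => exact frame_iter ih _ _

end Stmt

/-! ### Rules of the program logic -/

/-- The setting of a verification: random bits, bit length, size of the input, and a state with
the values of the loop bounds. -/
structure Setting where
  ω : ℕ → Bool
  w : ℕ
  Z : ℕ
  ref : St

namespace Setting

variable (S : Setting)

/-- Started in the state `st`, the program `p` runs without overflow and in the time that the
loop bounds allow, and ends in a state with the property `Q`. -/
def Good (st : St) (p : Stmt) (Q : St → Prop) : Prop :=
  p.Fits S.ω S.w S.Z st ∧ p.steps S.ω st ≤ p.maxSteps S.ref ∧ Q (p.run S.ω st)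

variable {S} {st : St} {Q : St → Prop}

theorem Good.mono {p : Stmt} {Q' : St → Prop} (h : S.Good st p Q) (hQ : ∀ st, Q st → Q' st) :
    S.Good st p Q' :=
  ⟨h.1, h.2.1, hQ _ h.2.2⟩

theorem Good.set {x : ℕ} {e : Expr} (h1 : e.Ok S.Z st) (h2 : e.eval st < 2 ^ S.w)
    (h3 : Q (st.setv x (e.eval st))) : S.Good st (.set x e) Q :=
  ⟨⟨h1, h2⟩, le_rfl, h3⟩

theorem Good.put {k : Fin 8} {e f : Expr} (h1 : e.Ok S.Z st) (h2 : f.Ok S.Z st)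
    (h3 : f.eval st < 2 ^ S.w) (h4 : Q (st.seta k (e.eval st) (f.eval st))) :
    S.Good st (.put k e f) Q :=
  ⟨⟨h1, h2, h3⟩, le_rfl, h4⟩

theorem Good.flip {x : ℕ}
    (h : Q { st.setv x (S.ω st.pos).toNat with pos := st.pos + 1 }) : S.Good st (.flip x) Q :=
  ⟨trivial, le_rfl, h⟩

theorem Good.seq {p q : Stmt} (h : S.Good st p fun st' => S.Good st' q Q) :
    S.Good st (.seq p q) Q :=
  ⟨⟨h.1, h.2.2.1⟩, Nat.add_le_add h.2.1 h.2.2.2.1, h.2.2.2.2⟩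

theorem Good.frame {p : Stmt} (h : S.Good st p Q) :
    S.Good st p fun st' => p.Frame st st' ∧ Q st' :=
  ⟨h.1, h.2.1, p.frame_run _ _, h.2.2⟩

/-- The invariant needs to mention only what changes: the frame condition relative to the start of
the loop is supplied in every round. Comparing the bound with its value in `ref` makes the step
counts of all loops multiply. -/
theorem Good.forTo {x : ℕ} {e : Expr} {p : Stmt} (n : ℕ) (I : ℕ → St → Prop) (h1 : e.Ok S.Z st)
    (h2 : e.eval st = n) (h3 : n ≤ e.eval S.ref) (h4 : n < 2 ^ S.w) (h5 : I 0 st)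
    (h6 : ∀ i < n, ∀ st', (Stmt.forTo x e p).Frame st st' → I i st' →
      S.Good (st'.setv x i) p (I (i + 1)))
    (h7 : ∀ st', (Stmt.forTo x e p).Frame st st' → I n st' → Q st') :
    S.Good st (.forTo x e p) Q := by
  have frame := Stmt.frame_iter (x := x) (e := e) (p.frame_run S.ω) st
  have key : ∀ i ≤ n, I i (iter (fun i s => p.run S.ω (s.setv x i)) i st) := by
    intro i hi
    induction i with
    | zero => exact h5
    | succ i ih => exact (h6 i (by omega) _ (frame i) (ih (by omega))).2.2
  refine ⟨⟨h1, by omega, fun i hi => (h6 i (by omega) _ (frame i) (key i (by omega))).1⟩, ?_, ?_⟩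
  · simp only [Stmt.steps, Stmt.maxSteps, h2]
    refine Nat.add_le_add_left ?_ _
    calc _ ≤ ∑ i ∈ Finset.range n, (p.maxSteps S.ref + 1) :=
          Finset.sum_le_sum fun i hi => by
            have hi := Finset.mem_range.1 hi
            exact Nat.add_le_add_right (h6 i hi _ (frame i) (key i hi.le)).2.1 1
      _ = n * (p.maxSteps S.ref + 1) := by simp
      _ ≤ _ := Nat.mul_le_mul_right _ h3
  · simp only [Stmt.run, h2]
    exact h7 _ (frame n) (key n le_rfl)

end Setting

end ArrayLang

/-! ### The set cover program: preprocessing -/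

/-- An instance of set cover together with random bits, a bit length and machine input. -/
structure CoverTask where
  n : ℕ
  t₀ : ℕ
  fam : List (Finset (Fin n))
  inp : ℕ → ℕ
  ω : ℕ → Bool
  w : ℕ

namespace CoverTask

variable (T : CoverTask) (b Q : ℕ)

/-- The bound for the number of sets. -/
def t : ℕ := min T.t₀ T.n

/-- The number of blocks. -/
def m : ℕ := T.n / b + 1

/-- The number of masks. -/
def L : ℕ := Q ^ T.m b

/-- The input is laid out as expected, and all relevant numbers are below `2 ^ w`. -/
structure Valid : Prop where
  b_pos : 0 < b
  Q_pos : 2 ≤ Q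
  inp_n : T.inp 0 = T.n
  inp_len : T.inp 1 = T.fam.length
  inp_fam : ∀ j (hj : j < T.fam.length), ∀ e < T.n, T.inp (2 + j * T.n + e) =
    if e ∈ (T.fam[j]).map Fin.valEmbedding then 1 else 0
  inp_digit : ∀ i ≤ T.n, T.inp (2 + T.fam.length * T.n + i) =
    if T.t₀ / 2 ^ i = 0 then 0 else T.t₀ / 2 ^ i % 2 + 1
  n_lt : 9 * (T.n + 1) ^ 2 < 2 ^ T.w
  len_lt : T.fam.length < 2 ^ T.w
  pow_lt : 2 ^ T.n + 2 * T.n < 2 ^ T.w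
  mask_le : 2 ^ (b * T.m b) ≤ 2 ^ T.w
  L_lt : T.L b Q < 2 ^ T.w

/-- The setting in which the program is verified. -/
def setting : ArrayLang.Setting where
  ω := T.ω
  w := T.w
  Z := T.fam.length * T.n + T.n + 3
  ref :=
    { v := fun x => match x with
        | 1 => T.n
        | 2 => T.fam.length
        | 3 => T.n
        | 4 => T.m b
        | 5 => T.L b Q
        | _ => 0
      inp := fun _ => 0
      arr := fun _ _ => 0
      pos := 0 }

@[simp] theorem setting_w : (T.setting b Q).w = T.w := rfl
@[simp] theorem setting_ω : (T.setting b Q).ω = T.ω := rfl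
@[simp] theorem setting_Z : (T.setting b Q).Z = T.fam.length * T.n + T.n + 3 := rfl

/-- The state after initialization. -/
structure Base (st : ArrayLang.St) : Prop where
  inp : st.inp = T.inp
  n : st.v 1 = T.n
  len : st.v 2 = T.fam.length
  t : st.v 3 = T.t
  m : st.v 4 = T.m b
  L : st.v 5 = T.L b Q
  L₁ : st.v 6 = Q ^ (T.m b - 1)
  pow : st.v 7 = 2 ^ T.n

end CoverTask

namespace ArrayLang

open ArrayLang.Expr

/-- The program does not assign to the variables from `1` to `7`. -/
def Stmt.keepsBase (p : Stmt) : Bool :=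
  !(p.assigns 1 || p.assigns 2 || p.assigns 3 || p.assigns 4 || p.assigns 5 || p.assigns 6 ||
    p.assigns 7)

end ArrayLang

open ArrayLang ArrayLang.Expr ArrayLang.Setting

namespace CoverTask

variable {T : CoverTask} {b Q : ℕ} {st st' : St}

theorem Base.frame (h : T.Base b Q st) {p : Stmt} (hp : p.keepsBase = true)
    (hF : p.Frame st st') : T.Base b Q st' := by
  simp only [Stmt.keepsBase, Bool.not_eq_true', Bool.or_eq_false_iff] at hp
  obtain ⟨⟨⟨⟨⟨⟨h1, h2⟩, h3⟩, h4⟩, h5⟩, h6⟩, h7⟩ := hp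
  exact ⟨hF.inp.trans h.inp, (hF.v _ h1).trans h.n, (hF.v _ h2).trans h.len,
    (hF.v _ h3).trans h.t, (hF.v _ h4).trans h.m, (hF.v _ h5).trans h.L, (hF.v _ h6).trans h.L₁,
    (hF.v _ h7).trans h.pow⟩

theorem Base.setv (h : T.Base b Q st) {x : ℕ} (hx : x = 0 ∨ 8 ≤ x) (a : ℕ) :
    T.Base b Q (st.setv x a) := by
  have e : ∀ y, 1 ≤ y → y ≤ 7 → (st.setv x a).v y = st.v y := fun y h1 h2 => by
    rw [St.setv_v, if_neg (by omega)]
  exact ⟨h.inp, (e 1 (by simp) (by simp)).trans h.n, (e 2 (by simp) (by simp)).trans h.len,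
    (e 3 (by simp) (by simp)).trans h.t, (e 4 (by simp) (by simp)).trans h.m,
    (e 5 (by simp) (by simp)).trans h.L, (e 6 (by simp) (by simp)).trans h.L₁,
    (e 7 (by simp) (by simp)).trans h.pow⟩

end CoverTask

namespace ArrayLang

/-- Read the input and compute the parameters. -/
def initStmt (b Q : ℕ) : Stmt :=
  .seq (.set 1 (.inp (lit 0))) <|
  .seq (.set 2 (.inp (lit 1))) <|
  .seq (.set 7 (lit 1)) <|
  .seq (.set 3 (lit 0)) <|
  .seq (.forTo 8 (var 1)
    -- A cell holds a digit plus one, or zero behind the last digit; truncated subtraction gives the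
    -- correct digit in both cases.
    (.seq (.set 3 (var 3 + var 7 * (Expr.inp (lit 2 + var 2 * var 1 + var 8) - lit 1)))
      (.set 7 (var 7 * lit 2)))) <|
  -- Cell n of the digits is nonempty exactly if t ≥ 2^n; then at least n is added. After x - (x -
  -- n) = min x n below the result is min t n, although only n + 1 digits of t are read.
  .seq (.set 3 (var 3 + Expr.inp (lit 2 + var 2 * var 1 + var 1) * var 1)) <|
  .seq (.set 3 (var 3 - (var 3 - var 1))) <|
  .seq (.set 4 (var 1 / lit b + lit 1)) <|
  .seq (.set 6 (lit 1)) <|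
  .seq (.forTo 8 (var 1 / lit b) (.set 6 (var 6 * lit Q)))
  (.set 5 (var 6 * lit Q))

/-- Compute the table of masks. -/
def maskStmt (tab : ℕ → ℕ) (b Q : ℕ) : Stmt :=
  -- The round N = 0 of the loop reads entry 0 itself, so that entry is set beforehand.
  .seq (.put 0 (lit 0) (lit 0)) <|
  .forTo 10 (var 5) (.put 0 (var 10)
    (Expr.get 0 (var 10 / lit Q) * lit (2 ^ b) + lookup tab (var 10 % lit Q) Q))

end ArrayLang

namespace CoverTask

variable {T : CoverTask} {b Q : ℕ} {st st' : St}

theorem good_init (hT : T.Valid b Q) (hst : st.inp = T.inp) :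
    (T.setting b Q).Good st (initStmt b Q) (T.Base b Q) := by
  have hn2 : T.n < 2 ^ T.n := Nat.lt_two_pow_self
  have h2n := hT.pow_lt
  have hn : T.n < 2 ^ T.w := by omega
  have h1 : 1 < 2 ^ T.w := by omega
  refine Good.seq (Good.set ?_ ?_ ?_)
  · simp
  · simpa [hst, hT.inp_n] using hn
  refine Good.seq (Good.set ?_ ?_ ?_)
  · simp
  · simpa [hst, hT.inp_len] using hT.len_lt
  refine Good.seq (Good.set (by simp) h1 ?_)
  refine Good.seq (Good.set (by simp) (by simp) ?_)
  simp only [eval_inp, eval_lit, hst, hT.inp_n, hT.inp_len, St.setv_inp]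
  refine Good.seq (Good.forTo T.n (fun i st' => st'.v 7 = 2 ^ i ∧ st'.v 3 = T.t₀ % 2 ^ i)
    (by simp) (by simp) le_rfl hn (by simp [Nat.mod_one]) ?_ ?_)
  · rintro i hi st' hF ⟨h7, h3⟩
    have v1 := hF.v 1 rfl
    have v2 := hF.v 2 rfl
    have vi := hF.inp
    simp only [St.setv_v, St.setv_inp, hst] at v1 v2 vi
    norm_num at v1 v2
    have hdig : T.inp (2 + T.fam.length * T.n + i) - 1 = T.t₀ / 2 ^ i % 2 := by
      rw [hT.inp_digit i hi.le]
      split_ifs with h0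
      · rw [h0]
      · omega
    have hp : (2:ℕ) ^ (i + 1) ≤ 2 ^ T.n := Nat.pow_le_pow_right (by norm_num) hi
    have hval : T.t₀ % 2 ^ i + 2 ^ i * (T.t₀ / 2 ^ i % 2) = T.t₀ % 2 ^ (i + 1) := by
      rw [pow_succ, Nat.mod_mul]
    have hlt : T.t₀ % 2 ^ (i + 1) < 2 ^ (i + 1) := Nat.mod_lt _ (by positivity)
    refine Good.seq (Good.set ?_ ?_ (Good.set (by simp) ?_ ?_))
    · simp [v1, v2]
      nlinarith
    · simp [v1, v2, vi, h7, h3, hdig, hval]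
      omega
    · simp [h7]
      rw [← pow_succ]; omega
    · simp [v1, v2, vi, h7, h3, hdig, hval, pow_succ]
  · rintro st' hF ⟨h7, h3⟩
    have v1 := hF.v 1 rfl
    have v2 := hF.v 2 rfl
    have vi := hF.inp
    simp only [St.setv_v, St.setv_inp, hst] at v1 v2 vi
    norm_num at v1 v2
    have hlt : T.t₀ % 2 ^ T.n < 2 ^ T.n := Nat.mod_lt _ (by positivity)
    have hd := hT.inp_digit T.n le_rfl
    have hd2 : T.inp (2 + T.fam.length * T.n + T.n) ≤ 2 := by
      rw [hd]; split_ifs <;> omega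
    have hd3 : T.inp (2 + T.fam.length * T.n + T.n) * T.n ≤ 2 * T.n :=
      Nat.mul_le_mul_right _ hd2
    have ht : T.t₀ % 2 ^ T.n + T.inp (2 + T.fam.length * T.n + T.n) * T.n -
        (T.t₀ % 2 ^ T.n + T.inp (2 + T.fam.length * T.n + T.n) * T.n - T.n) = T.t := by
      rw [hd, CoverTask.t]
      split_ifs with h0
      · have : T.t₀ < 2 ^ T.n := by
          by_contra hle
          have := Nat.div_pos (not_lt.1 hle) (by positivity)
          omega
        rw [Nat.mod_eq_of_lt this]; omega
      · have : 2 ^ T.n ≤ T.t₀ := by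
          by_contra hle
          exact h0 (Nat.div_eq_of_lt (not_le.1 hle))
        have : T.n ≤ (T.t₀ / 2 ^ T.n % 2 + 1) * T.n := Nat.le_mul_of_pos_left _ (by omega)
        omega
    have hL := hT.L_lt
    have hQ := hT.Q_pos
    have hLs : T.L b Q = Q ^ (T.n / b) * Q := by rw [L, m, pow_succ]
    have hL1 : Q ^ (T.n / b) ≤ T.L b Q := by rw [hLs]; exact Nat.le_mul_of_pos_right _ (by omega)
    have hnb : T.n / b ≤ T.n := Nat.div_le_self _ _
    refine Good.seq (Good.set ?_ ?_ ?_)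
    · simp [v1, v2]; ring_nf; omega
    · simp [v1, v2, vi, h3]; omega
    refine Good.seq (Good.set ?_ ?_ ?_)
    · simp
    · simp [v1, v2, vi, h3, ht]
      have : T.t ≤ T.n := min_le_right _ _
      omega
    refine Good.seq (Good.set ?_ ?_ ?_)
    · simp
    · simp [v1]; omega
    refine Good.seq (Good.set (by simp) h1 ?_)
    simp only [eval_var, eval_lit, eval_add, eval_sub, eval_mul, eval_div, eval_inp, St.setv_v,
      v1, v2, vi, h3, if_true]
    refine Good.seq (Good.forTo (T.n / b) (fun i st' => st'.v 6 = Q ^ i) ?_ ?_ ?_ ?_ ?_ ?_ ?_)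
    · simp
    · simp [v1]
    · simp [setting]
    · simp; omega
    · simp
    · intro i hi st'' hF' h6
      have : Q ^ (i + 1) ≤ Q ^ (T.n / b) := Nat.pow_le_pow_right (by omega) hi
      refine Good.set (by simp) ?_ ?_
      · simp [h6, ← pow_succ]; omega
      · simp [h6, pow_succ]
    · intro st'' hF' h6
      refine Good.set (by simp) ?_ ?_
      · simp [h6, ← hLs]; omega
      · have w1 := hF'.v 1 rfl
        have w2 := hF'.v 2 rfl
        have w3 := hF'.v 3 rfl
        have w4 := hF'.v 4 rfl
        have w7 := hF'.v 7 rfl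
        have wi := hF'.inp
        simp [v1, v2, vi, h7] at w1 w2 w3 w4 w7 wi
        constructor
        all_goals simp [w1, w2, w3, w4, w7, wi, h6, ht, hLs, m]

end CoverTask

/-! ### The set cover program: dynamic programming -/

namespace ArrayLang

open ArrayLang.Expr

/-- Store in the table of coverings which masks are covered by no sets. -/
def coverZeroStmt : Stmt :=
  -- The table of coverings is addressed by the mask and not by its number, so no search is needed
  -- for the number of a difference of sets.
  .forTo 10 (var 5) (.put 1 (Expr.get 0 (var 10) * (var 1 + lit 1))
    (lit 1 - Expr.get 0 (var 10) % var 7))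

/-- Compute the difference of a mask and a set of the family. -/
def diffStmt : Stmt :=
  .seq (.set 14 (lit 0)) <|
  .seq (.set 9 (lit 1)) <|
  .forTo 13 (var 1)
    (.seq (.set 14 (var 14 + var 9 * (Expr.get 0 (var 10) / var 9 % lit 2) *
      (lit 1 - Expr.inp (lit 2 + var 12 * var 1 + var 13))))
    (.set 9 (var 9 * lit 2)))

/-- Compute one entry of the table of coverings. -/
def coverRowStmt : Stmt :=
  .seq (.set 15 (Expr.get 1 (Expr.get 0 (var 10) * (var 1 + lit 1) + var 11))) <|
  .seq (.forTo 12 (var 2) (.seq diffStmt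
    -- With truncated subtraction, 1 - (1 - (a + b)) is the disjunction of the truth values a and b.
    (.set 15 (lit 1 - (lit 1 - (var 15 + Expr.get 1 (var 14 * (var 1 + lit 1) + var 11)))))))
  (.put 1 (Expr.get 0 (var 10) * (var 1 + lit 1) + (var 11 + lit 1)) (var 15))

/-- Compute the table of coverings. -/
def coverStmt : Stmt :=
  .seq coverZeroStmt <| .forTo 11 (var 3) (.forTo 10 (var 5) coverRowStmt)

end ArrayLang

open ArrayLang ArrayLang.Expr ArrayLang.Setting

namespace CoverTask

open Classical in
/-- The truth value of a proposition. -/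
noncomputable def ind (P : Prop) : ℕ := if P then 1 else 0

theorem ind_le (P : Prop) : ind P ≤ 1 := by unfold ind; split_ifs <;> simp

theorem ind_or (P R : Prop) : 1 - (1 - (ind P + ind R)) = ind (P ∨ R) := by
  unfold ind; split_ifs <;> simp_all

theorem ind_of {P : Prop} (h : P) : ind P = 1 := if_pos h
theorem ind_of_not {P : Prop} (h : ¬P) : ind P = 0 := if_neg h

/-- The characteristic function of a set of the family. -/
def chi (T : CoverTask) (j : ℕ) (e : ℕ) : ℕ :=
  if h : j < T.fam.length then (if e ∈ (T.fam[j]).map Fin.valEmbedding then 1 else 0) else 0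

theorem chi_le (T : CoverTask) (j e : ℕ) : T.chi j e ≤ 1 := by
  unfold chi; split_ifs <;> simp

variable {K : Type*} [Field K] {h k r Q : ℕ} (B : BlockData K h k r Q) {T : CoverTask}
  {st st' : St}

/-- The table of masks is complete. -/
def Masks (T : CoverTask) (st : St) : Prop :=
  ∀ N < T.L (3 * h * r) Q, st.arr 0 N = B.mask (T.m (3 * h * r)) N

/-- The entries of the table of coverings with `P τ N` are correct. -/
def Covers (T : CoverTask) (P : ℕ → ℕ → Prop) (st : St) : Prop :=
  ∀ N < T.L (3 * h * r) Q, ∀ τ ≤ T.t, P τ N →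
    st.arr 1 (B.mask (T.m (3 * h * r)) N * (T.n + 1) + τ) =
      ind (CoveredBy T.fam τ (B.mask (T.m (3 * h * r)) N))

theorem mask_lt_two_pow (hT : T.Valid (3 * h * r) Q) (N : ℕ) :
    B.mask (T.m (3 * h * r)) N < 2 ^ T.w :=
  (B.mask_lt (by have := hT.Q_pos; omega) _ _).trans_le hT.mask_le

theorem good_masks (hT : T.Valid (3 * h * r) Q) (hB : T.Base (3 * h * r) Q st) :
    (T.setting (3 * h * r) Q).Good st (maskStmt B.tab (3 * h * r) Q) (Masks B T) := by
  have hQ := hT.Q_pos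
  have hrec := blockMask_rec B.tab_zero (3 * h * r) Q (T.m (3 * h * r))
  have h0 : B.mask (T.m (3 * h * r)) 0 = 0 := by
    have h1 := hrec 0 (by positivity)
    simp only [Nat.zero_div, Nat.zero_mod, B.tab_zero, add_zero] at h1
    have h2 : 1 < 2 ^ (3 * h * r) := Nat.one_lt_two_pow hT.b_pos.ne'
    rw [BlockData.mask]
    by_contra hne
    nlinarith [Nat.pos_of_ne_zero hne]
  refine Good.seq (Good.put (by simp) (by simp) (by simp) ?_)
  refine Good.forTo (T.L (3 * h * r) Q) (fun i st' => ∀ N, N < i ∨ N = 0 →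
    st'.arr 0 N = B.mask (T.m (3 * h * r)) N) (by simp) (by simp [hB.L]) (by simp [setting])
    hT.L_lt ?_ ?_ ?_
  · intro N hN
    obtain rfl : N = 0 := by omega
    simp [St.seta_arr, h0]
  · intro N hN st' hF hI
    have key : eval (st'.setv 10 N) (Expr.get 0 (var 10 / lit Q) * lit (2 ^ (3 * h * r)) +
        lookup B.tab (var 10 % lit Q) Q) = B.mask (T.m (3 * h * r)) N := by
      rw [eval_add, eval_lookup]
      have h1 : N % Q < Q := Nat.mod_lt _ (by omega)
      simp only [eval_mul, eval_get, eval_div, eval_var, eval_lit, eval_mod, St.setv_v, if_true,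
        h1, St.setv_arr]
      rw [BlockData.mask, hrec N hN, hI (N / Q), ← BlockData.mask]
      rcases Nat.eq_zero_or_pos N with h2 | h2
      · right; simp [h2]
      · left; exact Nat.div_lt_self h2 (by omega)
    refine Good.put (by simp) (by simp) ?_ ?_
    · rw [key]; exact mask_lt_two_pow B hT N
    · intro N' hN'
      rw [key, St.seta_arr]
      simp only [eval_var, St.setv_v, if_true, true_and, St.setv_arr]
      split_ifs with h2
      · rw [h2]
      · exact hI N' (by omega)
  · intro st' hF hI N hN
    exact hI N (Or.inl hN)

theorem good_diff (hT : T.Valid (3 * h * r) Q) (hB : T.Base (3 * h * r) Q st)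
    (hM : Masks B T st) {j N : ℕ} (hj : j < T.fam.length) (hN : N < T.L (3 * h * r) Q)
    (v12 : st.v 12 = j) (v10 : st.v 10 = N) :
    (T.setting (3 * h * r) Q).Good st diffStmt fun st' =>
      st'.v 14 = diffMask T.n (B.mask (T.m (3 * h * r)) N) (T.chi j) := by
  have hp := hT.pow_lt
  have hp0 : 0 < 2 ^ T.n := by positivity
  have hn2 : T.n < 2 ^ T.n := Nat.lt_two_pow_self
  set x := B.mask (T.m (3 * h * r)) N with hx
  refine Good.seq (Good.set (by simp) (by simp) ?_)
  refine Good.seq (Good.set (by simp) (show 1 < 2 ^ T.w by omega) ?_)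
  refine Good.forTo T.n (fun i st' => st'.v 9 = 2 ^ i ∧ st'.v 14 = diffMask i x (T.chi j))
    (by simp) (by simp [hB.n]) (by simp [setting]) (show T.n < 2 ^ T.w by omega) (by simp [diffMask])
    ?_ (fun st' _ hI => hI.2)
  rintro i hi st' hF ⟨h9, h14⟩
  have v1 := hF.v 1 rfl
  have v10' := hF.v 10 rfl
  have v12' := hF.v 12 rfl
  have a0 := hF.arr 0 rfl
  have vi := hF.inp
  simp [v10, v12, hB.n, hB.inp] at v1 v10' v12' a0 vi
  have hinp : T.inp (2 + j * T.n + i) = T.chi j i := by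
    rw [hT.inp_fam j hj i hi, chi, dif_pos hj]
  have hval : diffMask i x (T.chi j) + 2 ^ i * (x / 2 ^ i % 2) * (1 - T.chi j i) =
      diffMask (i + 1) x (T.chi j) := by
    rw [diffMask, diffMask, Finset.sum_range_succ]
  have hlt := (diffMask_lt_and_testBit (i + 1) x (T.chi j) (T.chi_le j)).1
  have hpi : (2:ℕ) ^ (i + 1) ≤ 2 ^ T.n := Nat.pow_le_pow_right (by norm_num) hi
  have hM' := hM N hN
  refine Good.seq (Good.set ?_ ?_ (Good.set (by simp) ?_ ?_))
  · simp [v1, v12']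
    have : (j + 1) * T.n ≤ T.fam.length * T.n := Nat.mul_le_mul_right _ hj
    nlinarith
  · simp [v1, v10', v12', a0, vi, h9, h14, hM', hinp, ← hx, hval]
    omega
  · simp [h9, ← pow_succ]; omega
  · simp [v1, v10', v12', a0, vi, h9, h14, hM', hinp, ← hx, hval, pow_succ]

/-- The difference is a subset of the mask, so it is again a mask of the table and its entry has
already been computed. -/
theorem exists_mask_eq_diffMask (hT : T.Valid (3 * h * r) Q) (j N : ℕ) :
    ∃ N' < T.L (3 * h * r) Q, B.mask (T.m (3 * h * r)) N' =
      diffMask T.n (B.mask (T.m (3 * h * r)) N) (T.chi j) :=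
  B.exists_mask (smallMasks_of_subset (B.mask_mem (by have := hT.Q_pos; omega) _ N) fun i hi =>
    (((diffMask_lt_and_testBit _ _ _ (T.chi_le j)).2 i).1 hi).2.1)

theorem coveredBy_succ_iff (τ x : ℕ) : CoveredBy T.fam (τ + 1) x ↔
    CoveredBy T.fam τ x ∨ ∃ j < T.fam.length, CoveredBy T.fam τ (diffMask T.n x (T.chi j)) := by
  rw [coveredBy_succ]
  refine or_congr_right ⟨?_, ?_⟩
  · rintro ⟨X, hX, hc⟩
    obtain ⟨j, hj, rfl⟩ := List.mem_iff_getElem.1 hX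
    refine ⟨j, hj, ?_⟩
    convert hc using 3 with e
    rw [chi, dif_pos hj]
  · rintro ⟨j, hj, hc⟩
    refine ⟨T.fam[j], List.getElem_mem hj, ?_⟩
    convert hc using 3 with e
    rw [chi, dif_pos hj]

/-- Entries for τ + 1 depend only on entries for τ, which are complete. A mask that occurs under
several numbers is written repeatedly, each time with the same correct value. -/
theorem good_coverRow (hT : T.Valid (3 * h * r) Q) (hB : T.Base (3 * h * r) Q st)
    (hM : Masks B T st) {τ N : ℕ} (hτ : τ < T.t) (hN : N < T.L (3 * h * r) Q)
    (v11 : st.v 11 = τ) (v10 : st.v 10 = N)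
    (hC : Covers B T (fun τ' N' => τ' ≤ τ ∨ τ' = τ + 1 ∧ N' < N) st) :
    (T.setting (3 * h * r) Q).Good st coverRowStmt
      (Covers B T (fun τ' N' => τ' ≤ τ ∨ τ' = τ + 1 ∧ N' < N + 1)) := by
  have h1 : 1 < 2 ^ T.w := lt_of_le_of_lt (by linarith [Nat.one_le_pow 2 (T.n + 1) (by simp)]) hT.n_lt
  set x := B.mask (T.m (3 * h * r)) N with hx
  refine Good.seq (Good.set (by simp) ?_ ?_)
  · simp [v10, v11, hB.n, hM N hN, hC N hN τ hτ.le (Or.inl le_rfl)]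
    exact lt_of_le_of_lt (ind_le _) h1
  refine Good.seq (Good.forTo T.fam.length (fun j st' => st'.v 15 = ind (CoveredBy T.fam τ x ∨
    ∃ j' < j, CoveredBy T.fam τ (diffMask T.n x (T.chi j')))) (by simp) (by simp [hB.len])
    (by simp [setting]) hT.len_lt ?_ ?_ ?_)
  · simp [v10, v11, hB.n, hM N hN, hC N hN τ hτ.le (Or.inl le_rfl), hx]
  · intro j hj st' hF h15
    have v10' := hF.v 10 rfl
    have v11' := hF.v 11 rfl
    have a0 := hF.arr 0 rfl
    have a1 := hF.arr 1 rfl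
    simp [v10, v11] at v10' v11' a0 a1
    have hB' := ((hB.setv (x := 15) (by simp) _).frame rfl hF).setv (x := 12) (by simp) j
    have hM' : Masks B T (st'.setv 12 j) := fun N hN => by
      rw [St.setv_arr, a0, hM N hN]
    refine Good.seq ((good_diff B hT hB' hM' hj hN (by simp) (by simp [v10'])).frame.mono ?_)
    rintro st'' ⟨hF', h14⟩
    have w11 := hF'.v 11 rfl
    have w15 := hF'.v 15 rfl
    have w1 := hF'.v 1 rfl
    have b1 := hF'.arr 1 rfl
    rw [hB'.n] at w1
    simp [v11', a1, h15] at w11 b1 w15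
    obtain ⟨N', hN', hq⟩ := exists_mask_eq_diffMask B hT j N
    rw [← hx] at hq
    have hc := hC N' hN' τ hτ.le (Or.inl le_rfl)
    rw [hq] at hc
    have key : eval st'' (lit 1 - (lit 1 - (var 15 + Expr.get 1 (var 14 * (var 1 + lit 1) +
        var 11)))) = ind (CoveredBy T.fam τ x ∨
          ∃ j' < j + 1, CoveredBy T.fam τ (diffMask T.n x (T.chi j'))) := by
      simp only [eval_sub, eval_lit, eval_add, eval_var, eval_get, eval_mul, w11, w15, w1, b1, h14,
        ← hx, hc, ind_or]
      congr 1
      simp only [Nat.lt_succ_iff_lt_or_eq, or_and_right, exists_or, exists_eq_left, or_assoc]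
    refine Good.set (by simp) ?_ ?_
    · rw [key]; exact lt_of_le_of_lt (ind_le _) h1
    · rw [key]; simp
  · intro st' hF h15
    have v1 := hF.v 1 rfl
    have v10' := hF.v 10 rfl
    have v11' := hF.v 11 rfl
    have a0 := hF.arr 0 rfl
    have a1 := hF.arr 1 rfl
    simp [v10, v11, hB.n] at v1 v10' v11' a0 a1
    rw [← coveredBy_succ_iff] at h15
    refine Good.put (by simp) (by simp) ?_ ?_
    · simp only [eval_var, h15]; exact lt_of_le_of_lt (ind_le _) h1
    · intro N' hN' τ' hτ' hP
      rw [St.seta_arr]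
      simp only [eval_add, eval_mul, eval_var, eval_lit, eval_get, v1, v10', v11', a0, hM N hN,
        true_and, h15, ← hx]
      -- Since τ ≤ t ≤ n, an address mask·(n + 1) + τ determines both the mask and τ.
      have ht : T.t ≤ T.n := min_le_right _ _
      split_ifs with heq
      · have e1 : B.mask (T.m (3 * h * r)) N' = x := by
          have := congrArg (· / (T.n + 1)) heq
          simpa only [mul_comm _ (T.n + 1), Nat.mul_add_div (Nat.succ_pos T.n),
            Nat.div_eq_of_lt (show τ' < T.n + 1 by omega),
            Nat.div_eq_of_lt (show τ + 1 < T.n + 1 by omega), add_zero] using this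
        rw [e1] at heq ⊢
        rw [show τ' = τ + 1 by omega]
      · rw [a1]
        refine hC N' hN' τ' hτ' ?_
        rcases hP with hP | ⟨rfl, hP⟩
        · exact Or.inl hP
        · refine Or.inr ⟨rfl, ?_⟩
          rcases Nat.lt_succ_iff_lt_or_eq.1 hP with hlt | rfl
          · exact hlt
          · exact absurd rfl heq

theorem good_cover (hT : T.Valid (3 * h * r) Q) (hB : T.Base (3 * h * r) Q st)
    (hM : Masks B T st) :
    (T.setting (3 * h * r) Q).Good st coverStmt (Covers B T fun _ _ => True) := by
  have h1 : 1 < 2 ^ T.w := lt_of_le_of_lt (by linarith [Nat.one_le_pow 2 (T.n + 1) (by simp)]) hT.n_lt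
  have ht : T.t ≤ T.n := min_le_right _ _
  have hn : T.n < 2 ^ T.w := lt_of_le_of_lt (by nlinarith) hT.n_lt
  refine Good.seq (Good.forTo (T.L (3 * h * r) Q) (fun N st' => ∀ N' < N,
    st'.arr 1 (B.mask (T.m (3 * h * r)) N' * (T.n + 1)) =
      ind (CoveredBy T.fam 0 (B.mask (T.m (3 * h * r)) N'))) (by simp) (by simp [hB.L])
    (by simp [setting]) hT.L_lt (by simp) ?_ ?_)
  · intro N hN st' hF hI
    have v1 := hF.v 1 rfl
    have v7 := hF.v 7 rfl
    have a0 := hF.arr 0 rfl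
    rw [hB.n] at v1
    rw [hB.pow] at v7
    have key : eval (st'.setv 10 N) (lit 1 - Expr.get 0 (var 10) % var 7) =
        ind (CoveredBy T.fam 0 (B.mask (T.m (3 * h * r)) N)) := by
      simp only [eval_sub, eval_lit, eval_mod, eval_get, eval_var, St.setv_v, St.setv_arr, if_true,
        a0, hM N hN]
      rw [if_neg (by norm_num), v7, coveredBy_zero]
      by_cases hc : B.mask (T.m (3 * h * r)) N % 2 ^ T.n = 0
      · rw [ind_of hc, hc]
      · rw [ind_of_not hc]; omega
    refine Good.put (by simp) (by simp) ?_ ?_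
    · rw [key]; exact lt_of_le_of_lt (ind_le _) h1
    · intro N' hN'
      rw [key, St.seta_arr]
      simp only [eval_mul, eval_get, eval_var, eval_add, eval_lit, St.setv_v, St.setv_arr, if_true,
        a0, hM N hN, true_and, OfNat.one_ne_ofNat, if_false, v1]
      split_ifs with heq
      · rw [Nat.eq_of_mul_eq_mul_right (Nat.succ_pos _) heq]
      · refine hI N' ?_
        rcases Nat.lt_succ_iff_lt_or_eq.1 hN' with hlt | rfl
        · exact hlt
        · exact absurd rfl heq
  · intro st' hF hI
    have a0 := hF.arr 0 rfl
    have hB' := hB.frame rfl hF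
    refine Good.forTo T.t (fun τ st' => Covers B T (fun τ' _ => τ' ≤ τ) st') (by simp)
      (by simp [hB'.t]) (by simpa [setting]) (by simp; omega) ?_ ?_ ?_
    · intro N hN τ hτ h0
      obtain rfl : τ = 0 := by omega
      exact hI N hN
    · intro τ hτ st'' hF' hC
      have b0 := hF'.arr 0 rfl
      have hB'' := (hB'.frame rfl hF').setv (x := 11) (by simp) τ
      refine Good.forTo (T.L (3 * h * r) Q)
        (fun N st' => Covers B T (fun τ' N' => τ' ≤ τ ∨ τ' = τ + 1 ∧ N' < N) st') (by simp)
        (by rw [eval_var, hB''.L]) (by simp [setting]) hT.L_lt ?_ ?_ ?_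
      · intro N hN τ' hτ' hP
        exact hC N hN τ' hτ' (by omega)
      · intro N hN st₃ hF'' hC'
        have c0 := hF''.arr 0 rfl
        have w11 := hF''.v 11 rfl
        refine good_coverRow B hT ((hB''.frame rfl hF'').setv (by simp) _) (fun N hN => ?_) hτ hN
          ?_ ?_ hC'
        · rw [St.setv_arr, c0, St.setv_arr, b0, a0, hM N hN]
        · simpa using w11
        · simp
      · intro st₃ hF'' hC' N hN τ' hτ' hP
        exact hC' N hN τ' hτ' (by omega)
    · intro st'' hF' hC N hN τ hτ _
      exact hC N hN τ hτ hτ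

end CoverTask

/-! ### The set cover program: evaluation of the trilinear form -/

/-- An encoding of the elements of a finite field by small numbers. -/
structure FieldCode (K : Type*) [Field K] where
  size : ℕ
  enc : K → ℕ
  dec : ℕ → K
  dec_enc : ∀ x, dec (enc x) = x
  enc_lt : ∀ x, enc x < size
  enc_zero : enc 0 = 0
  enc_one : enc 1 = 1

theorem FieldCode.enc_eq_zero {K : Type*} [Field K] (E : FieldCode K) {x : K} :
    E.enc x = 0 ↔ x = 0 := by
  constructor
  · intro h
    rw [← E.dec_enc x, h, ← E.enc_zero, E.dec_enc]
  · rintro rfl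
    exact E.enc_zero

/-- The elements 0 and 1 receive the codes 0 and 1, so that a product of a random bit and a truth
value is already an encoded field element; all others are shifted by 2. -/
theorem exists_fieldCode (K : Type*) [Field K] [Finite K] : Nonempty (FieldCode K) := by
  classical
  obtain ⟨N, ⟨e⟩⟩ := Finite.exists_equiv_fin K
  set enc : K → ℕ := fun x => if x = 0 then 0 else if x = 1 then 1 else e x + 2 with henc
  have hinj : Function.Injective enc := by
    intro x y hxy
    simp only [henc] at hxy
    split_ifs at hxy with h1 h2 h3 h4 h5 h6 h7 <;> first | omega | simp_all
    exact e.injective (Fin.ext hxy)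
  refine ⟨⟨N + 2, enc, Function.invFun enc, Function.leftInverse_invFun hinj, fun x => ?_,
    by simp [henc], by simp [henc]⟩⟩
  have := (e x).2
  simp only [henc]
  split_ifs <;> omega

namespace ArrayLang

open ArrayLang.Expr

namespace Expr

variable {K : Type*} [Field K] (E : FieldCode K) {e f : Expr} {x y : K} {st : St} {Z : ℕ}

/-- Addition of encoded field elements. -/
def fadd (e f : Expr) : Expr :=
  lookup₂ (fun i j => E.enc (E.dec i + E.dec j)) E.size E.size e f

/-- Multiplication of encoded field elements. -/
def fmul (e f : Expr) : Expr :=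
  lookup₂ (fun i j => E.enc (E.dec i * E.dec j)) E.size E.size e f

theorem eval_fadd (he : e.eval st = E.enc x) (hf : f.eval st = E.enc y) :
    (fadd E e f).eval st = E.enc (x + y) := by
  rw [fadd, eval_lookup₂ _ _ (he ▸ E.enc_lt x) (hf ▸ E.enc_lt y), he, hf, E.dec_enc, E.dec_enc]

theorem eval_fmul (he : e.eval st = E.enc x) (hf : f.eval st = E.enc y) :
    (fmul E e f).eval st = E.enc (x * y) := by
  rw [fmul, eval_lookup₂ _ _ (he ▸ E.enc_lt x) (hf ▸ E.enc_lt y), he, hf, E.dec_enc, E.dec_enc]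

@[simp] theorem ok_fadd (he : e.Ok Z st) (hf : f.Ok Z st) : (fadd E e f).Ok Z st :=
  ok_lookup₂ _ _ _ _ _ _ _ he hf

@[simp] theorem ok_fmul (he : e.Ok Z st) (hf : f.Ok Z st) : (fmul E e f).Ok Z st :=
  ok_lookup₂ _ _ _ _ _ _ _ he hf

/-- The encoded coefficient with row `l` and column `A` of the matrix number `κ`. -/
def coefficient (c : ℕ → ℕ → ℕ → K) (Q : ℕ) (κ l A : Expr) : Expr :=
  lookup₂ (fun i j => E.enc (c (i / Q) (i % Q) j)) (3 * Q) Q (κ * lit Q + l) A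

theorem eval_coefficient (c : ℕ → ℕ → ℕ → K) {Q : ℕ} {κ l A : Expr} (hκ : κ.eval st < 3)
    (hl : l.eval st < Q) (hA : A.eval st < Q) :
    (coefficient E c Q κ l A).eval st = E.enc (c (κ.eval st) (l.eval st) (A.eval st)) := by
  have hQ : 0 < Q := by omega
  rw [coefficient, eval_lookup₂ _ _ ?_ hA]
  · simp only [eval_add, eval_mul, eval_lit]
    rw [mul_comm, Nat.mul_add_div hQ, Nat.div_eq_of_lt hl, Nat.mul_add_mod, Nat.mod_eq_of_lt hl,
      add_zero]
  · simp only [eval_add, eval_mul, eval_lit]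
    calc _ < κ.eval st * Q + Q := by omega
      _ = (κ.eval st + 1) * Q := by ring
      _ ≤ 3 * Q := Nat.mul_le_mul_right _ hκ

@[simp] theorem ok_coefficient (c : ℕ → ℕ → ℕ → K) {Q : ℕ} {κ l A : Expr} (hκ : κ.Ok Z st)
    (hl : l.Ok Z st) (hA : A.Ok Z st) : (coefficient E c Q κ l A).Ok Z st :=
  ok_lookup₂ _ _ _ _ _ _ _ (by simp [hκ, hl]) hA

end Expr

variable {K : Type*} [Field K] (E : FieldCode K) (c : ℕ → ℕ → ℕ → K) (Q : ℕ)

/-- Choose random bits for the masks that can be covered. -/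
def randomStmt : Stmt :=
  .forTo 10 (var 5) (.seq (.flip 20) (.put 2 (var 10)
    (var 20 * Expr.get 1 (Expr.get 0 (var 10) * (var 1 + lit 1) + Expr.get 5 (var 17)))))

/-- One pass of Yates' algorithm. -/
def passStmt : Stmt :=
  .seq (.forTo 10 (var 5) (.seq (.set 18 (lit 0)) (.seq (.forTo 19 (lit Q)
    (.set 18 (fadd E (var 18) (fmul E (coefficient E c Q (var 17) (var 10 % lit Q) (var 19))
      (Expr.get 2 (var 19 * var 6 + var 10 / lit Q)))))) (.put 4 (var 10) (var 18)))))
  (.forTo 10 (var 5) (.put 2 (var 10) (Expr.get 4 (var 10))))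

/-- Multiply the products by one of the three factors. -/
def factorStmt : Stmt :=
  .seq randomStmt <|
  .seq (.forTo 8 (var 4) (passStmt E c Q))
  (.forTo 10 (var 5) (.put 3 (var 10) (fmul E (Expr.get 3 (var 10)) (Expr.get 2 (var 10)))))

/-- Compute the guess of the three numbers of sets. -/
def guessStmt : Stmt :=
  .seq (.put 5 (lit 0) (var 16 % (var 3 + lit 1))) <|
  .seq (.put 5 (lit 1) (var 16 / (var 3 + lit 1) % (var 3 + lit 1 - Expr.get 5 (lit 0))))
  (.put 5 (lit 2) (var 3 - Expr.get 5 (lit 0) - Expr.get 5 (lit 1)))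

/-- Evaluate the trilinear form once. -/
def trialStmt : Stmt :=
  .seq guessStmt <|
  .seq (.forTo 10 (var 5) (.put 3 (var 10) (lit 1))) <|
  .seq (.forTo 17 (lit 3) (factorStmt E c Q)) <|
  .seq (.set 18 (lit 0)) <|
  .seq (.forTo 10 (var 5) (.set 18 (fadd E (var 18) (Expr.get 3 (var 10)))))
  (.set 0 (lit 1 - (lit 1 - (var 0 + var 18))))

/-- Evaluate the trilinear form for all guesses, and nine times for each of them. -/
def mainStmt : Stmt :=
  .seq (.set 0 (lit 0))
  (.forTo 16 (lit 9 * (var 3 + lit 1) * (var 3 + lit 1)) (trialStmt E c Q))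

end ArrayLang

open ArrayLang ArrayLang.Expr ArrayLang.Setting

namespace CoverTask

variable {K : Type*} [Field K] {h k r Q : ℕ} (B : BlockData K h k r Q) {T : CoverTask}
  {st st' : St} (E : FieldCode K)

/-- The guess of the three numbers of sets in the trial number `u`. -/
def guess (T : CoverTask) (u κ : ℕ) : ℕ :=
  if κ = 0 then u % (T.t + 1)
  else if κ = 1 then u / (T.t + 1) % (T.t + 1 - u % (T.t + 1))
  else T.t - u % (T.t + 1) - u / (T.t + 1) % (T.t + 1 - u % (T.t + 1))

theorem guess_sum (T : CoverTask) (u : ℕ) : T.guess u 0 + T.guess u 1 + T.guess u 2 = T.t := by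
  have h1 := Nat.mod_lt u (show 0 < T.t + 1 by omega)
  have h2 := Nat.mod_lt (u / (T.t + 1)) (show 0 < T.t + 1 - u % (T.t + 1) by omega)
  simp only [guess, if_true, one_ne_zero, if_false, OfNat.ofNat_ne_zero, OfNat.ofNat_ne_one]
  omega

theorem guess_le (T : CoverTask) (u κ : ℕ) (hκ : κ < 3) : T.guess u κ ≤ T.t := by
  have := T.guess_sum u
  interval_cases κ <;> omega

theorem one_lt_two_pow (hT : T.Valid (3 * h * r) Q) : 9 < 2 ^ T.w :=
  lt_of_le_of_lt (by linarith [Nat.one_le_pow 2 (T.n + 1) (by simp)]) hT.n_lt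

theorem good_random (hT : T.Valid (3 * h * r) Q) (hB : T.Base (3 * h * r) Q st)
    (hM : Masks B T st) (hC : Covers B T (fun _ _ => True) st) {κ τ p : ℕ} (hτ : τ ≤ T.t)
    (v17 : st.v 17 = κ) (a5 : st.arr 5 κ = τ) (hp : st.pos = p) :
    (T.setting (3 * h * r) Q).Good st randomStmt fun st' =>
      (∀ N < T.L (3 * h * r) Q, st'.arr 2 N = (T.ω (p + N)).toNat *
        ind (CoveredBy T.fam τ (B.mask (T.m (3 * h * r)) N))) ∧
      st'.pos = p + T.L (3 * h * r) Q := by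
  have h1 := one_lt_two_pow hT
  refine Good.forTo (T.L (3 * h * r) Q) (fun i st' => (∀ N < i, st'.arr 2 N =
    (T.ω (p + N)).toNat * ind (CoveredBy T.fam τ (B.mask (T.m (3 * h * r)) N))) ∧
      st'.pos = p + i) (by simp) (by simp [hB.L]) (by simp [setting]) hT.L_lt (by simp [hp]) ?_
      (fun st' _ hI => hI)
  rintro N hN st' hF ⟨hI, hpos⟩
  have v1 := hF.v 1 rfl
  have v17' := hF.v 17 rfl
  have a0 := hF.arr 0 rfl
  have a1 := hF.arr 1 rfl
  have a5' := hF.arr 5 rfl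
  rw [hB.n] at v1
  rw [v17] at v17'
  have key : (T.ω (p + N)).toNat * ind (CoveredBy T.fam τ (B.mask (T.m (3 * h * r)) N)) ≤ 1 :=
    (Nat.mul_le_mul (Bool.toNat_le _) (ind_le _)).trans (by simp)
  refine Good.seq (Good.flip (Good.put (by simp) (by simp) ?_ ⟨?_, ?_⟩))
  · simp [hpos, a0, a1, a5', a5, v1, v17', hM N hN, hC N hN τ hτ trivial]
    omega
  · intro N' hN'
    rw [St.seta_arr]
    simp [hpos, a0, a1, a5', a5, v1, v17', hM N hN, hC N hN τ hτ trivial]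
    split_ifs with heq
    · rw [heq]
    · exact hI N' (by omega)
  · simp [hpos, add_assoc]

/-- Every new entry depends on Q old ones, so the result is collected in array 4 and copied back.
All indices read stay below L because Q·Q^(m-1) = L. -/
theorem good_pass (hT : T.Valid (3 * h * r) Q) (hE : E.size ≤ 2 ^ T.w)
    (hB : T.Base (3 * h * r) Q st) {κ : ℕ} (hκ : κ < 3) (v17 : st.v 17 = κ) (V : ℕ → K)
    (hV : ∀ N < T.L (3 * h * r) Q, st.arr 2 N = E.enc (V N)) :
    (T.setting (3 * h * r) Q).Good st (passStmt E B.coef Q) fun st' =>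
      ∀ N < T.L (3 * h * r) Q, st'.arr 2 N =
        E.enc (yatesPass Q (Q ^ (T.m (3 * h * r) - 1)) (B.coef κ) V N) := by
  have hQ := hT.Q_pos
  have hLs : T.L (3 * h * r) Q = Q * Q ^ (T.m (3 * h * r) - 1) := by
    rw [L, ← pow_succ']; rfl
  have hQL : Q ≤ T.L (3 * h * r) Q := by
    rw [hLs]; exact Nat.le_mul_of_pos_right _ (by positivity)
  have hlt : ∀ x, E.enc x < 2 ^ T.w := fun x => (E.enc_lt x).trans_le hE
  refine Good.seq (Good.forTo (T.L (3 * h * r) Q) (fun i st' => ∀ N < i, st'.arr 4 N =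
    E.enc (yatesPass Q (Q ^ (T.m (3 * h * r) - 1)) (B.coef κ) V N)) (by simp) (by simp [hB.L])
    (by simp [setting]) hT.L_lt (by simp) ?_ ?_)
  · intro N hN st' hF hI
    have hB' := (hB.frame rfl hF).setv (x := 10) (by simp) N
    have v17' := hF.v 17 rfl
    have a2 := hF.arr 2 rfl
    rw [v17] at v17'
    refine Good.seq (Good.set (by simp) (by simp) ?_)
    refine Good.seq (Good.forTo Q (fun A st' => st'.v 18 = E.enc (∑ A ∈ Finset.range A,
      B.coef κ (N % Q) A * V (A * Q ^ (T.m (3 * h * r) - 1) + N / Q))) (by simp) (by simp)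
      (by simp) (hQL.trans_lt hT.L_lt) (by simp [E.enc_zero]) ?_ ?_)
    · intro A hA st'' hF' h18
      have w17 := hF'.v 17 rfl
      have w10 := hF'.v 10 rfl
      have w6 := hF'.v 6 rfl
      have b2 := hF'.arr 2 rfl
      simp [v17', a2] at w17 w10 w6 b2
      have w6' : st''.v 6 = Q ^ (T.m (3 * h * r) - 1) := by
        rw [w6, ← hB'.L₁]; simp
      have hidx : A * Q ^ (T.m (3 * h * r) - 1) + N / Q < T.L (3 * h * r) Q := by
        have h2 : N / Q < Q ^ (T.m (3 * h * r) - 1) := Nat.div_lt_of_lt_mul (hLs ▸ hN)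
        calc _ < A * Q ^ (T.m (3 * h * r) - 1) + Q ^ (T.m (3 * h * r) - 1) := by omega
          _ = (A + 1) * Q ^ (T.m (3 * h * r) - 1) := by ring
          _ ≤ _ := by rw [hLs]; exact Nat.mul_le_mul_right _ hA
      have key : eval (st''.setv 19 A) (fadd E (var 18) (fmul E (coefficient E B.coef Q (var 17)
          (var 10 % lit Q) (var 19)) (Expr.get 2 (var 19 * var 6 + var 10 / lit Q)))) =
          E.enc (∑ A ∈ Finset.range (A + 1),
            B.coef κ (N % Q) A * V (A * Q ^ (T.m (3 * h * r) - 1) + N / Q)) := by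
        rw [Finset.sum_range_succ]
        refine eval_fadd E (by simp [h18]) (eval_fmul E ?_ ?_)
        · rw [eval_coefficient]
          · simp [w17, w10]
          · simpa [w17]
          · simpa using Nat.mod_lt _ (by omega)
          · simpa
        · simp [w6', w10, b2, hV _ hidx]
      refine Good.set (ok_fadd E (by simp) (ok_fmul E (by simp) (by simp))) ?_ ?_
      · rw [key]; exact hlt _
      · rw [key]; simp
    · intro st'' hF' h18
      have w10 := hF'.v 10 rfl
      have b4 := hF'.arr 4 rfl
      simp at w10 b4
      refine Good.put (by simp) (by simp) ?_ ?_
      · simp [h18, hlt]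
      · intro N' hN'
        rw [St.seta_arr]
        simp only [eval_var, w10, h18, true_and, b4]
        split_ifs with heq
        · rw [heq, yatesPass]
        · exact hI N' (by omega)
  · intro st' hF hI
    have hB' := hB.frame rfl hF
    refine Good.forTo (T.L (3 * h * r) Q) (fun i st' => ∀ N < i, st'.arr 2 N =
      E.enc (yatesPass Q (Q ^ (T.m (3 * h * r) - 1)) (B.coef κ) V N)) (by simp)
      (by simp [hB'.L]) (by simp [setting]) hT.L_lt (by simp) ?_ (fun st' _ hI => hI)
    intro N hN st'' hF' hI'
    have b4 := hF'.arr 4 rfl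
    refine Good.put (by simp) (by simp) ?_ ?_
    · simp [b4, hI N hN, hlt]
    · intro N' hN'
      rw [St.seta_arr]
      simp [b4, hI N hN]
      split_ifs with heq
      · rw [heq]
      · exact hI' N' (by omega)

theorem good_factor (hT : T.Valid (3 * h * r) Q) (hE : E.size ≤ 2 ^ T.w)
    (hB : T.Base (3 * h * r) Q st) (hM : Masks B T st) (hC : Covers B T (fun _ _ => True) st)
    {κ τ p : ℕ} (hκ : κ < 3) (hτ : τ ≤ T.t) (v17 : st.v 17 = κ) (a5 : st.arr 5 κ = τ)
    (hp : st.pos = p) (V P : ℕ → K)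
    (hV : ∀ N < T.L (3 * h * r) Q, E.enc (V N) = (T.ω (p + N)).toNat *
      ind (CoveredBy T.fam τ (B.mask (T.m (3 * h * r)) N)))
    (hP : ∀ N < T.L (3 * h * r) Q, st.arr 3 N = E.enc (P N)) :
    (T.setting (3 * h * r) Q).Good st (factorStmt E B.coef Q) fun st' =>
      (∀ N < T.L (3 * h * r) Q, st'.arr 3 N = E.enc (P N *
        (yatesPass Q (Q ^ (T.m (3 * h * r) - 1)) (B.coef κ))^[T.m (3 * h * r)] V N)) ∧
      st'.pos = p + T.L (3 * h * r) Q := by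
  have hlt : ∀ x, E.enc x < 2 ^ T.w := fun x => (E.enc_lt x).trans_le hE
  have hm : T.m (3 * h * r) < 2 ^ T.w := by
    refine lt_of_lt_of_le Nat.lt_two_pow_self (le_trans ?_ hT.mask_le)
    exact Nat.pow_le_pow_right (by norm_num) (Nat.le_mul_of_pos_left _ hT.b_pos)
  refine Good.seq ((good_random B hT hB hM hC hτ v17 a5 hp).frame.mono ?_)
  rintro st₁ ⟨hF₁, h2, hpos⟩
  have hB₁ := hB.frame rfl hF₁
  refine Good.seq (Good.forTo (T.m (3 * h * r)) (fun i st' => ∀ N < T.L (3 * h * r) Q,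
    st'.arr 2 N = E.enc ((yatesPass Q (Q ^ (T.m (3 * h * r) - 1)) (B.coef κ))^[i] V N))
    (by simp) (by simp [hB₁.m]) (by simp [setting]) hm ?_ ?_ ?_)
  · intro N hN
    rw [h2 N hN, Function.iterate_zero, id, hV N hN]
  · intro i hi st₂ hF₂ hI
    simp only [Function.iterate_succ', Function.comp_apply]
    refine good_pass B E hT hE ((hB₁.frame rfl hF₂).setv (by simp) _) hκ ?_ _ ?_
    · have w := hF₂.v 17 rfl
      have w' := hF₁.v 17 rfl
      simp [w, w', v17]
    · simpa using hI
  · intro st₂ hF₂ hI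
    have hB₂ := hB₁.frame rfl hF₂
    have b3 := hF₂.arr 3 rfl
    have b3' := hF₁.arr 3 rfl
    refine Good.forTo (T.L (3 * h * r) Q) (fun i st' => ∀ N < T.L (3 * h * r) Q,
      st'.arr 3 N = if N < i then E.enc (P N *
        (yatesPass Q (Q ^ (T.m (3 * h * r) - 1)) (B.coef κ))^[T.m (3 * h * r)] V N)
        else E.enc (P N)) (by simp) (by simp [hB₂.L]) (by simp [setting]) hT.L_lt ?_ ?_ ?_
    · intro N hN
      simp [b3, b3', hP N hN]
    · intro N hN st₃ hF₃ hI'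
      have c2 := hF₃.arr 2 rfl
      have key : eval (st₃.setv 10 N) (fmul E (Expr.get 3 (var 10)) (Expr.get 2 (var 10))) =
          E.enc (P N *
            (yatesPass Q (Q ^ (T.m (3 * h * r) - 1)) (B.coef κ))^[T.m (3 * h * r)] V N) :=
        eval_fmul E (by simp [hI' N hN]) (by simp [c2, hI N hN])
      refine Good.put (by simp) (by simp) ?_ ?_
      · rw [key]; exact hlt _
      · intro N' hN'
        rw [key, St.seta_arr]
        simp only [eval_var, St.setv_v, if_true, true_and, St.setv_arr, hI' N' hN']
        rcases lt_trichotomy N' N with hlt | rfl | hlt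
        · rw [if_neg (by omega), if_pos hlt, if_pos (by omega)]
        · simp
        · rw [if_neg (by omega), if_neg (by omega), if_neg (by omega)]
    · intro st₃ hF₃ hI'
      refine ⟨fun N hN => by rw [hI' N hN, if_pos hN], ?_⟩
      rw [hF₃.pos rfl, hF₂.pos rfl, hpos]

/-- The random input of the trilinear form in the trial number `u`. -/
noncomputable def trialInput (T : CoverTask) (u : ℕ) : ℕ → ℕ → K :=
  BlockData.randomInput (T.L (3 * h * r) Q)
    (fun κ N => CoveredBy T.fam (T.guess u κ) (B.mask (T.m (3 * h * r)) N)) T.ω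
    (u * (3 * T.L (3 * h * r) Q))

theorem enc_trialInput (u κ N : ℕ) : E.enc (trialInput B T u κ N) =
    (T.ω (u * (3 * T.L (3 * h * r) Q) + κ * T.L (3 * h * r) Q + N)).toNat *
      ind (CoveredBy T.fam (T.guess u κ) (B.mask (T.m (3 * h * r)) N)) := by
  classical
  rw [trialInput, BlockData.randomInput, ind]
  cases T.ω (u * (3 * T.L (3 * h * r) Q) + κ * T.L (3 * h * r) Q + N) <;>
    split_ifs <;> simp_all [E.enc_zero, E.enc_one]

theorem good_guess (hT : T.Valid (3 * h * r) Q) (hB : T.Base (3 * h * r) Q st) {u : ℕ}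
    (v16 : st.v 16 = u) : (T.setting (3 * h * r) Q).Good st guessStmt fun st' =>
      ∀ κ < 3, st'.arr 5 κ = T.guess u κ := by
  have htn : T.t ≤ T.n := min_le_right _ _
  have ht : T.t + 1 < 2 ^ T.w := lt_of_le_of_lt (by nlinarith) hT.n_lt
  have h1 := Nat.mod_lt u (show 0 < T.t + 1 by omega)
  have h2 := Nat.mod_lt (u / (T.t + 1)) (show 0 < T.t + 1 - u % (T.t + 1) by omega)
  refine Good.seq (Good.put (by simp) (by simp) ?_ ?_)
  · simp [v16, hB.t]; omega
  refine Good.seq (Good.put (by simp) (by simp) ?_ ?_)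
  · simp [v16, hB.t, St.seta_arr]; omega
  refine Good.put (by simp) (by simp) ?_ ?_
  · simp [v16, hB.t, St.seta_arr]; omega
  intro κ hκ
  interval_cases κ <;> simp [v16, hB.t, St.seta_arr, guess]

/-- The trilinear form does not vanish at its random input in the trial number `u`. -/
def Success (T : CoverTask) (u : ℕ) : Prop :=
  B.value (T.m (3 * h * r)) (trialInput B T u) ≠ 0

/-- R stands for success in an earlier trial. Each trial consumes exactly 3L random bits, whatever
they are, so trial u starts at position 3Lu and the trials use disjoint bits. -/
theorem good_trial (hT : T.Valid (3 * h * r) Q) (hE : E.size ≤ 2 ^ T.w)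
    (hB : T.Base (3 * h * r) Q st) (hM : Masks B T st) (hC : Covers B T (fun _ _ => True) st)
    {u : ℕ} {R : Prop} (v16 : st.v 16 = u) (v0 : st.v 0 = ind R)
    (hp : st.pos = u * (3 * T.L (3 * h * r) Q)) :
    (T.setting (3 * h * r) Q).Good st (trialStmt E B.coef Q) fun st' =>
      st'.v 0 = ind (R ∨ Success B T u) ∧ st'.pos = (u + 1) * (3 * T.L (3 * h * r) Q) := by
  have h1 := one_lt_two_pow hT
  have hlt : ∀ x, E.enc x < 2 ^ T.w := fun x => (E.enc_lt x).trans_le hE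
  set y : ℕ → ℕ → K := fun κ => (yatesPass Q (Q ^ (T.m (3 * h * r) - 1)) (B.coef κ))^[T.m
    (3 * h * r)] (trialInput B T u κ) with hy
  refine Good.seq ((good_guess hT hB v16).frame.mono ?_)
  rintro st₁ ⟨hF₁, h5⟩
  have hB₁ := hB.frame rfl hF₁
  refine Good.seq (Good.forTo (T.L (3 * h * r) Q) (fun i st' => ∀ N < i, st'.arr 3 N = 1)
    (by simp) (by simp [hB₁.L]) (by simp [setting]) hT.L_lt (by simp) ?_ ?_)
  · intro N hN st' hF hI
    refine Good.put (by simp) (by simp) (show 1 < 2 ^ T.w by omega) ?_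
    intro N' hN'
    rw [St.seta_arr]
    simp only [eval_var, eval_lit, St.setv_v, if_true, true_and, St.setv_arr]
    split_ifs with heq
    · rfl
    · exact hI N' (by omega)
  intro st₂ hF₂ h3
  have hB₂ := hB₁.frame rfl hF₂
  have hM₂ : st₂.arr 0 = st.arr 0 := (hF₂.arr 0 rfl).trans (hF₁.arr 0 rfl)
  have hC₂ : st₂.arr 1 = st.arr 1 := (hF₂.arr 1 rfl).trans (hF₁.arr 1 rfl)
  have h5₂ : st₂.arr 5 = st₁.arr 5 := hF₂.arr 5 rfl
  have hp₂ : st₂.pos = st.pos := (hF₂.pos rfl).trans (hF₁.pos rfl)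
  have h0₂ : st₂.v 0 = st.v 0 := (hF₂.v 0 rfl).trans (hF₁.v 0 rfl)
  refine Good.seq (Good.forTo 3 (fun κ st' => (∀ N < T.L (3 * h * r) Q,
    st'.arr 3 N = E.enc (∏ κ ∈ Finset.range κ, y κ N)) ∧
    st'.pos = u * (3 * T.L (3 * h * r) Q) + κ * T.L (3 * h * r) Q) (by simp) (by simp)
    (by simp) (show 3 < 2 ^ T.w by omega) ?_ ?_ ?_)
  · refine ⟨fun N hN => ?_, by simp [hp₂, hp]⟩
    simp [h3 N hN, E.enc_one]
  · rintro κ hκ st' hF ⟨hI, hpos⟩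
    refine (good_factor B E hT hE ((hB₂.frame rfl hF).setv (by simp) _) (fun N hN => ?_)
      (fun N hN τ hτ _ => ?_) hκ (T.guess_le u κ hκ) (by simp) ?_ hpos (trialInput B T u κ)
      (fun N => ∏ κ ∈ Finset.range κ, y κ N) ?_ (by simpa using hI)).mono ?_
    · rw [St.setv_arr, hF.arr 0 rfl, hM₂, hM N hN]
    · rw [St.setv_arr, hF.arr 1 rfl, hC₂, hC N hN τ hτ trivial]
    · rw [St.setv_arr, hF.arr 5 rfl, h5₂, h5 κ hκ]
    · intro N _
      rw [enc_trialInput]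
    · rintro st'' ⟨g1, g2⟩
      refine ⟨fun N hN => ?_, by rw [g2]; ring⟩
      rw [g1 N hN, Finset.prod_range_succ]
  · rintro st₃ hF₃ ⟨h3₃, hpos⟩
    have hB₃ := hB₂.frame rfl hF₃
    refine Good.seq (Good.set (by simp) (by simp) ?_)
    refine Good.seq (Good.forTo (T.L (3 * h * r) Q) (fun i st' => st'.v 18 =
      E.enc (∑ N ∈ Finset.range i, ∏ κ ∈ Finset.range 3, y κ N)) (by simp) (by simp [hB₃.L])
      (by simp [setting]) hT.L_lt (by simp [E.enc_zero]) ?_ ?_)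
    · intro N hN st' hF hI
      have a3 := hF.arr 3 rfl
      have key : eval (st'.setv 10 N) (fadd E (var 18) (Expr.get 3 (var 10))) =
          E.enc (∑ N ∈ Finset.range (N + 1), ∏ κ ∈ Finset.range 3, y κ N) := by
        rw [Finset.sum_range_succ]
        exact eval_fadd E (by simp [hI]) (by simp [a3, h3₃ N hN])
      refine Good.set (by simp) ?_ ?_
      · rw [key]; exact hlt _
      · rw [key]; simp
    · intro st₄ hF₄ h18
      have w0 := hF₄.v 0 rfl
      have w0' := hF₃.v 0 rfl
      simp [w0', h0₂, v0] at w0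
      have key : eval st₄ (lit 1 - (lit 1 - (var 0 + var 18))) = ind (R ∨ Success B T u) := by
        have hv : ∑ N ∈ Finset.range (T.L (3 * h * r) Q), ∏ κ ∈ Finset.range 3, y κ N =
            B.value (T.m (3 * h * r)) (trialInput B T u) := by
          simp only [Finset.prod_range_succ, Finset.prod_range_zero, one_mul]
          rfl
        simp only [eval_sub, eval_lit, eval_add, eval_var, w0, h18, hv]
        by_cases hs : B.value (T.m (3 * h * r)) (trialInput B T u) = 0
        · rw [hs, E.enc_zero, add_zero]
          have : (R ∨ Success B T u) = R := by simp [Success, hs]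
          rw [this]
          have := ind_le R
          omega
        · have h2 : E.enc (B.value (T.m (3 * h * r)) (trialInput B T u)) ≠ 0 := fun h0 =>
            hs (E.enc_eq_zero.1 h0)
          rw [ind_of (show R ∨ Success B T u from Or.inr hs)]
          omega
      refine Good.set (by simp) ?_ ⟨?_, ?_⟩
      · rw [key]; exact lt_of_le_of_lt (ind_le _) (show 1 < 2 ^ T.w by omega)
      · rw [key]; simp
      · rw [St.setv_pos, hF₄.pos rfl, St.setv_pos, hpos]; ring

theorem good_main (hT : T.Valid (3 * h * r) Q) (hE : E.size ≤ 2 ^ T.w)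
    (hB : T.Base (3 * h * r) Q st) (hM : Masks B T st) (hC : Covers B T (fun _ _ => True) st)
    (hp : st.pos = 0) :
    (T.setting (3 * h * r) Q).Good st (mainStmt E B.coef Q) fun st' =>
      st'.v 0 = ind (∃ u < 9 * (T.t + 1) * (T.t + 1), Success B T u) := by
  have htn : T.t ≤ T.n := min_le_right _ _
  have hle : 9 * (T.t + 1) * (T.t + 1) ≤ 9 * (T.n + 1) * (T.n + 1) := by gcongr
  refine Good.seq (Good.set (by simp) (by simp) ?_)
  refine Good.forTo (9 * (T.t + 1) * (T.t + 1)) (fun i st' =>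
    st'.v 0 = ind (∃ u < i, Success B T u) ∧ st'.pos = i * (3 * T.L (3 * h * r) Q)) (by simp)
    (by simp [hB.t]) hle ?_ ?_ ?_ (fun st' _ hI => hI.1)
  · exact lt_of_le_of_lt hle (by have := hT.n_lt; rwa [sq, ← mul_assoc] at this)
  · simp [ind, hp]
  · rintro u hu st' hF ⟨h0, hpos⟩
    have hF0 := hF.arr 0 rfl
    have hF1 := hF.arr 1 rfl
    refine (good_trial B E hT hE (((hB.setv (by simp) _).frame rfl hF).setv (by simp) _)
      (fun N hN => ?_) (fun N hN τ hτ _ => ?_) (u := u) (R := ∃ u' < u, Success B T u') (by simp)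
      (by simp [h0]) (by simpa using hpos)).mono ?_
    · rw [St.setv_arr, hF0, St.setv_arr, hM N hN]
    · rw [St.setv_arr, hF1, St.setv_arr, hC N hN τ hτ trivial]
    · rintro st'' ⟨g1, g2⟩
      refine ⟨?_, g2⟩
      rw [g1]
      congr 1
      simp only [Nat.lt_succ_iff_lt_or_eq, or_and_right, exists_or, exists_eq_left]

end CoverTask

/-! ### The complete program -/

namespace ArrayLang

/-- The program for set cover. -/
def setCoverStmt {K : Type*} [Field K] {h k r Q : ℕ} (B : BlockData K h k r Q)
    (E : FieldCode K) : Stmt :=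
  .seq (initStmt (3 * h * r) Q) <|
  .seq (maskStmt B.tab (3 * h * r) Q) <|
  .seq coverStmt
  (mainStmt E B.coef Q)

end ArrayLang

namespace CoverTask

variable {K : Type*} [Field K] {h k r Q : ℕ} (B : BlockData K h k r Q) {T : CoverTask}
  {st : St} (E : FieldCode K)

theorem good_setCover (hT : T.Valid (3 * h * r) Q) (hE : E.size ≤ 2 ^ T.w)
    (hst : st.inp = T.inp) (hp : st.pos = 0) :
    (T.setting (3 * h * r) Q).Good st (setCoverStmt B E) fun st' =>
      st'.v 0 = ind (∃ u < 9 * (T.t + 1) * (T.t + 1), Success B T u) := by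
  refine Good.seq ((good_init hT hst).frame.mono ?_)
  rintro st₁ ⟨hF₁, hB₁⟩
  refine Good.seq ((good_masks B hT hB₁).frame.mono ?_)
  rintro st₂ ⟨hF₂, hM₂⟩
  have hB₂ := hB₁.frame rfl hF₂
  refine Good.seq ((good_cover B hT hB₂ hM₂).frame.mono ?_)
  rintro st₃ ⟨hF₃, hC₃⟩
  have hM₃ := hF₃.arr 0 rfl
  refine good_main B E hT hE (hB₂.frame rfl hF₃) (fun N hN => ?_) hC₃ ?_
  · rw [hM₃, hM₂ N hN]
  · rw [hF₃.pos rfl, hF₂.pos rfl, hF₁.pos rfl, hp]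

end CoverTask

/-! ### Running time -/

namespace ArrayLang

/-- Up to a constant, the program needs at most `G ^ a * L ^ e` steps, where `L` is the number of
masks and `G` bounds the other parameters of the instance. -/
def Stmt.CostBound (b Q : ℕ) (p : Stmt) (a e : ℕ) : Prop :=
  ∃ c, ∀ (T : CoverTask) (G : ℕ), T.n + 1 ≤ G → T.fam.length ≤ G →
    p.maxSteps (T.setting b Q).ref ≤ c * (G ^ a * T.L b Q ^ e)

namespace Stmt.CostBound

variable {b Q : ℕ}

theorem one_le (hQ : 0 < Q) {T : CoverTask} {G : ℕ} (hG : T.n + 1 ≤ G) (a e : ℕ) :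
    1 ≤ G ^ a * T.L b Q ^ e :=
  Nat.mul_pos (Nat.pow_pos (by omega)) (Nat.pow_pos (Nat.pow_pos hQ))

theorem set (hQ : 0 < Q) (x : ℕ) (f : Expr) (a e : ℕ) : CostBound b Q (.set x f) a e :=
  ⟨f.len + 1, fun _ _ hG _ => Nat.le_mul_of_pos_right _ (one_le hQ hG a e)⟩

theorem put (hQ : 0 < Q) (k : Fin 8) (f g : Expr) (a e : ℕ) : CostBound b Q (.put k f g) a e :=
  ⟨f.len + g.len + 1, fun _ _ hG _ => Nat.le_mul_of_pos_right _ (one_le hQ hG a e)⟩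

theorem flip (hQ : 0 < Q) (x a e : ℕ) : CostBound b Q (.flip x) a e :=
  ⟨1, fun _ _ hG _ => Nat.le_mul_of_pos_right _ (one_le hQ hG a e)⟩

theorem seq {p q : Stmt} {a e : ℕ} (hp : CostBound b Q p a e) (hq : CostBound b Q q a e) :
    CostBound b Q (.seq p q) a e := by
  obtain ⟨c, hc⟩ := hp
  obtain ⟨c', hc'⟩ := hq
  refine ⟨c + c', fun T G h1 h2 => ?_⟩
  rw [add_mul]
  exact Nat.add_le_add (hc T G h1 h2) (hc' T G h1 h2)

/-- The exponents of the loop bound and of the body add up. The lone term for the loop overhead is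
absorbed because the monomial is at least 1. -/
theorem forTo (hQ : 0 < Q) {x : ℕ} {f : Expr} {p : Stmt} {a e : ℕ} (c₀ a₀ e₀ : ℕ)
    (hf : ∀ (T : CoverTask) (G : ℕ), T.n + 1 ≤ G → T.fam.length ≤ G →
      f.eval (T.setting b Q).ref ≤ c₀ * (G ^ a₀ * T.L b Q ^ e₀))
    (hp : CostBound b Q p a e) : CostBound b Q (.forTo x f p) (a₀ + a) (e₀ + e) := by
  obtain ⟨c, hc⟩ := hp
  refine ⟨f.len + 1 + c₀ * (c + 1), fun T G h1 h2 => ?_⟩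
  have h3 := one_le (b := b) hQ h1 a e
  have h4 := one_le (b := b) hQ h1 (a₀ + a) (e₀ + e)
  calc f.len + 1 + f.eval (T.setting b Q).ref * (p.maxSteps (T.setting b Q).ref + 1)
      ≤ (f.len + 1) * (G ^ (a₀ + a) * T.L b Q ^ (e₀ + e)) + c₀ * (G ^ a₀ * T.L b Q ^ e₀) *
        (c * (G ^ a * T.L b Q ^ e) + 1 * (G ^ a * T.L b Q ^ e)) := by
        refine Nat.add_le_add (Nat.le_mul_of_pos_right _ h4) (Nat.mul_le_mul (hf T G h1 h2) ?_)
        exact Nat.add_le_add (hc T G h1 h2) (by omega)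
    _ = _ := by ring

theorem forTo_param (hQ : 0 < Q) {x : ℕ} {f : Expr} {p : Stmt} {a e : ℕ}
    (hf : ∀ (T : CoverTask) (G : ℕ), T.n + 1 ≤ G → T.fam.length ≤ G →
      f.eval (T.setting b Q).ref ≤ G)
    (hp : CostBound b Q p a e) : CostBound b Q (.forTo x f p) (a + 1) e := by
  have := forTo (x := x) hQ 1 1 0 (fun T G h1 h2 => by simpa using hf T G h1 h2) hp
  rwa [add_comm, Nat.zero_add] at this

theorem forTo_masks (hQ : 0 < Q) {x : ℕ} {p : Stmt} {a : ℕ} (hp : CostBound b Q p a 0) :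
    CostBound b Q (.forTo x (.var 5) p) a 1 := by
  have := forTo (x := x) (f := .var 5) hQ 1 0 1 (fun T G h1 h2 => by
    simp [CoverTask.setting]) hp
  rwa [Nat.zero_add] at this

theorem forTo_lit (hQ : 0 < Q) {x c : ℕ} {p : Stmt} {a e : ℕ} (hp : CostBound b Q p a e) :
    CostBound b Q (.forTo x (.lit c) p) a e := by
  have := forTo (x := x) (f := .lit c) hQ c 0 0 (fun T G h1 h2 => by simp) hp
  rwa [Nat.zero_add, Nat.zero_add] at this

theorem init (hQ : 0 < Q) : CostBound b Q (initStmt b Q) 3 1 := by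
  refine .seq (set hQ _ _ _ _) (.seq (set hQ _ _ _ _) (.seq (set hQ _ _ _ _) (.seq (set hQ _ _ _ _)
    (.seq (forTo_param hQ (fun T G h1 _ => ?_) (.seq (set hQ _ _ _ _) (set hQ _ _ _ _)))
    (.seq (set hQ _ _ _ _) (.seq (set hQ _ _ _ _) (.seq (set hQ _ _ _ _) (.seq (set hQ _ _ _ _)
    (.seq (forTo_param hQ (fun T G h1 _ => ?_) (set hQ _ _ _ _)) (set hQ _ _ _ _))))))))))
  · simp [CoverTask.setting]; omega
  · simp only [CoverTask.setting, Expr.eval_div, Expr.eval_var, Expr.eval_lit]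
    exact (Nat.div_le_self _ _).trans (by omega)

/-- One loop over masks is nested with loops over τ, over the sets and over the elements; this gives
G³L. -/
theorem cover (hQ : 0 < Q) : CostBound b Q coverStmt 3 1 := by
  refine .seq (forTo_masks hQ (put hQ _ _ _ _ _)) (forTo_param hQ (fun T G h1 _ => ?_)
    (forTo_masks hQ (.seq (set hQ _ _ _ _) (.seq (forTo_param hQ (fun T G _ h2 => ?_)
    (.seq (.seq (set hQ _ _ _ _) (.seq (set hQ _ _ _ _) (forTo_param hQ (fun T G h1 _ => ?_)
    (.seq (set hQ _ _ _ _) (set hQ _ _ _ _))))) (set hQ _ _ _ _))) (put hQ _ _ _ _ _)))))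
  · simp [CoverTask.setting]; omega
  · simpa [CoverTask.setting]
  · simp [CoverTask.setting]; omega

variable {K : Type*} [Field K] (E : FieldCode K) (c : ℕ → ℕ → ℕ → K)

/-- There are m ≤ n + 1 passes over L entries; the inner loop of length Q is a constant factor. -/
theorem factor (hQ : 0 < Q) : CostBound b Q (factorStmt E c Q) 1 1 := by
  refine .seq (forTo_masks hQ (.seq (flip hQ _ _ _) (put hQ _ _ _ _ _)))
    (.seq (forTo_param hQ (fun T G h1 _ => ?_) (.seq (forTo_masks hQ (.seq (set hQ _ _ _ _)
    (.seq (forTo_lit hQ (set hQ _ _ _ _)) (put hQ _ _ _ _ _)))) (forTo_masks hQ (put hQ _ _ _ _ _))))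
    (forTo_masks hQ (put hQ _ _ _ _ _)))
  simp only [CoverTask.setting, Expr.eval_var, CoverTask.m]
  have := Nat.div_le_self T.n b
  omega

/-- At most 9(n + 1)² trials account for G², and the passes of Yates' algorithm for one more factor
G. -/
theorem main (hQ : 0 < Q) : CostBound b Q (mainStmt E c Q) 3 1 := by
  refine .seq (set hQ _ _ _ _) (forTo (e := 1) hQ 9 2 0 (fun T G h1 _ => ?_)
    (.seq (.seq (put hQ _ _ _ _ _) (.seq (put hQ _ _ _ _ _) (put hQ _ _ _ _ _)))
    (.seq (forTo_masks hQ (put hQ _ _ _ _ _)) (.seq (forTo_lit hQ (factor E c hQ))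
    (.seq (set hQ _ _ _ _) (.seq (forTo_masks hQ (set hQ _ _ _ _)) (set hQ _ _ _ _)))))))
  simp only [CoverTask.setting, Expr.eval_mul, Expr.eval_add, Expr.eval_var, Expr.eval_lit,
    pow_zero, mul_one]
  nlinarith

theorem setCover {h k r : ℕ} (hQ : 0 < Q) (B : BlockData K h k r Q) :
    CostBound (3 * h * r) Q (setCoverStmt B E) 3 1 :=
  .seq (init hQ) (.seq (.seq (put hQ _ _ _ _ _) (forTo_masks hQ (put hQ _ _ _ _ _)))
    (.seq (cover hQ) (main E _ hQ)))

end Stmt.CostBound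

end ArrayLang

/-- The sequence k^A (g/G)^k tends to 0 and so is bounded; it is used at k = n + 1. -/
theorem exists_bound_pow_mul_pow {g G : ℝ} (hg : 0 < g) (hgG : g < G) (A : ℕ) :
    ∃ C : ℝ, 0 ≤ C ∧ ∀ n : ℕ, ((n : ℝ) + 1) ^ A * g ^ n ≤ C * G ^ n := by
  have hG : 0 < G := hg.trans hgG
  have hr : |g / G| < 1 := by
    rw [abs_of_pos (by positivity)]
    exact (div_lt_one hG).2 hgG
  obtain ⟨M, hM⟩ := (tendsto_pow_const_mul_const_pow_of_abs_lt_one A hr).bddAbove_range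
  refine ⟨M / (g / G), ?_, fun n => ?_⟩
  · have h0 : 0 ≤ M := le_trans (by positivity) (hM ⟨0, rfl⟩)
    positivity
  · have h1 : ((n : ℝ) + 1) ^ A * (g / G) ^ (n + 1) ≤ M := by
      have := hM ⟨n + 1, rfl⟩
      simpa using this
    rw [pow_succ, ← mul_assoc] at h1
    have h2 := (le_div_iff₀ (by positivity : 0 < g / G)).2 h1
    rw [div_pow, ← mul_div_assoc, div_le_iff₀ (by positivity)] at h2
    exact h2

/-! ### The input of the machine -/

namespace SetCoverInstance

theorem length_flatMap_const {α : Type*} {n : ℕ} (g : α → List ℕ) (hg : ∀ x, (g x).length = n)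
    (l : List α) : (l.flatMap g).length = l.length * n := by
  induction l with
  | nil => simp
  | cons x l ih => rw [List.flatMap_cons, List.length_append, hg, ih, List.length_cons]; ring

theorem getD_flatMap_const {α : Type*} {n : ℕ} (g : α → List ℕ) (hg : ∀ x, (g x).length = n)
    (l : List α) (j : ℕ) (hj : j < l.length) (e : ℕ) (he : e < n) :
    (l.flatMap g).getD (j * n + e) 0 = (g l[j]).getD e 0 := by
  induction l generalizing j with
  | nil => simp at hj
  | cons x l ih =>
    rw [List.flatMap_cons]
    cases j with
    | zero =>
      rw [List.getD_append _ _ _ _ (by rw [hg]; omega)]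
      simp
    | succ j =>
      rw [List.getD_append_right _ _ _ _ (by rw [hg]; nlinarith), hg,
        show (j + 1) * n + e - n = j * n + e by rw [add_mul]; omega, ih j (by simpa using hj)]
      simp

theorem getD_digits_succ (t i : ℕ) : ((Nat.digits 2 t).map (· + 1)).getD i 0 =
    if t / 2 ^ i = 0 then 0 else t / 2 ^ i % 2 + 1 := by
  induction i generalizing t with
  | zero =>
    rcases Nat.eq_zero_or_pos t with rfl | ht
    · simp
    · rw [Nat.digits_def' (by norm_num) ht]
      simp [ht.ne']
  | succ i ih =>
    rcases Nat.eq_zero_or_pos t with rfl | ht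
    · simp
    · rw [Nat.digits_def' (by norm_num) ht]
      simp only [List.map_cons, List.getD_cons_succ, ih, Nat.div_div_eq_div_mul, ← pow_succ']

variable {s : ℕ} (I : SetCoverInstance s)

theorem encode_getD_zero : I.encode.getD 0 0 = I.n := by simp [encode]

theorem encode_getD_one : I.encode.getD 1 0 = I.family.length := by simp [encode]

theorem encode_getD_add_two (i : ℕ) : I.encode.getD (2 + i) 0 =
    ((I.family.flatMap fun X => List.ofFn fun i : Fin I.n => if i ∈ X then 1 else 0) ++
    (Nat.digits 2 I.t).map (· + 1)).getD i 0 := by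
  rw [encode, List.append_assoc, List.getD_append_right _ _ _ _ (by simp)]
  simp

theorem encode_getD_family (j : ℕ) (hj : j < I.family.length) (e : ℕ) (he : e < I.n) :
    I.encode.getD (2 + j * I.n + e) 0 =
      if e ∈ (I.family[j]).map Fin.valEmbedding then 1 else 0 := by
  have hlt : j * I.n + e < I.family.length * I.n := by
    calc j * I.n + e < j * I.n + I.n := by omega
      _ = (j + 1) * I.n := by ring
      _ ≤ _ := Nat.mul_le_mul_right _ hj
  rw [add_assoc, encode_getD_add_two, List.getD_append _ _ _ _ (by
    rw [length_flatMap_const (n := I.n) _ (by simp)]; exact hlt),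
    getD_flatMap_const (n := I.n) _ (by simp) _ j hj e he]
  rw [List.getD_eq_getElem _ _ (by simpa), List.getElem_ofFn]
  have : (⟨e, he⟩ ∈ I.family[j]) ↔ e ∈ (I.family[j]).map Fin.valEmbedding := by
    simp only [Finset.mem_map, Fin.valEmbedding_apply]
    constructor
    · intro h
      exact ⟨_, h, rfl⟩
    · rintro ⟨a, ha, rfl⟩
      exact ha
  simp only [this]

theorem encode_getD_digit (i : ℕ) : I.encode.getD (2 + I.family.length * I.n + i) 0 =
    if I.t / 2 ^ i = 0 then 0 else I.t / 2 ^ i % 2 + 1 := by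
  rw [add_assoc, encode_getD_add_two, List.getD_append_right _ _ _ _ (by
    rw [length_flatMap_const (n := I.n) _ (by simp)]; omega),
    length_flatMap_const (n := I.n) _ (by simp), Nat.add_sub_cancel_left, getD_digits_succ]

theorem encode_getD_le (a : ℕ) : I.encode.getD a 0 ≤ I.n + I.family.length + 2 := by
  by_cases ha : a < I.encode.length
  · rw [List.getD_eq_getElem _ _ ha]
    have hmem := List.getElem_mem ha
    generalize I.encode[a] = v at hmem
    simp only [encode, List.mem_append, List.mem_cons, List.not_mem_nil, or_false, List.mem_flatMap,
      List.mem_ofFn, List.mem_map] at hmem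
    rcases hmem with ((rfl | rfl) | ⟨X, -, i, rfl⟩) | ⟨d, hd, rfl⟩
    · omega
    · omega
    · split_ifs <;> omega
    · have := Nat.digits_lt_base (by norm_num) hd
      omega
  · rw [List.getD_eq_default _ _ (by omega)]
    omega

theorem length_family_le_two_pow : I.family.length ≤ 2 ^ I.n := by
  simpa using I.nodup.length_le_card

/-- A set of size at most s is the set of values of a partial function on s points, and there are (n
+ 1)^s of these. Here the bound on the set sizes keeps the running time polynomial in n apart from
L. -/
theorem length_family_le_pow : I.family.length ≤ (I.n + 1) ^ s := by
  classical
  rw [← List.toFinset_card_of_nodup I.nodup]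
  have hsub : I.family.toFinset ⊆ Finset.univ.image fun g : Fin s → Option (Fin I.n) =>
      Finset.univ.filter fun x => ∃ i, g i = some x := by
    intro X hX
    have hc := I.card_le X (List.mem_toFinset.1 hX)
    refine Finset.mem_image.2 ⟨fun i => if h : (i : ℕ) < X.card then
      some (X.equivFin.symm ⟨i, h⟩ : Fin I.n) else none, Finset.mem_univ _, ?_⟩
    ext x
    simp only [Finset.mem_filter, Finset.mem_univ, true_and]
    constructor
    · rintro ⟨i, hi⟩
      split_ifs at hi with h
      · rw [← Option.some.inj hi]
        exact (X.equivFin.symm ⟨i, h⟩).2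
    · intro hx
      refine ⟨⟨X.equivFin ⟨x, hx⟩, (X.equivFin ⟨x, hx⟩).2.trans_le hc⟩, ?_⟩
      simp
  refine (Finset.card_le_card hsub).trans (Finset.card_image_le.trans ?_)
  simp [Finset.card_univ]

end SetCoverInstance

namespace RAM

/-- Needed for no-instances: an accepting run must coincide with the run that has been verified. -/
theorem Exec.deterministic {p : Prog} {σ τ τ' : State} {c c' : ℕ} (h : Exec p σ c τ)
    (h' : Exec p σ c' τ') : τ = τ' := by
  induction h generalizing c' τ' with
  | const | arith | load | store | coin => cases h'; rfl
  | seq _ _ ih₁ ih₂ =>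
    cases h' with
    | seq h₁ h₂ => obtain rfl := ih₁ h₁; exact ih₂ h₂
  | branch_true h0 _ ih =>
    cases h' with
    | branch_true _ h => exact ih h
    | branch_false h _ => exact absurd h h0
  | branch_false h0 _ ih =>
    cases h' with
    | branch_true h _ => exact absurd h0 h
    | branch_false _ h => exact ih h
  | loop_true h0 _ _ ih₁ ih₂ =>
    cases h' with
    | loop_true _ h₁ h₂ => obtain rfl := ih₁ h₁; exact ih₂ h₂
    | loop_false h => exact absurd h h0
  | loop_false h0 =>
    cases h' with
    | loop_true h _ _ => exact absurd h0 h
    | loop_false _ => rfl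

end RAM

/-! ### The randomized algorithm for set cover -/

open ArrayLang

namespace SetCoverInstance

variable {s : ℕ} (I : SetCoverInstance s)

/-- The verification task for an instance of set cover. -/
def task (ω : ℕ → Bool) (w : ℕ) : CoverTask where
  n := I.n
  t₀ := I.t
  fam := I.family
  inp := fun a => I.encode.getD a 0
  ω := ω
  w := w

/-- A bit length which suffices for the instance. -/
def bitLength (W : ℕ) : ℕ := W * (I.n + 1)

/-- All numbers are at most single exponential in n: masks need bm ≤ b(n + 1) bits, L needs at most
Qm, and the rest fits into 2n + 4. Hence W(n + 1) bits suffice for a constant W. -/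
theorem task_bounds {b Q W : ℕ} (hb : 0 < b) (hQ : 2 ≤ Q) (hW : b + Q + 4 ≤ W) (ω : ℕ → Bool) :
    (I.task ω (I.bitLength W)).Valid b Q ∧
      I.n + I.family.length + 2 < 2 ^ I.bitLength W ∧
      I.family.length * I.n + I.n + 3 < 2 ^ I.bitLength W := by
  have hf := I.length_family_le_two_pow
  have hn : I.n + 1 ≤ 2 ^ I.n := Nat.lt_two_pow_self
  have hdiv : I.n / b * b ≤ I.n := Nat.div_mul_le_self _ _
  have hdiv' : I.n / b ≤ I.n := Nat.div_le_self _ _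
  have hw : 2 * I.n + 4 ≤ I.bitLength W := by
    rw [bitLength]; nlinarith
  have hp : 2 ^ I.n * 2 ^ I.n * 16 ≤ 2 ^ I.bitLength W := by
    calc 2 ^ I.n * 2 ^ I.n * 16 = 2 ^ (2 * I.n + 4) := by ring
      _ ≤ _ := Nat.pow_le_pow_right (by norm_num) hw
  have h1 : 2 ^ I.n ≤ 2 ^ I.n * 2 ^ I.n := Nat.le_mul_of_pos_left _ (by positivity)
  have h2 : (I.n + 1) ^ 2 ≤ 2 ^ I.n * 2 ^ I.n := by rw [sq]; exact Nat.mul_le_mul hn hn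
  have h3 : I.family.length * I.n ≤ 2 ^ I.n * 2 ^ I.n := Nat.mul_le_mul hf (by omega)
  refine ⟨⟨hb, hQ, I.encode_getD_zero, I.encode_getD_one, fun j hj e he =>
    I.encode_getD_family j hj e he, fun i _ => I.encode_getD_digit i, ?_, ?_, ?_, ?_, ?_⟩, ?_, ?_⟩
  · change 9 * (I.n + 1) ^ 2 < 2 ^ I.bitLength W
    nlinarith
  · change I.family.length < 2 ^ I.bitLength W
    omega
  · change 2 ^ I.n + 2 * I.n < 2 ^ I.bitLength W
    omega
  · refine Nat.pow_le_pow_right (by norm_num) ?_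
    change b * (I.n / b + 1) ≤ W * (I.n + 1)
    nlinarith
  · change Q ^ (I.n / b + 1) < 2 ^ (W * (I.n + 1))
    calc Q ^ (I.n / b + 1) < (2 ^ Q) ^ (I.n / b + 1) :=
          Nat.pow_lt_pow_left Nat.lt_two_pow_self (Nat.succ_ne_zero _)
      _ = 2 ^ (Q * (I.n / b + 1)) := by rw [← pow_mul]
      _ ≤ _ := Nat.pow_le_pow_right (by norm_num) (Nat.mul_le_mul (by omega)
          (Nat.add_le_add_right hdiv' 1))
  · omega
  · omega

end SetCoverInstance

namespace ArrayLang

open RAM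

/-- Load the number of elements and the number of sets, and store the end of the relevant part of
the input in register `1`. -/
def prologue : Prog :=
  .seq (.load 3 5) <| .seq (.const 5 1) <| .seq (.load 5 5) <| .seq (.arith .times 1 3 5) <|
  .seq (.arith .plus 1 1 3) <| .seq (.const 5 3) (.arith .plus 1 1 5)

/-- Register 5 is initially zero, so the first load reads n. The arrays do not start empty: they
contain whatever digits of t lie behind the relevant input. This is harmless, since the program
writes array entries before reading them. -/
theorem exec_prologue {w : ℕ} (input : List ℕ) (ω : ℕ → Bool)
    (h0 : input.getD 0 0 < 2 ^ w) (h1 : input.getD 1 0 < 2 ^ w)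
    (hZ : input.getD 1 0 * input.getD 0 0 + input.getD 0 0 + 3 < 2 ^ w) :
    ∃ c τ, Exec prologue (initial input ω) c τ ∧ c ≤ 20 * (w + 1) ∧
      Agree ω (input.getD 1 0 * input.getD 0 0 + input.getD 0 0 + 3) τ
        { v := fun _ => 0
          inp := fun a => input.getD a 0
          arr := fun k i => input.getD
            (input.getD 1 0 * input.getD 0 0 + input.getD 0 0 + 3 + i * 8 + k) 0
          pos := 0 } := by
  set n := input.getD 0 0 with hn
  set f := input.getD 1 0 with hf
  refine ⟨_, _, .seq (.load _ _ _) (.seq (.const _ _ _) (.seq (.load _ _ _) (.seq (.arith _ _ _ _ _)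
    (.seq (.arith _ _ _ _ _) (.seq (.const _ _ _) (.arith _ _ _ _ _)))))), ?_, ?_⟩
  · have s1 : n.size ≤ w := Nat.size_le.2 h0
    have s2 : f.size ≤ w := Nat.size_le.2 h1
    have s3 : (n * f).size ≤ w := Nat.size_le.2 (by rw [mul_comm]; omega)
    have s4 : (n * f + n).size ≤ w := Nat.size_le.2 (by rw [mul_comm n f]; omega)
    have s5 : (n * f + n + 3).size ≤ w := Nat.size_le.2 (by rw [mul_comm n f]; omega)
    have e1 : Nat.size 1 = 1 := by decide
    have e3 : Nat.size 3 = 2 := by decide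
    simp [initial, State.setReg, Op.eval, ← hn, ← hf, e1, e3, -List.getD_eq_getElem?_getD]
    omega
  · constructor
    · intro x
      have x1 : 2 * x ≠ 1 := by omega
      have x3 : 2 * x ≠ 3 := by omega
      have x5 : 2 * x ≠ 5 := by omega
      simp [initial, State.setReg, x1, x3, x5]
    · simp [initial, State.setReg, Op.eval, ← hn, ← hf, mul_comm n f, -List.getD_eq_getElem?_getD]
    · intro a _
      rfl
    · intro k i
      rfl
    · funext i
      simp [initial, State.setReg]

end ArrayLang

namespace CoverTask

variable {K : Type*} [Field K] {h k r Q s : ℕ} (B : BlockData K h k r Q) (I : SetCoverInstance s)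

/-- A nonzero sum has a nonzero term, and such a term consists of three masks that partition the
padded ground set and can be covered within the guessed budgets. So there are no false positives. -/
theorem isYes_of_success (hQ : 0 < Q) (hb : 0 < 3 * h * r) {ω : ℕ → Bool} {w u : ℕ}
    (hs : Success B (I.task ω w) u) : I.IsYes := by
  classical
  rw [Success, B.value_eq hQ] at hs
  obtain ⟨A₁, -, h1⟩ := Finset.exists_ne_zero_of_sum_ne_zero hs
  obtain ⟨A₂, -, h2⟩ := Finset.exists_ne_zero_of_sum_ne_zero h1
  obtain ⟨A₃, -, h3⟩ := Finset.exists_ne_zero_of_sum_ne_zero h2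
  have hp := left_ne_zero_of_mul h3
  have h12 := left_ne_zero_of_mul (right_ne_zero_of_mul h3)
  have key : ∀ κ N, (trialInput B (I.task ω w) u κ N : K) ≠ 0 →
      CoveredBy I.family ((I.task ω w).guess u κ) (B.mask ((I.task ω w).m (3 * h * r)) N) := by
    intro κ N hne
    by_contra hc
    refine hne (if_neg fun hand => hc hand.2)
  have hsum := (I.task ω w).guess_sum u
  refine I.isYes_of_partition (N := 3 * h * r * (I.task ω w).m (3 * h * r)) ?_
    (by_contra fun hne => hp (if_neg hne)) (key 0 _ (left_ne_zero_of_mul h12))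
    (key 1 _ (right_ne_zero_of_mul h12)) (key 2 _ (right_ne_zero_of_mul (right_ne_zero_of_mul h3)))
    (hsum.trans_le (min_le_left _ _))
  have := Nat.lt_div_mul_add (a := I.n) hb
  change I.n ≤ 3 * h * r * (I.n / (3 * h * r) + 1)
  linarith

theorem two_thirds_le_success (B : BlockData K h (h + 2 * (s + 1)) r Q) (hQ : 0 < Q) (hh : 0 < h)
    (hyes : I.IsYes) (w : ℕ) :
    2 / 3 ≤ RAM.fairCoins {ω | ∃ u < 9 * (min I.t I.n + 1) * (min I.t I.n + 1),
      Success B (I.task ω w) u} := by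
  set m := I.n / (3 * h * r) + 1 with hm
  set t := min I.t I.n with ht
  obtain ⟨t₁, t₂, t₃, x, y, z, hsum, hp, hx, hy, hz, cx, cy, cz⟩ :=
    I.exists_partition_of_isYes hyes hh (R := r * m)
  obtain ⟨A₁, hA₁, rfl⟩ := B.exists_mask hx
  obtain ⟨A₂, hA₂, rfl⟩ := B.exists_mask hy
  obtain ⟨A₃, hA₃, rfl⟩ := B.exists_mask hz
  rw [← mul_assoc] at hp
  set θ : ℕ → ℕ := fun κ => if κ = 0 then t₁ else if κ = 1 then t₂ else t₃ with hθ
  set A : ℕ → ℕ := fun κ => if κ = 0 then A₁ else if κ = 1 then A₂ else A₃ with hA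
  have ht₂ : t₂ < t + 1 - t₁ := by omega
  -- Nine trial numbers that decode to the same guess: t₁ is the remainder modulo t + 1, and the
  -- quotient is congruent to t₂ modulo t + 1 - t₁.
  set u : Fin 9 → ℕ := fun i => (i * (t + 1 - t₁) + t₂) * (t + 1) + t₁ with hu
  have hmod : ∀ i, u i % (t + 1) = t₁ := fun i => by
    rw [hu]
    dsimp only
    rw [mul_comm, Nat.mul_add_mod, Nat.mod_eq_of_lt (by omega)]
  have hdiv : ∀ i, u i / (t + 1) = i * (t + 1 - t₁) + t₂ := fun i => by
    rw [hu]
    dsimp only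
    rw [mul_comm, Nat.mul_add_div (by omega), Nat.div_eq_of_lt (by omega), add_zero]
  have hdm : ∀ i, u i / (t + 1) % (t + 1 - t₁) = t₂ := fun i => by
    rw [hdiv, mul_comm, Nat.mul_add_mod, Nat.mod_eq_of_lt ht₂]
  have hguess : ∀ ω i, (I.task ω w).guess (u i) = θ := by
    intro ω i
    funext κ
    have e : (I.task ω w).t = t := rfl
    rw [guess, e, hmod, hdm, hθ]
    dsimp only
    split_ifs <;> omega
  have hinj : Function.Injective u := by
    intro i j hij
    have h1 := hdiv i
    rw [hij, hdiv j] at h1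
    exact Fin.ext (Nat.eq_of_mul_eq_mul_right (by omega : 0 < t + 1 - t₁) (by omega))
  have hult : ∀ i, u i < 9 * (t + 1) * (t + 1) := by
    intro i
    have hi := i.2
    have h1 : (i : ℕ) * (t + 1 - t₁) + t₂ < 9 * (t + 1) := by
      calc (i : ℕ) * (t + 1 - t₁) + t₂ < i * (t + 1 - t₁) + (t + 1 - t₁) := by omega
        _ = (i + 1) * (t + 1 - t₁) := by ring
        _ ≤ 9 * (t + 1) := Nat.mul_le_mul hi (by omega)
    exact (Nat.div_lt_iff_lt_mul (by omega)).1 ((hdiv i).trans_lt h1)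
  have := B.two_thirds_le_nonzero hQ m (fun κ N => CoveredBy I.family (θ κ) (B.mask m N)) u hinj A
    (fun κ hκ => by interval_cases κ <;> simpa [hA]) (fun κ hκ => by
      interval_cases κ <;> simpa [hA, hθ]) (by simpa [hA] using hp)
  refine this.trans (measure_mono ?_)
  rintro ω ⟨i, hi⟩
  refine ⟨u i, hult i, ?_⟩
  rw [Success, trialInput, hguess]
  exact hi

end CoverTask

section Algorithm

variable {K : Type*} [Field K] {h k r Q s : ℕ} (B : BlockData K h k r Q) (E : FieldCode K)

/-- The machine program for set cover. -/
def setCoverProg : RAM.Prog := .seq prologue ((setCoverStmt B E).code 1)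

theorem exec_setCoverProg {W : ℕ} (hb : 0 < 3 * h * r) (hQ : 2 ≤ Q)
    (hW : 3 * h * r + Q + E.size + 4 ≤ W) (I : SetCoverInstance s) (ω : ℕ → Bool) :
    ∃ c τ, RAM.Exec (setCoverProg B E) (RAM.initial I.encode ω) c τ ∧
      c ≤ 20 * (I.bitLength W + 1) +
        (setCoverStmt B E).maxSteps ((I.task ω (I.bitLength W)).setting (3 * h * r) Q).ref *
          (200 * (((setCoverStmt B E).width + 1) * (I.bitLength W + 1) + 1)) ∧
      τ.reg 0 = CoverTask.ind (∃ u < 9 * (min I.t I.n + 1) * (min I.t I.n + 1),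
        CoverTask.Success B (I.task ω (I.bitLength W)) u) := by
  obtain ⟨hT, h1, h2⟩ := I.task_bounds hb hQ (show 3 * h * r + Q + 4 ≤ W by omega) ω
  set w := I.bitLength W with hw
  have hWw : W ≤ w := Nat.le_mul_of_pos_right _ (Nat.succ_pos _)
  have hE : E.size ≤ 2 ^ (I.task ω w).w :=
    Nat.lt_two_pow_self.le.trans (Nat.pow_le_pow_right (by norm_num) (by
      change E.size ≤ w
      omega))
  obtain ⟨c₁, τ₁, x₁, b₁, hA⟩ := exec_prologue (w := w) I.encode ω
    (by rw [I.encode_getD_zero]; omega) (by rw [I.encode_getD_one]; omega)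
    (by rw [I.encode_getD_zero, I.encode_getD_one]; exact h2)
  simp only [I.encode_getD_zero, I.encode_getD_one] at hA
  obtain ⟨g₁, g₂, g₃⟩ := CoverTask.good_setCover B E hT hE
    (st := { v := fun _ => 0
             inp := fun a => I.encode.getD a 0
             arr := fun k i => I.encode.getD (I.family.length * I.n + I.n + 3 + i * 8 + k) 0
             pos := 0 }) rfl rfl
  obtain ⟨c₂, τ₂, x₂, b₂, hA₂, -, -⟩ := Stmt.exec (w := w) (by omega) h2 (setCoverStmt B E)
    (Nat.le_succ _) (Nat.succ_pos _)
    ⟨fun _ => by positivity, fun a _ => (I.encode_getD_le a).trans_lt h1,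
      fun k i => (I.encode_getD_le _).trans_lt h1⟩ g₁ 1 one_pos τ₁ hA
  refine ⟨_, _, .seq x₁ x₂, ?_, ?_⟩
  · exact Nat.add_le_add b₁ (b₂.trans (Nat.mul_le_mul_right _ g₂))
  · rw [show (0 : ℕ) = 2 * 0 from rfl, hA₂.reg]
    exact g₃

theorem exists_setCover_algorithm (B : BlockData K h (h + 2 * (s + 1)) r Q) (hh : 0 < h)
    (hr : 0 < r) (hQ : 2 ≤ Q) : ∃ C A : ℕ,
      RAM.IsRandomizedAlgorithm (setCoverProg B E) SetCoverInstance.encode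
        (SetCoverInstance.IsYes (s := s))
        (fun I => C * (((I.n : ℝ) + 1) ^ A * (Q : ℝ) ^ (I.n / (3 * h * r) + 1))) := by
  have hb : 0 < 3 * h * r := by positivity
  obtain ⟨c, hc⟩ := Stmt.CostBound.setCover E (show 0 < Q by omega) B
  set W := 3 * h * r + Q + E.size + 4 with hW
  set ℓ := (setCoverStmt B E).width + 1 with hℓ
  -- The step count is cubic in (n + 1)^(s + 1), which bounds n + 1 and the number of sets; one
  -- further factor n + 1 is the bit length.
  refine ⟨20 * (W + 1) + c * (200 * (ℓ * (W + 1) + 1)), 3 * (s + 1) + 1, fun I => ⟨fun ω => ?_,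
    fun hyes => ?_, fun hno ω hacc => ?_⟩⟩
  · obtain ⟨c', τ, hx, hc', -⟩ := exec_setCoverProg B E hb hQ hW.ge I ω
    refine ⟨c', τ, hx, ?_⟩
    have hG := hc (I.task ω (I.bitLength W)) ((I.n + 1) ^ (s + 1))
      (Nat.le_self_pow (Nat.succ_ne_zero s) _)
      (I.length_family_le_pow.trans (Nat.pow_le_pow_right (by omega) (Nat.le_succ s)))
    set X := (I.n + 1) ^ (3 * (s + 1) + 1) * Q ^ (I.n / (3 * h * r) + 1) with hX
    have hL : 1 ≤ Q ^ (I.n / (3 * h * r) + 1) := Nat.one_le_pow _ _ (by omega)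
    have hwn : I.bitLength W + 1 ≤ (W + 1) * (I.n + 1) := by
      rw [SetCoverInstance.bitLength]; nlinarith
    have hnX : I.n + 1 ≤ X :=
      (Nat.le_self_pow (by omega) _).trans (Nat.le_mul_of_pos_right _ hL)
    have key : c' ≤ (20 * (W + 1) + c * (200 * (ℓ * (W + 1) + 1))) * X := by
      calc c' ≤ 20 * ((W + 1) * (I.n + 1)) + c * (((I.n + 1) ^ (s + 1)) ^ 3 *
            (Q ^ (I.n / (3 * h * r) + 1)) ^ 1) *
            (200 * (ℓ * ((W + 1) * (I.n + 1)) + 1 * (I.n + 1))) := by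
            refine hc'.trans (Nat.add_le_add (Nat.mul_le_mul_left _ hwn)
              (Nat.mul_le_mul hG (Nat.mul_le_mul_left _ (Nat.add_le_add
                (Nat.mul_le_mul_left _ hwn) (by omega)))))
        _ = 20 * (W + 1) * (I.n + 1) + c * (200 * (ℓ * (W + 1) + 1)) * X := by
            rw [hX, ← pow_mul, mul_comm (s + 1) 3]; ring
        _ ≤ 20 * (W + 1) * X + c * (200 * (ℓ * (W + 1) + 1)) * X :=
            Nat.add_le_add_right (Nat.mul_le_mul_left _ hnX) _
        _ = _ := by ring
    have := (Nat.cast_le (α := ℝ)).2 key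
    rw [Nat.cast_mul, hX] at this
    push_cast at this ⊢
    exact this
  · refine (CoverTask.two_thirds_le_success I B (by omega) hh hyes (I.bitLength W)).trans
      (measure_mono fun ω hω => ?_)
    obtain ⟨c', τ, hx, -, h0⟩ := exec_setCoverProg B E hb hQ hW.ge I ω
    exact ⟨c', τ, hx, h0.trans (CoverTask.ind_of hω)⟩
  · obtain ⟨c', τ, hx, hτ⟩ := hacc
    obtain ⟨c'', τ', hx', -, h0⟩ := exec_setCoverProg B E hb hQ hW.ge I ω
    rw [← hx.deterministic hx', hτ] at h0
    by_cases hs : ∃ u < 9 * (min I.t I.n + 1) * (min I.t I.n + 1),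
        CoverTask.Success B (I.task ω (I.bitLength W)) u
    · obtain ⟨u, -, hu⟩ := hs
      exact hno (CoverTask.isYes_of_success B I (by omega) hb hu)
    · rw [CoverTask.ind_of_not hs] at h0
      exact one_ne_zero h0

end Algorithm

theorem corollary2 {F : Type*} [Field F] (hARC : AsymptoticRankConjecture F)
    (ε : ℝ) (hε : 0 < ε) (s : ℕ) :
    ∃ (p : RAM.Prog) (C : ℝ),
      RAM.IsRandomizedAlgorithm p SetCoverInstance.encode (SetCoverInstance.IsYes (s := s))
        (fun I => C * (3 / (2 : ℝ) ^ ((2 : ℝ) / 3) + ε) ^ I.n) := by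
  set γ : ℝ := 3 / (2 : ℝ) ^ ((2 : ℝ) / 3) with hγ
  have hγ1 : 1 ≤ γ := by
    rw [hγ, le_div_iff₀ (by positivity), one_mul]
    calc (2 : ℝ) ^ ((2 : ℝ) / 3) ≤ 2 ^ (1 : ℝ) :=
          Real.rpow_le_rpow_of_exponent_le (by norm_num) (by norm_num)
      _ ≤ 3 := by norm_num
  -- Half of ε pays for the finite block length, the other half absorbs the polynomial factor.
  set g : ℝ := γ + ε / 2 with hg
  have hg1 : 1 ≤ g := by linarith
  -- The slack 2(s + 1) is the error of the three-colouring for items of size at most s + 1.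
  obtain ⟨K, iK, iF, h, r, Q, B, hh, hr, hQ, hQg⟩ :=
    exists_blockData hARC (2 * (s + 1)) (g := g) (by linarith)
  obtain ⟨E⟩ := exists_fieldCode K
  obtain ⟨C, A, hp⟩ := exists_setCover_algorithm E B hh hr hQ
  obtain ⟨M, hM0, hM⟩ := exists_bound_pow_mul_pow (show 0 < g by linarith)
    (show g < γ + ε by linarith) A
  refine ⟨setCoverProg B E, C * Q * M, fun I => ⟨fun ω => ?_, (hp I).2⟩⟩
  obtain ⟨c, τ, hx, hc⟩ := (hp I).1 ω
  refine ⟨c, τ, hx, hc.trans ?_⟩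
  have h1 : (Q : ℝ) ^ (I.n / (3 * h * r)) ≤ g ^ I.n := by
    calc (Q : ℝ) ^ (I.n / (3 * h * r)) ≤ (g ^ (3 * h * r)) ^ (I.n / (3 * h * r)) :=
          pow_le_pow_left₀ (by positivity) hQg _
      _ = g ^ (3 * h * r * (I.n / (3 * h * r))) := by rw [← pow_mul]
      _ ≤ g ^ I.n := pow_le_pow_right₀ hg1 (Nat.mul_div_le _ _)
  calc (C : ℝ) * (((I.n : ℝ) + 1) ^ A * (Q : ℝ) ^ (I.n / (3 * h * r) + 1))
      = C * Q * (((I.n : ℝ) + 1) ^ A * (Q : ℝ) ^ (I.n / (3 * h * r))) := by ring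
    _ ≤ C * Q * (((I.n : ℝ) + 1) ^ A * g ^ I.n) := by gcongr
    _ ≤ C * Q * (M * (γ + ε) ^ I.n) := mul_le_mul_of_nonneg_left (hM I.n) (by positivity)
    _ = _ := by ring
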